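/- Setting. Consider a two-arm randomized trial (arms $j=0,1$) with $K\ge 1$ post-baseline visits and $p$ baseline covariates. The complete data of a participant are $W=(\boldsymbol Y(0),\boldsymbol Y(1),\boldsymbol M(0),\boldsymbol M(1),\boldsymbol X)$: potential outcomes $\boldsymbol Y(j)\in\mathbb R^K$, potential non-missingness indicators $\boldsymbol M(j)\in\{0,1\}^K$ ($M_t(j)=1$ if the outcome at visit $t$ is observed) and covariates $\boldsymbol X\in\mathbb R^p$. Participants $i=1,2,\dots$ have i.i.d. complete data $W_i$ with law $P$, where: $\boldsymbol Y(0),\boldsymbol Y(1),\boldsymbol X$ have finite second moments; outcomes are missing completely at random, i.e. $\boldsymbol M(j)$ is independent of $(\boldsymbol X,\boldsymbol Y(j))$ for $j=0,1$ and $\boldsymbol M(0),\boldsymbol M(1)$ have the same distribution; and $P(\boldsymbol M(j)=(1,\dots,1))>0$. If participant $i$ is assigned to arm $A_i$, then $\boldsymbol X_i$, $\boldsymbol M_i=\boldsymbol M_i(A_i)$ and the entries of $\boldsymbol Y_i=\boldsymbol Y_i(A_i)$ at visits with $M_{it}=1$ are observed. The estimand is $\Delta^*=E[Y_K(1)]-E[Y_K(0)]$.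 Randomization is equal ($\pi_0=\pi_1=1/2$). Simple randomization: the $A_i$ are independent fair coin tosses, independent of the complete data. Stratified randomization: the stratum $S_i$ is a function of $\boldsymbol X_i$ with finitely many levels, whose indicators are affine functions of $\boldsymbol X_i$ almost surely (as when $\boldsymbol X$ contains the dummy variables of the strata but one); within each stratum, participants are assigned in order of enrolment by independent, uniformly random permuted blocks of a fixed even size (which may depend on the stratum), each with equally many participants in both arms, and independent of the complete data. Estimators. Each estimator $\widehat\Delta$ is a coordinate of an M-estimator $\widehat{\boldsymbol\theta}_n$, i.e. a measurable random vector which with probability tending to one lies in the parameter set $\mathbf\Theta$ and solves $\frac1n\sum_{i=1}^n\boldsymbol\psi(A_i,\boldsymbol X_i,\boldsymbol Y_i,\boldsymbol M_i;\boldsymbol\theta)=\boldsymbol 0$. * ANCOVA: $\boldsymbol\psi=I\{M_K=1\}(Y_K-\beta_0-\beta_A A-\boldsymbol\beta_{\boldsymbol X}^\top\boldsymbol X)(1,A,\boldsymbol X^\top)^\top$ and $\widehat\Delta=\widehat\beta_A$. * MMRM-I and MMRM-II: $\boldsymbol\psi$ is the likelihood score, from the observed outcomes, of the working model $Y_t=\beta_{0t}+\beta_{At}A+\boldsymbol\beta_{\boldsymbol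 X}^\top\boldsymbol X+\varepsilon_t$ (MMRM-I), respectively $Y_t=\beta_{0t}+\beta_{At}A+\boldsymbol\beta_{\boldsymbol Xt}^\top\boldsymbol X+\varepsilon_t$ (MMRM-II), $t=1,\dots,K$, with $\boldsymbol\varepsilon\sim N(\boldsymbol 0,\boldsymbol\Sigma)$ and $\boldsymbol\Sigma$ an unstructured positive definite matrix, whose entries on and below the diagonal are parameters; $\widehat\Delta=\widehat\beta_{AK}$. The working models need not be correct. Regularity conditions, for each of the three estimators, with $\boldsymbol\psi_j(\boldsymbol\theta)=\boldsymbol\psi(j,\boldsymbol X,\boldsymbol Y(j),\boldsymbol M(j);\boldsymbol\theta)$: (1) $\mathbf\Theta$ is compact (and for the MMRM estimators contains only parameters with $\boldsymbol\Sigma$ positive definite); (2) $E\|\boldsymbol\psi_j(\boldsymbol\theta)\|^2<\infty$ for $\boldsymbol\theta\in\mathbf\Theta$, $j=0,1$; (3) $\frac12\sum_{j}E[\boldsymbol\psi_j(\boldsymbol\theta)]=\boldsymbol 0$ has a unique solution $\underline{\boldsymbol\theta}$ in $\mathbf\Theta$, and it is an interior point of $\mathbf\Theta$; (4) almost surely $\boldsymbol\psi_j$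 is twice continuously differentiable in $\boldsymbol\theta$ at every point of $\mathbf\Theta$, and $\sup_{\boldsymbol\theta\in\mathbf\Theta}\|\boldsymbol\psi_j(\boldsymbol\theta)\|$ is bounded by an integrable function of the data; (5) the second derivatives of the entries of $\boldsymbol\psi_j$ are bounded by an integrable function of the data for all $\boldsymbol\theta$ in a neighbourhood of $\underline{\boldsymbol\theta}$; (6) $E\|\partial_{\boldsymbol\theta}\boldsymbol\psi_j(\underline{\boldsymbol\theta})\|^2<\infty$ and $\frac12\sum_jE[\partial_{\boldsymbol\theta}\boldsymbol\psi_j(\underline{\boldsymbol\theta})]$ is invertible. Claim. There are numbers $V^{(\mathrm{ANCOVA})},V^{(\mathrm{MMRM\text{-}I})},V^{(\mathrm{MMRM\text{-}II})}\ge 0$, depending only on the law $P$, the strata and the parameter sets, such that as $n\to\infty$: (a) $\sqrt n(\widehat\Delta^{(\mathrm{ANCOVA})}-\Delta^*)$ converges in distribution to $N(0,V^{(\mathrm{ANCOVA})})$ and $\sqrt n(\widehat\Delta^{(\mathrm{MMRM\text{-}II})}-\Delta^*)$ to $N(0,V^{(\mathrm{MMRM\text{-}II})})$, both under simple and under stratified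 randomization; so the asymptotic variances of these two estimators are the same under the two schemes; (b) under stratified randomization $\sqrt n(\widehat\Delta^{(\mathrm{MMRM\text{-}I})}-\Delta^*)$ converges in distribution to $N(0,V^{(\mathrm{MMRM\text{-}I})})$; (c) $V^{(\mathrm{ANCOVA})}\ge V^{(\mathrm{MMRM\text{-}II})}$ and $V^{(\mathrm{MMRM\text{-}I})}\ge V^{(\mathrm{MMRM\text{-}II})}$. -/

import Mathlib

open MeasureTheory ProbabilityTheory Filter Topology
open scoped NNReal ENNReal Matrix

noncomputable section

namespace RepeatedMeasures

/-! ### Data of a two-arm trial with `k + 1` visits and `p` baseline covariates -/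

/-- Complete data of one participant: the potential outcomes `Y_t(j)`, the potential non-missingness
indicators `M_t(j)` (`true` means observed) and the baseline covariates `X`. The arms are `0, 1`, the
visits `0, …, k`, so the last visit is `Fin.last k`. -/
abbrev FullData (p k : ℕ) : Type :=
  (Fin 2 → Fin (k + 1) → ℝ) × (Fin 2 → Fin (k + 1) → Bool) × (Fin p → ℝ)

/-- The triple `(X, Y, M)` recorded for a participant. The estimating functions below use `Y_t` only
where `M_t = true`. -/
abbrev ArmData (p k : ℕ) : Type :=
  (Fin p → ℝ) × (Fin (k + 1) → ℝ) × (Fin (k + 1) → Bool)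

/-- The potential outcome vector `Y(j)`. -/
def outcome {p k : ℕ} (j : Fin 2) (w : FullData p k) : Fin (k + 1) → ℝ := w.1 j

/-- The potential non-missingness vector `M(j)`. -/
def observed {p k : ℕ} (j : Fin 2) (w : FullData p k) : Fin (k + 1) → Bool := w.2.1 j

/-- The baseline covariates `X`. -/
def covariates {p k : ℕ} (w : FullData p k) : Fin p → ℝ := w.2.2

/-- What is recorded under arm `j`: `(X, Y(j), M(j))`. -/
def armData {p k : ℕ} (j : Fin 2) (w : FullData p k) : ArmData p k :=
  (covariates w, outcome j w, observed j w)

/-- Assumptions on the law `P` of the complete data: finite second moments, outcomes missing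
completely at random (in the same way in both arms), and a positive probability that all visits are
observed. -/
structure DataAssumptions {p k : ℕ} (P : Measure (FullData p k)) : Prop where
  outcome_memLp : ∀ j t, MemLp (fun w => outcome j w t) 2 P
  covariates_memLp : ∀ l, MemLp (fun w => covariates w l) 2 P
  missing_indep : ∀ j, IndepFun (observed j) (fun w => (covariates w, outcome j w)) P
  missing_identDistrib : IdentDistrib (observed 0) (observed 1) P P
  positivity : ∀ j, 0 < P {w | ∀ t, observed j w t = true}

/-- The indicators of the strata are affine functions of the covariates. This is so when the
covariates include the dummy variables of all strata but a reference one. -/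
def StrataInCovariates {p k : ℕ} {𝒮 : Type} [DecidableEq 𝒮] (P : Measure (FullData p k))
    (strat : (Fin p → ℝ) → 𝒮) : Prop :=
  ∀ s, ∃ (a : ℝ) (c : Fin p → ℝ), ∀ᵐ w ∂P,
    (if strat (covariates w) = s then (1 : ℝ) else 0) = a + ∑ l, c l * covariates w l

/-- The average treatment effect at the last visit, `Δ* = E[Y_K(1)] - E[Y_K(0)]`. -/
def treatmentEffect {p k : ℕ} (P : Measure (FullData p k)) : ℝ :=
  (∫ w, outcome 1 w (Fin.last k) ∂P) - ∫ w, outcome 0 w (Fin.last k) ∂P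

/-! ### Sampling and randomization -/

/-- The complete data `W 0, W 1, …` of the participants are i.i.d. with law `P`. -/
structure IsIIDSample {p k : ℕ} {Ω : Type} [MeasurableSpace Ω] (P : Measure (FullData p k))
    (μ : Measure Ω) (W : ℕ → Ω → FullData p k) : Prop where
  measurable : ∀ i, Measurable (W i)
  law : ∀ i, μ.map (W i) = P
  indep : iIndepFun W μ

/-- A randomization scheme: the property of the treatment assignments `A 0, A 1, …` of the
participants, given their complete data `W 0, W 1, …`, that the scheme is used. -/
abbrev Scheme (p k : ℕ) : Type 1 :=
  ∀ ⦃Ω : Type⦄ [MeasurableSpace Ω], Measure Ω → (ℕ → Ω → FullData p k) → (ℕ → Ω → Fin 2) → Prop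

/-- Simple randomization with equal allocation: the assignments are independent fair coin tosses,
independent of the complete data. -/
def SimpleRandomization (p k : ℕ) : Scheme p k := fun Ω _ μ W A =>
  (∀ i, Measurable (A i)) ∧ iIndepFun A μ ∧ (∀ i j, μ {ω | A i ω = j} = 1 / 2) ∧
    IndepFun (fun (ω : Ω) (i : ℕ) => A i ω) (fun (ω : Ω) (i : ℕ) => W i ω) μ

/-- The number of participants enrolled before participant `i` in the same stratum. -/
def stratumRank {p k : ℕ} {𝒮 : Type} [DecidableEq 𝒮] {Ω : Type} (strat : (Fin p → ℝ) → 𝒮)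
    (W : ℕ → Ω → FullData p k) (i : ℕ) (ω : Ω) : ℕ :=
  ((Finset.range i).filter
    fun i' => strat (covariates (W i' ω)) = strat (covariates (W i ω))).card

/-- The treatment sequences of length `2 * h` in which both arms occur equally often. -/
def balancedBlocks (h : ℕ) : Set (Fin (2 * h) → Fin 2) :=
  {f | (Finset.univ.filter fun x => f x = 1).card = h}

/-- Stratified randomization with equal allocation, by permuted blocks: in every stratum `s` the
participants are assigned, in the order of their enrolment, by successive independent blocks of size
`2 * (b s + 1)`, each uniformly distributed among the balanced ones; the blocks are independent of
the complete data. -/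
def StratifiedRandomization {p : ℕ} (k : ℕ) {𝒮 : Type} [DecidableEq 𝒮]
    (strat : (Fin p → ℝ) → 𝒮) : Scheme p k := fun Ω _ μ W A =>
  ∃ (b : 𝒮 → ℕ) (B : ∀ sl : 𝒮 × ℕ, Ω → Fin (2 * (b sl.1 + 1)) → Fin 2),
    (∀ sl, Measurable (B sl)) ∧ iIndepFun B μ ∧
    (∀ sl, μ.map (B sl) = uniformOn (balancedBlocks (b sl.1 + 1))) ∧
    IndepFun (fun (ω : Ω) (sl : 𝒮 × ℕ) => B sl ω) (fun (ω : Ω) (i : ℕ) => W i ω) μ ∧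
    ∀ i ω, A i ω =
      B (strat (covariates (W i ω)),
          stratumRank strat W i ω / (2 * (b (strat (covariates (W i ω))) + 1))) ω
        ⟨stratumRank strat W i ω % (2 * (b (strat (covariates (W i ω))) + 1)),
          Nat.mod_lt _ (by omega)⟩

/-! ### M-estimators, their regularity conditions and their asymptotic variance -/

/-- An estimating function `ψ(a, (x, y, m); θ)` with parameters and equations indexed by `ι`. -/
abbrev EstimatingFunction (p k : ℕ) (ι : Type) : Type :=
  Fin 2 → ArmData p k → (ι → ℝ) → (ι → ℝ)

/-- The population version `∑_j π_j E[ψ(j, X, Y(j), M(j); θ)]` with `π_0 = π_1 = 1 / 2`. -/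
def populationEquation {p k : ℕ} {ι : Type} [Fintype ι] (P : Measure (FullData p k))
    (ψ : EstimatingFunction p k ι) (θ : ι → ℝ) : ι → ℝ :=
  ∑ j : Fin 2, (1 / 2 : ℝ) • (∫ w, ψ j (armData j w) θ ∂P)

/-- Regularity conditions on an estimating function `ψ` with parameter set `Θ`; `θ₀` is the unique
root in `Θ` of the population equation, and lies in the interior of `Θ`. (The norm on `ι → ℝ` is the
maximum norm, equivalent to the Euclidean one.) -/
structure RegularityConditions {p k : ℕ} {ι : Type} [Fintype ι] (P : Measure (FullData p k))
    (ψ : EstimatingFunction p k ι) (Θ : Set (ι → ℝ)) (θ₀ : ι → ℝ) : Prop where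
  compact : IsCompact Θ
  moment : ∀ j, ∀ θ ∈ Θ, MemLp (fun w => ψ j (armData j w) θ) 2 P
  mem_interior : θ₀ ∈ interior Θ
  root : populationEquation P ψ θ₀ = 0
  root_unique : ∀ θ ∈ Θ, populationEquation P ψ θ = 0 → θ = θ₀
  smooth : ∀ j, ∀ᵐ w ∂P, ∀ θ ∈ Θ, ContDiffAt ℝ 2 (ψ j (armData j w)) θ
  dominated : ∀ j, ∃ u : ArmData p k → ℝ, Integrable (fun w => u (armData j w)) P ∧
    ∀ᵐ w ∂P, ∀ θ ∈ Θ, ‖ψ j (armData j w) θ‖ ≤ u (armData j w)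
  second_deriv : ∃ C > (0 : ℝ), ∀ j, ∃ v : ArmData p k → ℝ,
    Integrable (fun w => v (armData j w)) P ∧ ∀ᵐ w ∂P, ∀ r, ∀ θ, ‖θ - θ₀‖ < C →
      ‖iteratedFDeriv ℝ 2 (fun θ' => ψ j (armData j w) θ' r) θ‖ ≤ v (armData j w)
  deriv_moment : ∀ j, MemLp (fun w => fderiv ℝ (ψ j (armData j w)) θ₀) 2 P
  deriv_invertible :
    IsUnit (∑ j : Fin 2, (1 / 2 : ℝ) • (∫ w, fderiv ℝ (ψ j (armData j w)) θ₀ ∂P))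

/-- `θhat n` is the M-estimator from the first `n` participants: with probability tending to one it
lies in `Θ` and solves `n⁻¹ ∑_i ψ(A_i, X_i, Y_i, M_i; θ) = 0`, where `(X_i, Y_i, M_i)` is what is
recorded under the arm `A_i`. -/
structure IsMEstimator {p k : ℕ} {ι : Type} [Fintype ι] {Ω : Type} [MeasurableSpace Ω]
    (μ : Measure Ω) (W : ℕ → Ω → FullData p k) (A : ℕ → Ω → Fin 2)
    (ψ : EstimatingFunction p k ι) (Θ : Set (ι → ℝ)) (θhat : ℕ → Ω → ι → ℝ) : Prop where
  aemeasurable : ∀ n, AEMeasurable (θhat n) μ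
  solves : Tendsto (fun n : ℕ => μ {ω | ¬ (θhat n ω ∈ Θ ∧
    (n : ℝ)⁻¹ • ∑ i ∈ Finset.range n, ψ (A i ω) (armData (A i ω) (W i ω)) (θhat n ω) = 0)})
    atTop (𝓝 0)

/-- Under the randomization scheme `D`, the estimator `Δhat` of the average treatment effect `Δ*`
that is the coordinate `c` of the M-estimator of `θ ∈ Θ` given by `ψ` has asymptotic variance `v`:
`√n (Δhat - Δ*)` converges in distribution to `N(0, v)` in every trial with data law `P`. -/
def HasAsymptoticVariance {p k : ℕ} {ι : Type} [Fintype ι] (P : Measure (FullData p k))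
    (D : Scheme p k) (ψ : EstimatingFunction p k ι) (Θ : Set (ι → ℝ)) (c : ι) (v : ℝ≥0) : Prop :=
  ∀ (Ω : Type) [MeasurableSpace Ω] (μ : Measure Ω) [IsProbabilityMeasure μ]
    (W : ℕ → Ω → FullData p k) (A : ℕ → Ω → Fin 2) (θhat : ℕ → Ω → ι → ℝ),
    IsIIDSample P μ W → D μ W A → IsMEstimator μ W A ψ Θ θhat →
      TendstoInDistribution
        (fun (n : ℕ) (ω : Ω) => √(n : ℝ) * (θhat n ω c - treatmentEffect P))
        atTop (id : ℝ → ℝ) (fun _ => μ) (gaussianReal 0 v)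

/-! ### The ANCOVA estimator -/

/-- The number `1{a = 1}`. -/
def treated (a : Fin 2) : ℝ := if a = 1 then 1 else 0

/-- Parameters of ANCOVA: the intercept, the treatment effect and the covariate effects. -/
abbrev AncovaIndex (p : ℕ) : Type := Unit ⊕ Unit ⊕ Fin p

/-- The regressor of ANCOVA, `(1, A, X)`. -/
def ancovaRegressor {p : ℕ} (a : Fin 2) (x : Fin p → ℝ) : AncovaIndex p → ℝ :=
  Sum.elim (fun _ => 1) (Sum.elim (fun _ => treated a) x)

/-- The coordinate of the treatment effect. -/
def ancovaEffect (p : ℕ) : AncovaIndex p := .inr (.inl ())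

/-- The estimating function of ANCOVA (least squares among the participants observed at the last
visit): `1{M_K = 1} (Y_K - β_0 - β_A A - β_X ⬝ X) (1, A, X)`. -/
def ancovaPsi (p k : ℕ) : EstimatingFunction p k (AncovaIndex p) := fun a d θ =>
  ((if d.2.2 (Fin.last k) = true then 1 else 0) *
    (d.2.1 (Fin.last k) - θ (.inl ()) - θ (.inr (.inl ())) * treated a -
      ∑ l, θ (.inr (.inr l)) * d.1 l)) • ancovaRegressor a d.1

/-! ### The MMRM estimators -/

/-- The matrix `D_m`, whose columns are the unit vectors `e_t` with `m_t = 1`. -/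
def selection {k : ℕ} (m : Fin (k + 1) → Bool) :
    Matrix (Fin (k + 1)) {t : Fin (k + 1) // m t = true} ℝ :=
  Matrix.of fun t t' => if t = t'.1 then 1 else 0

/-- `V_m(Σ) = D_m (D_mᵀ Σ D_m)⁻¹ D_mᵀ` (which is zero if no visit is observed). -/
def obsPrecision {k : ℕ} (m : Fin (k + 1) → Bool) (S : Matrix (Fin (k + 1)) (Fin (k + 1)) ℝ) :
    Matrix (Fin (k + 1)) (Fin (k + 1)) ℝ :=
  selection m * ((selection m)ᵀ * S * selection m)⁻¹ * (selection m)ᵀ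

/-- Parameters of an MMRM model with covariate effects indexed by `U`: per visit the intercept and
the treatment effect, the covariate effects, and the entries on and below the diagonal of the
unstructured covariance matrix. -/
abbrev MmrmIndex (k : ℕ) (U : Type) : Type :=
  Fin (k + 1) ⊕ Fin (k + 1) ⊕ U ⊕ {rs : Fin (k + 1) × Fin (k + 1) // rs.2 ≤ rs.1}

/-- The symmetric matrix `Σ(α)` whose entries on and below the diagonal are `α`. -/
def covOfLower {k : ℕ} (α : {rs : Fin (k + 1) × Fin (k + 1) // rs.2 ≤ rs.1} → ℝ) :
    Matrix (Fin (k + 1)) (Fin (k + 1)) ℝ :=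
  Matrix.of fun r s => α ⟨(max r s, min r s), min_le_max⟩

/-- The covariance matrix contained in the parameter `θ`. -/
def mmrmCov {k : ℕ} {U : Type} (θ : MmrmIndex k U → ℝ) : Matrix (Fin (k + 1)) (Fin (k + 1)) ℝ :=
  covOfLower fun l => θ (.inr (.inr (.inr l)))

/-- The residual `Y - β_0 - A β_A - u(X)ᵀ β_u`, for the covariate matrix `ux = u(X)`. -/
def mmrmResidual {k : ℕ} {U : Type} [Fintype U] (ux : Matrix U (Fin (k + 1)) ℝ) (a : Fin 2)
    (y : Fin (k + 1) → ℝ) (θ : MmrmIndex k U → ℝ) : Fin (k + 1) → ℝ := fun t =>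
  y t - θ (.inl t) - treated a * θ (.inr (.inl t)) - (uxᵀ *ᵥ fun q => θ (.inr (.inr (.inl q)))) t

/-- The estimating function (likelihood score) of the MMRM model
`Y = β_0 + A β_A + u(X)ᵀ β_u + ε`, `ε ∼ N(0, Σ(α))`. With `r` the residual and `V = V_M(Σ(α))` its
blocks are `V r`, `A V r`, `u(X) V r` and `- tr(V ∂Σ/∂α_l) + rᵀ V (∂Σ/∂α_l) V r`. As `Σ` is linear in
`α`, the derivative `∂Σ/∂α_l` is `Σ` at the `l`-th unit vector. -/
def mmrmPsi {p : ℕ} (k : ℕ) {U : Type} [Fintype U]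
    (u : (Fin p → ℝ) → Matrix U (Fin (k + 1)) ℝ) : EstimatingFunction p k (MmrmIndex k U) :=
  fun a d θ =>
    let V := obsPrecision d.2.2 (mmrmCov θ)
    let r := mmrmResidual (u d.1) a d.2.1 θ
    Sum.elim (V *ᵥ r) <| Sum.elim (treated a • (V *ᵥ r)) <| Sum.elim (u d.1 *ᵥ (V *ᵥ r)) fun l =>
      - (V * covOfLower (Pi.single l 1)).trace + r ⬝ᵥ ((V * covOfLower (Pi.single l 1) * V) *ᵥ r)

/-- The coordinate of the treatment effect at the last visit. -/
def mmrmEffect (k : ℕ) (U : Type) : MmrmIndex k U := .inr (.inl (Fin.last k))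

/-- MMRM-I: the covariate effects are the same at all visits, `u(X) = X 1ᵀ`. -/
def mmrmOneDesign (p k : ℕ) (x : Fin p → ℝ) : Matrix (Fin p) (Fin (k + 1)) ℝ :=
  Matrix.of fun l _ => x l

/-- MMRM-II: the covariate effects depend on the visit, `u(X) = I ⊗ X`. -/
def mmrmTwoDesign (p k : ℕ) (x : Fin p → ℝ) : Matrix (Fin (k + 1) × Fin p) (Fin (k + 1)) ℝ :=
  Matrix.of fun tl t => if tl.1 = t then x tl.2 else 0

end RepeatedMeasures

end

/-!
The proof compares influence functions. Up to an error that vanishes in probability, each of the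
three estimators is a mean of `f (A i) (W i)`, where `f a` is `±2` times a weighted sum over the
visits of the residuals `Y_t(a) - E Y_t(a) - B_tᵀ (X - E X)`. The weights `G` depend on the
pattern of missingness only, vanish at the missing visits, and have as mean the unit vector of the
last visit: inverse probability weighting for ANCOVA, and `V_M(Σ) Q⁻¹ e_K` with `Q = E V_M(Σ)` for
MMRM. This form (`BalancedTrial.tendstoInDistribution_armwise`) needs no expansion of the
estimating function around the root. The equations for the intercepts of the two arms can be
solved exactly, given the estimated weights and covariate coefficients, and as missingness is
completely at random and the covariates are balanced between the arms, these two enter only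
through their limits. So consistency (`RegularityConditions.tendstoInMeasure`), a consequence of
compactness and of the uniform law of large numbers, is all that is used of the nuisance
parameters.

Both randomization schemes are treated at once, as a `BalancedTrial`: the assignments are
independent of the data given the strata, and the strata are balanced to the order `o(√n)`. Simple
randomization is the case of a single stratum, whose imbalance is harmless as the influence
functions have mean zero in both arms. The limit theorems come from
`BalancedTrial.tendsto_integral_prod`: conditionally on the strata and the assignments, the
characteristic function is a product over the participants whose limit is determined by the means
over the strata.

The population equations of ANCOVA make its residuals at the last visit orthogonal to the
covariates, and those of MMRM-II do so at all visits
(`RegularityConditions.mmrm_normal_equations`). As the strata are affine in the covariates, the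
residuals then have mean zero in every stratum on average over the arms, and stratification does
not change the variance. The covariance equations of MMRM-II force `Σ` to be the second moment
matrix `Λ` of the residuals, even though the model may be wrong
(`RegularityConditions.mmrmCov_eq_residualCov`): with `H = Λ - Σ` they give `E tr(V_M H V_M H) =
0`. Hence the variance of MMRM-II is four times the last diagonal entry of `Q⁻¹`, which is the
minimum in a generalized Gauss–Markov inequality (`dotProduct_inv_le_sum_variance`). Other
covariate coefficients shift the residuals by a function of the covariates, which adds to the
variance; by Jensen's inequality over the patterns of missingness, stratification cannot remove
more than is added (`asymptoticVariance_visitInfluence_le`).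
-/

noncomputable section

namespace RepeatedMeasures

/-! ### Randomization given the strata -/

/-- The number of the first `n` participants that belong to the stratum `s` and are assigned to the
arm `a`. -/
def cellCount {E 𝒮 Ω : Type} [DecidableEq 𝒮] (σ : E → 𝒮) (W : ℕ → Ω → E) (A : ℕ → Ω → Fin 2)
    (n : ℕ) (s : 𝒮) (a : Fin 2) (ω : Ω) : ℕ :=
  ((Finset.range n).filter fun i => σ (W i ω) = s ∧ A i ω = a).card

/-- What the asymptotic theory needs to know about a randomized trial whose participants have i.i.d.
data with law `P`: given the strata `σ (W i)`, the assignments are independent of the data, the two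
arms get the same share of every stratum, and the imbalance inside a stratum is `o(√n)` unless it
does not matter for the functions at hand. Independence given the strata is encoded by
`integral_prod`: a factor `F i a` can be replaced by any other with the same integrals over the
strata. -/
structure BalancedTrial {E 𝒮 Ω : Type} [MeasurableSpace E] [DecidableEq 𝒮] [MeasurableSpace Ω]
    (P : Measure E) (σ : E → 𝒮) (μ : Measure Ω) (W : ℕ → Ω → E) (A : ℕ → Ω → Fin 2) : Prop where
  measurable_data : ∀ i, Measurable (W i)
  law : ∀ i, μ.map (W i) = P
  indep : iIndepFun W μ
  measurable_arm : ∀ i, Measurable (A i)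
  integral_prod : ∀ (n : ℕ) (F F' : Fin n → Fin 2 → E → ℂ),
    (∀ i a, Measurable (F i a)) → (∀ i a w, ‖F i a w‖ ≤ 1) →
    (∀ i a, Measurable (F' i a)) → (∀ i a w, ‖F' i a w‖ ≤ 1) →
    (∀ i a s, ∫ w in σ ⁻¹' {s}, F i a w ∂P = ∫ w in σ ⁻¹' {s}, F' i a w ∂P) →
    ∫ ω, ∏ i : Fin n, F i (A i ω) (W i ω) ∂μ = ∫ ω, ∏ i : Fin n, F' i (A i ω) (W i ω) ∂μ
  share : ∀ s a, ∀ᵐ ω ∂μ,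
    Tendsto (fun n : ℕ => (cellCount σ W A n s a ω : ℝ) / n) atTop (𝓝 (P.real (σ ⁻¹' {s}) / 2))
  imbalance : ∀ f : Fin 2 → E → ℝ, (∀ a, ∫ w, f a w ∂P = 0) → ∀ s, ∀ᵐ ω ∂μ,
    Tendsto (fun n : ℕ => (√(n : ℝ))⁻¹ *
      (((cellCount σ W A n s 1 ω : ℝ) - cellCount σ W A n s 0 ω) *
        (∫ w in σ ⁻¹' {s}, f 1 w ∂P - ∫ w in σ ⁻¹' {s}, f 0 w ∂P))) atTop (𝓝 0)

section Averaging

variable {E 𝒮 Ω β : Type} [MeasurableSpace E] [Fintype 𝒮] [MeasurableSpace 𝒮]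
  [DiscreteMeasurableSpace 𝒮] [MeasurableSpace Ω] [MeasurableSpace β]
  {P : Measure E} {σ : E → 𝒮} {μ : Measure Ω} {W : ℕ → Ω → E} {A : ℕ → Ω → Fin 2} {Z : Ω → β}
  {n : ℕ} {α : (Fin n → 𝒮) → β → Fin n → Fin 2}

/-- If the assignments are a function of the strata and of a source `Z` of randomness independent of
the data, then a mixed moment is a combination of products of integrals over strata. -/
lemma integral_prod_eq_sum [IsProbabilityMeasure μ] (hσ : Measurable σ)
    (hWm : ∀ i, Measurable (W i))
    (hlaw : ∀ i, μ.map (W i) = P) (hind : iIndepFun W μ) (hZ : Measurable Z)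
    (hZW : IndepFun Z (fun (ω : Ω) (i : ℕ) => W i ω) μ) (hα : ∀ s, Measurable (α s))
    (hA : ∀ (i : Fin n) ω, A i ω = α (fun i' => σ (W i' ω)) (Z ω) i)
    (F : Fin n → Fin 2 → E → ℂ) (hF : ∀ i a, Measurable (F i a)) (hF1 : ∀ i a w, ‖F i a w‖ ≤ 1) :
    ∫ ω, ∏ i : Fin n, F i (A i ω) (W i ω) ∂μ =
      ∑ s : Fin n → 𝒮, ∑ a : Fin n → Fin 2, (∫ ω, (if α s (Z ω) = a then (1 : ℂ) else 0) ∂μ) *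
        ∏ i, ∫ w in σ ⁻¹' {s i}, F i (a i) w ∂P := by
  have hpt : ∀ ω, ∏ i : Fin n, F i (A i ω) (W i ω) = ∑ s : Fin n → 𝒮, ∑ a : Fin n → Fin 2,
      (if α s (Z ω) = a then (1 : ℂ) else 0) *
        ∏ i, (σ ⁻¹' {s i}).indicator (F i (a i)) (W i ω) := by
    intro ω
    rw [Finset.sum_eq_single (fun i : Fin n => σ (W i ω)),
      Finset.sum_eq_single (α (fun i : Fin n => σ (W i ω)) (Z ω))]
    · simp [hA]
    · intro a _ ha
      rw [if_neg (fun h => ha h.symm), zero_mul]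
    · simp
    · intro s _ hs
      obtain ⟨i, hi⟩ := Function.ne_iff.1 hs
      refine Finset.sum_eq_zero fun a _ => ?_
      rw [Finset.prod_eq_zero (Finset.mem_univ i), mul_zero]
      rw [Set.indicator_of_notMem]
      simpa using fun h => hi h.symm
    · simp
  have hmS : ∀ s : 𝒮, MeasurableSet (σ ⁻¹' {s}) := fun s => hσ (measurableSet_singleton s)
  have hmα : ∀ s a, MeasurableSet {b | α s b = a} := fun s a => hα s (measurableSet_singleton a)
  have hgm : ∀ s a, Measurable fun b => (if α s b = a then (1 : ℂ) else 0) := fun s a =>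
    Measurable.ite (hmα s a) measurable_const measurable_const
  have hhm : ∀ (s : Fin n → 𝒮) (a : Fin n → Fin 2),
      Measurable fun x : ℕ → E => ∏ i : Fin n, (σ ⁻¹' {s i}).indicator (F i (a i)) (x i) := by
    intro s a
    refine Finset.measurable_fun_prod _ fun i _ => ?_
    exact ((hF i (a i)).indicator (hmS _)).comp (measurable_pi_apply _)
  have hWm' : Measurable (fun (ω : Ω) (i : ℕ) => W i ω) := measurable_pi_lambda _ hWm
  have hint : ∀ s a, Integrable (fun ω => (if α s (Z ω) = a then (1 : ℂ) else 0) *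
      ∏ i : Fin n, (σ ⁻¹' {s i}).indicator (F i (a i)) (W i ω)) μ := by
    intro s a
    refine Integrable.of_bound (C := 1) ?_ (ae_of_all _ fun ω => ?_)
    · exact (((hgm s a).comp hZ).mul ((hhm s a).comp hWm')).aestronglyMeasurable
    · rw [norm_mul, norm_prod]
      refine mul_le_one₀ ?_ (Finset.prod_nonneg fun _ _ => norm_nonneg _)
        (Finset.prod_le_one (fun _ _ => norm_nonneg _) fun i _ => ?_)
      · split_ifs <;> simp
      · exact (norm_indicator_le_norm_self _ _).trans (hF1 _ _ _)
  simp_rw [hpt]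
  rw [integral_finsetSum _ fun s _ => integrable_finsetSum _ fun a _ => hint s a]
  refine Finset.sum_congr rfl fun s _ => ?_
  rw [integral_finsetSum _ fun a _ => hint s a]
  refine Finset.sum_congr rfl fun a _ => ?_
  rw [hZW.integral_fun_comp_mul_comp (f := fun b => (if α s b = a then (1 : ℂ) else 0))
    (g := fun x : ℕ → E => ∏ i : Fin n, (σ ⁻¹' {s i}).indicator (F i (a i)) (x i))
    hZ.aemeasurable hWm'.aemeasurable (hgm s a).aestronglyMeasurable (hhm s a).aestronglyMeasurable]
  congr 1
  have := (hind.precomp (g := fun i : Fin n => (i : ℕ)) Fin.val_injective).integral_fun_prod_comp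
    (f := fun i => (σ ⁻¹' {s i}).indicator (F i (a i)))
    (fun i => (hWm i).aemeasurable)
    (fun i => ((hF i (a i)).indicator (hmS _)).aestronglyMeasurable)
  refine this.trans (Finset.prod_congr rfl fun i _ => ?_)
  rw [← integral_map (f := (σ ⁻¹' {s i}).indicator (F i (a i))) (hWm i).aemeasurable
    ((hF i (a i)).indicator (hmS _)).aestronglyMeasurable, hlaw, integral_indicator (hmS _)]

/-- Assignments that are a function of the strata and of randomness independent of the data satisfy
the replacement property of `BalancedTrial`. -/
lemma integral_prod_congr [IsProbabilityMeasure μ] (hσ : Measurable σ)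
    (hWm : ∀ i, Measurable (W i))
    (hlaw : ∀ i, μ.map (W i) = P) (hind : iIndepFun W μ) (hZ : Measurable Z)
    (hZW : IndepFun Z (fun (ω : Ω) (i : ℕ) => W i ω) μ) (hα : ∀ s, Measurable (α s))
    (hA : ∀ (i : Fin n) ω, A i ω = α (fun i' => σ (W i' ω)) (Z ω) i)
    (F F' : Fin n → Fin 2 → E → ℂ)
    (hF : ∀ i a, Measurable (F i a)) (hF1 : ∀ i a w, ‖F i a w‖ ≤ 1)
    (hF' : ∀ i a, Measurable (F' i a)) (hF1' : ∀ i a w, ‖F' i a w‖ ≤ 1)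
    (h : ∀ i a s, ∫ w in σ ⁻¹' {s}, F i a w ∂P = ∫ w in σ ⁻¹' {s}, F' i a w ∂P) :
    ∫ ω, ∏ i : Fin n, F i (A i ω) (W i ω) ∂μ = ∫ ω, ∏ i : Fin n, F' i (A i ω) (W i ω) ∂μ := by
  rw [integral_prod_eq_sum hσ hWm hlaw hind hZ hZW hα hA F hF hF1,
    integral_prod_eq_sum hσ hWm hlaw hind hZ hZW hα hA F' hF' hF1']
  simp_rw [h]

end Averaging

/-- The strong law of large numbers for the relative frequency of a measurable set. -/
lemma ae_tendsto_frequency {E Ω : Type} [MeasurableSpace E] [MeasurableSpace Ω] {P : Measure E}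
    {μ : Measure Ω} [IsProbabilityMeasure μ] {W : ℕ → Ω → E} (hWm : ∀ i, Measurable (W i))
    (hlaw : ∀ i, μ.map (W i) = P) (hind : iIndepFun W μ) {B : Set E} [DecidablePred (· ∈ B)]
    (hB : MeasurableSet B) :
    ∀ᵐ ω ∂μ, Tendsto (fun n : ℕ => (((Finset.range n).filter fun i => W i ω ∈ B).card : ℝ) / n)
      atTop (𝓝 (P.real B)) := by
  have hm : Measurable (B.indicator fun _ => (1 : ℝ)) := measurable_const.indicator hB
  have h := strong_law_ae_real (μ := μ) (fun i ω => B.indicator (fun _ => (1 : ℝ)) (W i ω))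
    (Integrable.of_bound (C := 1) (hm.comp (hWm 0)).aestronglyMeasurable
      (ae_of_all _ fun ω => (norm_indicator_le_norm_self _ _).trans (by simp)))
    (fun i j hij => (hind.indepFun hij).comp hm hm)
    (fun i => ⟨(hm.comp (hWm i)).aemeasurable, (hm.comp (hWm 0)).aemeasurable, by
      have e : ∀ i, μ.map (fun ω => B.indicator (fun _ => (1 : ℝ)) (W i ω)) =
          P.map (B.indicator fun _ => (1 : ℝ)) := fun i => by
        rw [← hlaw i, Measure.map_map hm (hWm i)]; rfl
      rw [e, e]⟩)
  have hE : ∫ ω, B.indicator (fun _ => (1 : ℝ)) (W 0 ω) ∂μ = P.real B := by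
    rw [← integral_map (f := B.indicator fun _ => (1 : ℝ)) (hWm 0).aemeasurable
      hm.aestronglyMeasurable, hlaw, integral_indicator hB]
    simp
  rw [hE] at h
  filter_upwards [h] with ω hω
  convert! hω using 3 with n
  simp [Set.indicator_apply]

/-- The sign `+1` of the treatment arm and `-1` of the control arm. -/
def armSign (a : Fin 2) : ℝ := if a = 1 then 1 else -1

lemma abs_armSign (a : Fin 2) : |armSign a| = 1 := by
  unfold armSign; split_ifs <;> simp

/-- Simple randomization is a balanced trial with a single stratum. -/
lemma BalancedTrial.of_simple {p k : ℕ} {Ω : Type} [MeasurableSpace Ω]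
    {P : Measure (FullData p k)} [IsProbabilityMeasure P] {μ : Measure Ω} [IsProbabilityMeasure μ]
    {W : ℕ → Ω → FullData p k} {A : ℕ → Ω → Fin 2} (hW : IsIIDSample P μ W)
    (hA : SimpleRandomization p k μ W A) :
    BalancedTrial P (fun _ => ()) μ W A := by
  obtain ⟨hAm, hAi, hAu, hAW⟩ := hA
  refine ⟨hW.measurable, hW.law, hW.indep, hAm, ?_, ?_, ?_⟩
  · intro n F F' hF hF1 hF' hF1' h
    exact integral_prod_congr (α := fun _ z i => z i) (Z := fun ω (i : ℕ) => A i ω)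
      measurable_const hW.measurable hW.law hW.indep
      (measurable_pi_lambda _ hAm) hAW
      (fun s => measurable_pi_lambda _ fun i => measurable_pi_apply _)
      (fun i ω => rfl) F F' hF hF1 hF' hF1' h
  · intro s a
    have hlaw : ∀ i, μ.map (A i) = μ.map (A 0) := fun i => by
      refine Measure.ext_of_singleton fun j => ?_
      rw [Measure.map_apply (hAm i) (measurableSet_singleton j),
        Measure.map_apply (hAm 0) (measurableSet_singleton j)]
      exact (hAu i j).trans (hAu 0 j).symm
    have h := ae_tendsto_frequency hAm hlaw hAi (measurableSet_singleton a)
    have hr : (μ.map (A 0)).real {a} = 1 / 2 := by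
      rw [Measure.real, Measure.map_apply (hAm 0) (measurableSet_singleton a)]
      have := hAu 0 a
      simp only [Set.preimage, Set.mem_singleton_iff]
      rw [this]; simp
    rw [hr] at h
    filter_upwards [h] with ω hω
    simpa [cellCount] using hω
  · intro f hf s
    have : (fun _ : FullData p k => ()) ⁻¹' {s} = Set.univ := by ext; simp
    refine ae_of_all _ fun ω => ?_
    simp [this, hf]

section PermutedBlocks

/-- Complete balanced blocks cancel, so the imbalance is at most the length of a block. -/
lemma abs_sum_armSign_blocks_le (h : ℕ) (hh : 0 < 2 * h) (f : ℕ → Fin (2 * h) → Fin 2)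
    (hf : ∀ l, f l ∈ balancedBlocks h) (N : ℕ) :
    |∑ r ∈ Finset.range N, armSign (f (r / (2 * h)) ⟨r % (2 * h), Nat.mod_lt _ hh⟩)| ≤ 2 * h := by
  set g : ℕ → ℝ := fun r => armSign (f (r / (2 * h)) ⟨r % (2 * h), Nat.mod_lt _ hh⟩) with hg
  have hblock : ∀ q, ∑ x ∈ Finset.range (2 * h), g (2 * h * q + x) = 0 := by
    intro q
    rw [Finset.sum_range]
    have hx : ∀ x : Fin (2 * h), g (2 * h * q + x) = armSign (f q x) := by
      intro x
      have h1 : (2 * h * q + (x : ℕ)) / (2 * h) = q := by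
        rw [Nat.mul_add_div hh, Nat.div_eq_of_lt x.2, add_zero]
      have h2 : (2 * h * q + (x : ℕ)) % (2 * h) = x := by
        rw [Nat.mul_add_mod, Nat.mod_eq_of_lt x.2]
      simp only [hg]
      congr 2
      exact Fin.ext h2
    simp_rw [hx, armSign]
    have hc : (Finset.univ.filter fun x => f q x = 1).card = h := hf q
    have hc' : (Finset.univ.filter fun x => ¬ f q x = 1).card = h := by
      have := Finset.card_filter_add_card_filter_not (s := Finset.univ) (fun x => f q x = 1)
      simp only [Finset.card_univ, Fintype.card_fin] at this
      omega
    rw [Finset.sum_ite, Finset.sum_const, Finset.sum_const, hc, hc']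
    simp
  have hfull : ∀ q, ∑ r ∈ Finset.range (2 * h * q), g r = 0 := by
    intro q
    induction q with
    | zero => simp
    | succ q ih => rw [Nat.mul_succ, Finset.sum_range_add, ih, hblock, add_zero]
  have hN := Nat.div_add_mod N (2 * h)
  rw [← hN, Finset.sum_range_add, hfull, zero_add]
  refine (Finset.abs_sum_le_sum_abs _ _).trans ?_
  have hg1 : ∀ r, |g r| = 1 := fun r => abs_armSign _
  refine (Finset.sum_le_sum (g := fun _ => (1 : ℝ)) fun i _ => (hg1 _).le).trans ?_
  simp only [Finset.sum_const, Finset.card_range, nsmul_eq_mul, mul_one]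
  exact_mod_cast (Nat.mod_lt N hh).le

/-- Summing over the participants of a stratum is summing over their ranks in it. -/
lemma sum_rank_eq {𝒮 : Type} [DecidableEq 𝒮] (S : ℕ → 𝒮) (s : 𝒮) (χ : ℕ → ℝ) (n : ℕ) :
    ∑ i ∈ (Finset.range n).filter (fun i => S i = s),
      χ (((Finset.range i).filter fun i' => S i' = S i).card) =
    ∑ r ∈ Finset.range ((Finset.range n).filter fun i => S i = s).card, χ r := by
  induction n with
  | zero => simp
  | succ n ih =>
    rw [Finset.range_add_one, Finset.filter_insert]
    split_ifs with hs
    · rw [Finset.sum_insert (by simp), Finset.card_insert_of_notMem (by simp), ih,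
        Finset.sum_range_succ, hs, add_comm]
    · exact ih

lemma cellCount_sub {E 𝒮 Ω : Type} [DecidableEq 𝒮] (σ : E → 𝒮) (W : ℕ → Ω → E)
    (A : ℕ → Ω → Fin 2) (n : ℕ) (s : 𝒮) (ω : Ω) :
    (cellCount σ W A n s 1 ω : ℝ) - cellCount σ W A n s 0 ω =
      ∑ i ∈ (Finset.range n).filter (fun i => σ (W i ω) = s), armSign (A i ω) := by
  simp only [cellCount, Finset.card_filter, Finset.sum_filter]
  push_cast
  rw [← Finset.sum_sub_distrib]
  refine Finset.sum_congr rfl fun i _ => ?_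
  have : A i ω = 0 ∨ A i ω = 1 := by omega
  rcases this with h | h <;> by_cases hs : σ (W i ω) = s <;> simp [h, hs, armSign]

lemma cellCount_add {E 𝒮 Ω : Type} [DecidableEq 𝒮] (σ : E → 𝒮) (W : ℕ → Ω → E)
    (A : ℕ → Ω → Fin 2) (n : ℕ) (s : 𝒮) (ω : Ω) :
    (cellCount σ W A n s 1 ω : ℝ) + cellCount σ W A n s 0 ω =
      ((Finset.range n).filter (fun i => σ (W i ω) = s)).card := by
  simp only [cellCount, Finset.card_filter]
  push_cast
  rw [← Finset.sum_add_distrib]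
  refine Finset.sum_congr rfl fun i _ => ?_
  have : A i ω = 0 ∨ A i ω = 1 := by omega
  rcases this with h | h <;> by_cases hs : σ (W i ω) = s <;> simp [h, hs]

end PermutedBlocks

/-- Bounded imbalance within the strata gives both asymptotic properties of `BalancedTrial`. -/
lemma tendsto_of_bounded_imbalance {N0 N1 N : ℕ → ℝ} {q C : ℝ} (hs : ∀ n, N1 n + N0 n = N n)
    (hd : ∀ n, |N1 n - N0 n| ≤ C) (hN : Tendsto (fun n : ℕ => N n / n) atTop (𝓝 q)) :
    Tendsto (fun n : ℕ => N1 n / n) atTop (𝓝 (q / 2)) ∧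
      Tendsto (fun n : ℕ => N0 n / n) atTop (𝓝 (q / 2)) ∧
      ∀ c, Tendsto (fun n : ℕ => (√(n : ℝ))⁻¹ * ((N1 n - N0 n) * c)) atTop (𝓝 0) := by
  have h1 : Tendsto (fun n : ℕ => (N1 n - N0 n) / n) atTop (𝓝 0) :=
    squeeze_zero_norm (a := fun n : ℕ => C / n)
      (fun n => by rw [Real.norm_eq_abs, abs_div, Nat.abs_cast]; gcongr; exact hd n)
      (tendsto_const_nhds.div_atTop tendsto_natCast_atTop_atTop)
  refine ⟨?_, ?_, fun c => ?_⟩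
  · have := (hN.add h1).div_const 2
    rw [add_zero] at this
    refine this.congr fun n => ?_
    rw [← hs n]; ring
  · have := (hN.sub h1).div_const 2
    rw [sub_zero] at this
    refine this.congr fun n => ?_
    rw [← hs n]; ring
  · have hsq : Tendsto (fun n : ℕ => (√(n : ℝ))⁻¹ * (C * |c|)) atTop (𝓝 0) := by
      simpa using (tendsto_inv_atTop_zero.comp
        (Real.tendsto_sqrt_atTop.comp tendsto_natCast_atTop_atTop)).mul_const (C * |c|)
    refine squeeze_zero_norm (fun n => ?_) hsq
    rw [norm_mul, norm_mul, Real.norm_eq_abs, Real.norm_eq_abs, Real.norm_eq_abs,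
      abs_of_nonneg (inv_nonneg.2 (Real.sqrt_nonneg _))]
    gcongr
    exact hd n

/-- Stratified randomization by permuted blocks is a balanced trial. -/
lemma BalancedTrial.of_stratified {p k : ℕ} {𝒮 Ω : Type} [Fintype 𝒮] [DecidableEq 𝒮]
    [MeasurableSpace 𝒮] [DiscreteMeasurableSpace 𝒮] [MeasurableSpace Ω]
    {P : Measure (FullData p k)} [IsProbabilityMeasure P] {μ : Measure Ω} [IsProbabilityMeasure μ]
    {W : ℕ → Ω → FullData p k} {A : ℕ → Ω → Fin 2} {strat : (Fin p → ℝ) → 𝒮}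
    (hstrat : Measurable strat) (hW : IsIIDSample P μ W)
    (hA : StratifiedRandomization k strat μ W A) :
    BalancedTrial P (fun w => strat (covariates w)) μ W A := by
  obtain ⟨b, B, hBm, hBi, hBu, hBW, hA⟩ := hA
  set σ : FullData p k → 𝒮 := fun w => strat (covariates w) with hσdef
  have hσ : Measurable σ := hstrat.comp (measurable_snd.comp measurable_snd)
  -- the first `n` assignments, as a function `α n` of the first `n` strata and of the blocks
  let rank : ∀ n, (Fin n → 𝒮) → Fin n → ℕ := fun n s i =>
    (Finset.univ.filter fun i' : Fin n => i' < i ∧ s i' = s i).card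
  let α : ∀ n, (Fin n → 𝒮) → (∀ sl : 𝒮 × ℕ, Fin (2 * (b sl.1 + 1)) → Fin 2) → Fin n → Fin 2 :=
    fun n s z i => z (s i, rank n s i / (2 * (b (s i) + 1)))
      ⟨rank n s i % (2 * (b (s i) + 1)), Nat.mod_lt _ (by omega)⟩
  have hαm : ∀ n s, Measurable (α n s) := fun n s => measurable_pi_lambda _ fun i =>
    (measurable_pi_apply _).comp (measurable_pi_apply _)
  have hrank : ∀ n (i : Fin n) ω,
      stratumRank strat W i ω = rank n (fun i' => σ (W i' ω)) i := by
    intro n i ω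
    simp only [stratumRank, rank, hσdef]
    symm
    refine Finset.card_bij (fun (i' : Fin n) _ => (i' : ℕ)) ?_ ?_ ?_
    · intro i' hi'
      simpa using hi'
    · intro a _ c _ h
      exact Fin.ext h
    · intro i' hi'
      simp only [Finset.mem_filter, Finset.mem_range] at hi'
      exact ⟨⟨i', hi'.1.trans i.2⟩,
        Finset.mem_filter.2 ⟨Finset.mem_univ _, Fin.lt_def.2 hi'.1, hi'.2⟩, rfl⟩
  have hAα : ∀ n (i : Fin n) ω,
      A i ω = α n (fun i' => σ (W i' ω)) (fun sl => B sl ω) i := by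
    intro n i ω
    have key : ∀ s (r r' : ℕ), r = r' →
        B (s, r / (2 * (b s + 1))) ω ⟨r % (2 * (b s + 1)), Nat.mod_lt _ (by omega)⟩ =
          B (s, r' / (2 * (b s + 1))) ω ⟨r' % (2 * (b s + 1)), Nat.mod_lt _ (by omega)⟩ := by
      rintro s r _ rfl
      rfl
    exact (hA i ω).trans (key _ _ _ (hrank n i ω))
  have hZ : Measurable (fun ω (sl : 𝒮 × ℕ) => B sl ω) := measurable_pi_lambda _ hBm
  have hBbal : ∀ᵐ ω ∂μ, ∀ sl, B sl ω ∈ balancedBlocks (b sl.1 + 1) := by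
    refine ae_all_iff.2 fun sl => ?_
    have hne : (balancedBlocks (b sl.1 + 1)).Finite := Set.toFinite _
    have : ∀ᵐ x ∂(μ.map (B sl)), x ∈ balancedBlocks (b sl.1 + 1) := by
      rw [hBu sl, uniformOn]
      exact ae_cond_mem (Set.toFinite _).measurableSet
    exact ae_of_ae_map (hBm sl).aemeasurable this
  have hfreq : ∀ s, ∀ᵐ ω ∂μ, Tendsto (fun n : ℕ =>
      (((Finset.range n).filter fun i => σ (W i ω) = s).card : ℝ) / n)
        atTop (𝓝 (P.real (σ ⁻¹' {s}))) := by
    intro s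
    classical
    filter_upwards [ae_tendsto_frequency hW.measurable hW.law hW.indep
      (hσ (measurableSet_singleton s))] with ω hω
    convert! hω
  have hmain : ∀ s, ∀ᵐ ω ∂μ,
      Tendsto (fun n : ℕ => (cellCount σ W A n s 1 ω : ℝ) / n) atTop
        (𝓝 (P.real (σ ⁻¹' {s}) / 2)) ∧
      Tendsto (fun n : ℕ => (cellCount σ W A n s 0 ω : ℝ) / n) atTop
        (𝓝 (P.real (σ ⁻¹' {s}) / 2)) ∧
      ∀ c, Tendsto (fun n : ℕ => (√(n : ℝ))⁻¹ *
        (((cellCount σ W A n s 1 ω : ℝ) - cellCount σ W A n s 0 ω) * c)) atTop (𝓝 0) := by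
    intro s
    -- complete blocks are balanced, so that only the last block of the stratum contributes
    filter_upwards [hBbal, hfreq s] with ω hω hN
    refine tendsto_of_bounded_imbalance (C := 2 * ((b s + 1 : ℕ) : ℝ))
      (fun n => cellCount_add σ W A n s ω) (fun n => ?_) hN
    rw [cellCount_sub]
    have hpos : 0 < 2 * (b s + 1) := by omega
    have := abs_sum_armSign_blocks_le (b s + 1) hpos (fun l => B (s, l) ω) (fun l => hω (s, l))
      ((Finset.range n).filter fun i => σ (W i ω) = s).card
    rw [← sum_rank_eq (fun i => σ (W i ω)) s (fun r => armSign (B (s, r / (2 * (b s + 1))) ω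
      ⟨r % (2 * (b s + 1)), Nat.mod_lt _ hpos⟩)) n] at this
    refine le_trans (le_of_eq ?_) this
    congr 1
    refine Finset.sum_congr rfl fun i hi => ?_
    obtain rfl : σ (W i ω) = s := (Finset.mem_filter.1 hi).2
    rw [hA]
    rfl
  refine ⟨hW.measurable, hW.law, hW.indep, ?_, ?_, ?_, ?_⟩
  · intro i
    have : A i = fun ω => α (i + 1) (fun i' => σ (W i' ω)) (fun sl => B sl ω) (Fin.last i) := by
      funext ω
      exact hAα (i + 1) (Fin.last i) ω
    rw [this]
    have hm2 : Measurable fun x : (Fin (i + 1) → 𝒮) ×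
        (∀ sl : 𝒮 × ℕ, Fin (2 * (b sl.1 + 1)) → Fin 2) => α (i + 1) x.1 x.2 (Fin.last i) :=
      measurable_from_prod_countable_right fun s => (measurable_pi_apply _).comp (hαm _ s)
    exact hm2.comp ((measurable_pi_lambda _ fun i' => hσ.comp (hW.measurable _)).prodMk hZ)
  · intro n F F' hF hF1 hF' hF1' h
    exact integral_prod_congr (α := α n) hσ hW.measurable hW.law hW.indep hZ hBW (hαm n)
      (hAα n) F F' hF hF1 hF' hF1' h
  · intro s a
    filter_upwards [hmain s] with ω hω
    have : a = 0 ∨ a = 1 := by omega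
    rcases this with rfl | rfl
    · exact hω.2.1
    · exact hω.1
  · intro f _ s
    filter_upwards [hmain s] with ω hω
    exact hω.2.2 _

/-! ### Limits of products over the participants -/

/-- If `z n = 1 + L / n + o(1 / n)` and `N n / n → q` then `z n ^ N n → exp (q L)`. -/
lemma tendsto_pow_exp_of_tendsto_div {z : ℕ → ℂ} {L : ℂ} {N : ℕ → ℕ} {q : ℝ}
    (hz : Tendsto (fun n : ℕ => (n : ℂ) * (z n - 1)) atTop (𝓝 L))
    (hN : Tendsto (fun n : ℕ => (N n : ℝ) / n) atTop (𝓝 q)) :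
    Tendsto (fun n => z n ^ N n) atTop (𝓝 (Complex.exp (q * L))) := by
  have hz0 : Tendsto (fun n => z n - 1) atTop (𝓝 0) := by
    have h1 : Tendsto (fun n : ℕ => ((n : ℂ))⁻¹) atTop (𝓝 0) :=
      tendsto_inv₀_cobounded.comp (tendsto_natCast_atTop_cobounded)
    have := h1.mul hz
    rw [zero_mul] at this
    refine this.congr' ?_
    filter_upwards [eventually_ne_atTop 0] with n hn
    rw [inv_mul_cancel_left₀ (Nat.cast_ne_zero.2 hn)]
  have hlog : Tendsto (fun n : ℕ => (n : ℂ) * Complex.log (z n)) atTop (𝓝 L) := by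
    simpa using Complex.tendsto_nat_mul_log_one_add_of_tendsto hz
  have hNc : Tendsto (fun n : ℕ => ((N n : ℂ)) / n) atTop (𝓝 (q : ℂ)) := by
    have := (Complex.continuous_ofReal.tendsto q).comp hN
    refine this.congr fun n => ?_
    simp
  have hexp := (Complex.continuous_exp.tendsto _).comp (hNc.mul hlog)
  refine hexp.congr' ?_
  have hne : ∀ᶠ n in atTop, z n ≠ 0 := by
    have : ∀ᶠ n in atTop, z n - 1 ≠ -1 := hz0.eventually_ne (by norm_num)
    filter_upwards [this] with n hn h0
    exact hn (by rw [h0]; ring)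
  filter_upwards [eventually_ne_atTop 0, hne] with n hn hzn
  have hn' : (n : ℂ) ≠ 0 := Nat.cast_ne_zero.2 hn
  simp only [Function.comp]
  rw [show ((N n : ℂ)) / n * ((n : ℂ) * Complex.log (z n)) = (N n : ℂ) * Complex.log (z n) by
    field_simp, Complex.exp_nat_mul, Complex.exp_log hzn]

lemma measurable_eval_arm {E Ω α : Type} [MeasurableSpace E] [MeasurableSpace Ω]
    [MeasurableSpace α] {A : Ω → Fin 2} {W : Ω → E} (hA : Measurable A) (hW : Measurable W)
    {f : Fin 2 → E → α} (hf : ∀ a, Measurable (f a)) : Measurable fun ω => f (A ω) (W ω) := by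
  have : Measurable fun x : Fin 2 × E => f x.1 x.2 := measurable_from_prod_countable_right hf
  exact this.comp (hA.prodMk hW)

section Core

variable {E 𝒮 Ω : Type} [MeasurableSpace E] [Fintype 𝒮] [DecidableEq 𝒮] [MeasurableSpace 𝒮]
  [DiscreteMeasurableSpace 𝒮] [MeasurableSpace Ω]
  {P : Measure E} [IsProbabilityMeasure P] {σ : E → 𝒮} {μ : Measure Ω} [IsProbabilityMeasure μ]
  {W : ℕ → Ω → E} {A : ℕ → Ω → Fin 2}

omit [Fintype 𝒮] [DecidableEq 𝒮] [MeasurableSpace 𝒮] [DiscreteMeasurableSpace 𝒮] in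
/-- The average of `F` over a stratum, written so that it is `1` for a stratum of measure zero. -/
lemma stratumAverage_spec {F : E → ℂ} (hF : Measurable F)
    (hF1 : ∀ w, ‖F w‖ ≤ 1) (s : 𝒮) :
    (P.real (σ ⁻¹' {s}) : ℂ) *
        (1 + (P.real (σ ⁻¹' {s}) : ℂ)⁻¹ * ∫ w in σ ⁻¹' {s}, (F w - 1) ∂P) =
      ∫ w in σ ⁻¹' {s}, F w ∂P ∧
    ‖1 + (P.real (σ ⁻¹' {s}) : ℂ)⁻¹ * ∫ w in σ ⁻¹' {s}, (F w - 1) ∂P‖ ≤ 1 := by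
  have hint : IntegrableOn F (σ ⁻¹' {s}) P :=
    (Integrable.of_bound hF.aestronglyMeasurable 1 (ae_of_all _ hF1)).integrableOn
  have hsub : ∫ w in σ ⁻¹' {s}, (F w - 1) ∂P =
      ∫ w in σ ⁻¹' {s}, F w ∂P - (P.real (σ ⁻¹' {s}) : ℂ) := by
    rw [integral_sub hint (integrable_const _)]
    simp
  by_cases hp : P.real (σ ⁻¹' {s}) = 0
  · have h0 : P (σ ⁻¹' {s}) = 0 := by
      simpa [Measure.real, ENNReal.toReal_eq_zero_iff] using hp
    rw [hp, Measure.restrict_eq_zero.2 h0]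
    simp
  · have hp' : (P.real (σ ⁻¹' {s}) : ℂ) ≠ 0 := by exact_mod_cast hp
    have h1 : 1 + (P.real (σ ⁻¹' {s}) : ℂ)⁻¹ * ∫ w in σ ⁻¹' {s}, (F w - 1) ∂P =
        (P.real (σ ⁻¹' {s}) : ℂ)⁻¹ * ∫ w in σ ⁻¹' {s}, F w ∂P := by
      rw [hsub]; field_simp; ring
    rw [h1]
    refine ⟨by field_simp, ?_⟩
    have h2 : ‖∫ w in σ ⁻¹' {s}, F w ∂P‖ ≤ 1 * P.real (σ ⁻¹' {s}) :=
      norm_setIntegral_le_of_norm_le_const (measure_lt_top _ _) fun w _ => hF1 w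
    rw [norm_mul, norm_inv, Complex.norm_real, Real.norm_of_nonneg measureReal_nonneg]
    rw [inv_mul_le_iff₀ (lt_of_le_of_ne measureReal_nonneg (Ne.symm hp))]
    linarith

/-- The mean of a product over the participants, whose factors are `1 + O(1/n)` up to a factor `G`
that depends on the stratum only: given the strata, the other factors average out. -/
lemma BalancedTrial.tendsto_integral_prod (BT : BalancedTrial P σ μ W A) (hσ : Measurable σ)
    {F : ℕ → Fin 2 → E → ℂ} {G : ℕ → 𝒮 → ℂ} {L : 𝒮 → Fin 2 → ℂ}
    (hF : ∀ n a, Measurable (F n a)) (hF1 : ∀ n a w, ‖F n a w‖ ≤ 1) (hG : ∀ n s, ‖G n s‖ ≤ 1)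
    (hL : ∀ s a, Tendsto (fun n : ℕ => (n : ℂ) * ∫ w in σ ⁻¹' {s}, (F n a w - 1) ∂P) atTop
      (𝓝 (L s a))) :
    Tendsto (fun n : ℕ =>
      (∫ ω, ∏ i ∈ Finset.range n, (G n (σ (W i ω)) * F n (A i ω) (W i ω)) ∂μ) -
      (∫ ω, ∏ i ∈ Finset.range n, G n (σ (W i ω)) ∂μ) *
        Complex.exp ((1 / 2 : ℂ) * ∑ sa : 𝒮 × Fin 2, L sa.1 sa.2)) atTop (𝓝 0) := by
  set Φ : ℕ → 𝒮 → Fin 2 → ℂ := fun n s a =>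
    1 + (P.real (σ ⁻¹' {s}) : ℂ)⁻¹ * ∫ w in σ ⁻¹' {s}, (F n a w - 1) ∂P with hΦ
  have hmS : ∀ s : 𝒮, MeasurableSet (σ ⁻¹' {s}) := fun s => hσ (measurableSet_singleton s)
  have hΦ1 : ∀ n s a, ‖Φ n s a‖ ≤ 1 := fun n s a =>
    (stratumAverage_spec (hF n a) (hF1 n a) s).2
  have hGm : ∀ n, Measurable fun w => G n (σ w) := fun n => (Measurable.of_discrete).comp hσ
  have hΦm : ∀ n a, Measurable fun w => Φ n (σ w) a := fun n a =>
    (Measurable.of_discrete (f := fun s => Φ n s a)).comp hσ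
  set e : ℂ := Complex.exp ((1 / 2 : ℂ) * ∑ sa : 𝒮 × Fin 2, L sa.1 sa.2) with he
  -- averaging given the strata
  have havg : ∀ n, ∫ ω, ∏ i ∈ Finset.range n, (G n (σ (W i ω)) * F n (A i ω) (W i ω)) ∂μ =
      ∫ ω, (∏ i ∈ Finset.range n, G n (σ (W i ω))) *
        ∏ i ∈ Finset.range n, Φ n (σ (W i ω)) (A i ω) ∂μ := by
    intro n
    simp_rw [← Finset.prod_mul_distrib]
    have := BT.integral_prod n (fun _ a w => G n (σ w) * F n a w)
      (fun _ a w => G n (σ w) * Φ n (σ w) a) (fun i a => (hGm n).mul (hF n a))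
      (fun i a w => by
        rw [norm_mul]; exact mul_le_one₀ (hG _ _) (norm_nonneg _) (hF1 _ _ _))
      (fun i a => (hGm n).mul (hΦm n a))
      (fun i a w => by
        rw [norm_mul]; exact mul_le_one₀ (hG _ _) (norm_nonneg _) (hΦ1 _ _ _))
      (fun i a s => by
        have h1 : ∀ w ∈ σ ⁻¹' {s}, G n (σ w) * F n a w = G n s * F n a w := by
          rintro w rfl; rfl
        have h2 : ∀ w ∈ σ ⁻¹' {s}, G n (σ w) * Φ n (σ w) a = G n s * Φ n s a := by
          rintro w rfl; rfl
        rw [setIntegral_congr_fun (hmS s) h1, setIntegral_congr_fun (hmS s) h2,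
          integral_const_mul, ← (stratumAverage_spec (hF n a) (hF1 n a) s).1]
        simp only [integral_const, measureReal_restrict_apply_univ, Complex.real_smul, hΦ]
        ring)
    simpa only [Finset.prod_range] using this
  -- the averaged factors converge almost surely
  have hlim : ∀ᵐ ω ∂μ, Tendsto (fun n => ∏ i ∈ Finset.range n, Φ n (σ (W i ω)) (A i ω)) atTop
      (𝓝 e) := by
    have hsh : ∀ᵐ ω ∂μ, ∀ sa : 𝒮 × Fin 2, Tendsto
        (fun n : ℕ => (cellCount σ W A n sa.1 sa.2 ω : ℝ) / n) atTop
        (𝓝 (P.real (σ ⁻¹' {sa.1}) / 2)) := ae_all_iff.2 fun sa => BT.share sa.1 sa.2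
    filter_upwards [hsh] with ω hω
    have hprod : ∀ n, ∏ i ∈ Finset.range n, Φ n (σ (W i ω)) (A i ω) =
        ∏ sa : 𝒮 × Fin 2, Φ n sa.1 sa.2 ^ cellCount σ W A n sa.1 sa.2 ω := by
      intro n
      rw [← Finset.prod_fiberwise' (Finset.range n) (fun i => (σ (W i ω), A i ω))
        (fun sa => Φ n sa.1 sa.2)]
      refine Finset.prod_congr rfl fun sa _ => ?_
      rw [Finset.prod_const, cellCount]
      simp only [Prod.ext_iff]
    simp_rw [hprod, he, Finset.mul_sum, Complex.exp_sum]
    refine tendsto_finsetProd _ fun sa _ => ?_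
    have hmul : Tendsto (fun n : ℕ => (n : ℂ) * (Φ n sa.1 sa.2 - 1)) atTop
        (𝓝 ((P.real (σ ⁻¹' {sa.1}) : ℂ)⁻¹ * L sa.1 sa.2)) := by
      refine ((hL sa.1 sa.2).const_mul _).congr fun n => ?_
      simp only [hΦ]; ring
    convert! tendsto_pow_exp_of_tendsto_div hmul (hω sa) using 3
    by_cases hp : P.real (σ ⁻¹' {sa.1}) = 0
    · have h0 : P (σ ⁻¹' {sa.1}) = 0 := by
        simpa [Measure.real, ENNReal.toReal_eq_zero_iff] using hp
      have hL0 := hL sa.1 sa.2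
      rw [Measure.restrict_eq_zero.2 h0] at hL0
      have : L sa.1 sa.2 = 0 := by
        refine tendsto_nhds_unique hL0 (by simp)
      rw [this]; simp
    · have hp' : (P.real (σ ⁻¹' {sa.1}) : ℂ) ≠ 0 := by exact_mod_cast hp
      push_cast
      field_simp
  have hmΦ : ∀ n, Measurable fun ω => ∏ i ∈ Finset.range n, Φ n (σ (W i ω)) (A i ω) := fun n =>
    Finset.measurable_fun_prod _ fun i _ => measurable_eval_arm (BT.measurable_arm i)
      (BT.measurable_data i) (f := fun a w => Φ n (σ w) a) (hΦm n)
  have hmG : ∀ n, Measurable fun ω => ∏ i ∈ Finset.range n, G n (σ (W i ω)) := fun n =>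
    Finset.measurable_fun_prod _ fun i _ => (hGm n).comp (BT.measurable_data i)
  have hbG : ∀ n ω, ‖∏ i ∈ Finset.range n, G n (σ (W i ω))‖ ≤ 1 := fun n ω => by
    rw [norm_prod]; exact Finset.prod_le_one (fun _ _ => norm_nonneg _) fun _ _ => hG _ _
  have hbΦ : ∀ n ω, ‖∏ i ∈ Finset.range n, Φ n (σ (W i ω)) (A i ω)‖ ≤ 1 := fun n ω => by
    rw [norm_prod]; exact Finset.prod_le_one (fun _ _ => norm_nonneg _) fun _ _ => hΦ1 _ _ _
  have hDCT : Tendsto (fun n => ∫ ω, ‖(∏ i ∈ Finset.range n, Φ n (σ (W i ω)) (A i ω)) - e‖ ∂μ)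
      atTop (𝓝 0) := by
    have := tendsto_integral_of_dominated_convergence (μ := μ) (f := fun _ => (0 : ℝ))
      (F := fun n ω => ‖(∏ i ∈ Finset.range n, Φ n (σ (W i ω)) (A i ω)) - e‖)
      (fun _ => 1 + ‖e‖)
      (fun n => ((hmΦ n).sub_const e).norm.aestronglyMeasurable) (integrable_const _)
      (fun n => ae_of_all _ fun ω => by
        rw [norm_norm]
        exact (norm_sub_le _ _).trans (by gcongr; exact hbΦ n ω))
      (by
        filter_upwards [hlim] with ω hω
        simpa using (hω.sub_const e).norm)
    simpa using this
  refine squeeze_zero_norm (fun n => ?_) hDCT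
  have hi1 : Integrable (fun ω => (∏ i ∈ Finset.range n, G n (σ (W i ω))) *
      ∏ i ∈ Finset.range n, Φ n (σ (W i ω)) (A i ω)) μ :=
    Integrable.of_bound ((hmG n).mul (hmΦ n)).aestronglyMeasurable 1 (ae_of_all _ fun ω => by
      rw [norm_mul]; exact mul_le_one₀ (hbG n ω) (norm_nonneg _) (hbΦ n ω))
  have hi2 : Integrable (fun ω => ∏ i ∈ Finset.range n, G n (σ (W i ω))) μ :=
    Integrable.of_bound (hmG n).aestronglyMeasurable 1 (ae_of_all _ fun ω => hbG n ω)
  rw [havg, ← integral_mul_const, ← integral_sub hi1 (hi2.mul_const e)]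
  refine (norm_integral_le_integral_norm _).trans (integral_mono_of_nonneg
    (ae_of_all _ fun ω => norm_nonneg _) ?_ (ae_of_all _ fun ω => ?_))
  · refine (Integrable.of_bound (hmΦ n).aestronglyMeasurable 1
      (ae_of_all _ fun ω => hbΦ n ω)).sub (integrable_const e) |>.norm
  · dsimp only
    rw [← mul_sub, norm_mul]
    exact mul_le_of_le_one_left (norm_nonneg _) (hbG n ω)

end Core

/-! ### Convergence in distribution through characteristic functions -/

lemma tendstoInDistribution_of_charFun {Ω : Type} [MeasurableSpace Ω] {μ : Measure Ω}
    [IsProbabilityMeasure μ] {X : ℕ → Ω → ℝ} (hX : ∀ n, AEMeasurable (X n) μ) (ν : Measure ℝ)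
    [IsProbabilityMeasure ν]
    (h : ∀ t : ℝ, Tendsto (fun n => ∫ ω, Complex.exp (Complex.I * (t * X n ω : ℝ)) ∂μ) atTop
      (𝓝 (charFun ν t))) :
    TendstoInDistribution X atTop (id : ℝ → ℝ) (fun _ => μ) ν where
  forall_aemeasurable := hX
  aemeasurable_limit := aemeasurable_id
  tendsto := by
    refine ProbabilityMeasure.tendsto_iff_tendsto_charFun.2 fun t => ?_
    simp only [ProbabilityMeasure.coe_mk, Measure.map_id]
    refine (h t).congr fun n => ?_
    rw [charFun_apply_real, integral_map (hX n) (by fun_prop)]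
    refine integral_congr_ae (ae_of_all _ fun ω => ?_)
    dsimp only
    push_cast
    ring_nf

/-- Convergence in distribution to a constant is convergence in measure. -/
lemma tendstoInMeasure_of_tendstoInDistribution_dirac {Ω Ω' : Type} [MeasurableSpace Ω]
    [MeasurableSpace Ω'] {μ : Measure Ω} [IsProbabilityMeasure μ] {μ' : Measure Ω'}
    [IsProbabilityMeasure μ'] {X : ℕ → Ω → ℝ} {Z : Ω' → ℝ} {c : ℝ}
    (h : TendstoInDistribution X atTop Z (fun _ => μ) μ') (hZ : μ'.map Z = Measure.dirac c) :
    TendstoInMeasure μ X atTop fun _ => c := by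
  rw [tendstoInMeasure_iff_norm]
  intro ε hε
  have hcl : IsClosed {x : ℝ | ε ≤ ‖x - c‖} := isClosed_le continuous_const (by fun_prop)
  have hc : c ∉ {x : ℝ | ε ≤ ‖x - c‖} := by simpa using hε
  have h0 : (Measure.dirac c) {x : ℝ | ε ≤ ‖x - c‖} = 0 := by
    rw [Measure.dirac_apply' _ hcl.measurableSet, Set.indicator_of_notMem hc]
  have := ProbabilityMeasure.tendsto_measure_of_null_frontier_of_tendsto' h.tendsto
    (E := {x : ℝ | ε ≤ ‖x - c‖}) (by
      simp only [ProbabilityMeasure.coe_mk, hZ]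
      exact measure_mono_null hcl.frontier_subset h0)
  simp only [ProbabilityMeasure.coe_mk, hZ] at this
  rw [h0] at this
  refine this.congr fun n => ?_
  rw [Measure.map_apply_of_aemeasurable (h.forall_aemeasurable n) hcl.measurableSet]
  rfl

lemma norm_exp_I_mul_sub_le (x : ℝ) :
    ‖Complex.exp (Complex.I * x) - 1 - Complex.I * x‖ ≤ 3 * x ^ 2 := by
  by_cases hx : |x| ≤ 1
  · have h1 : ‖Complex.I * (x : ℂ)‖ ≤ 1 := by simpa using hx
    have := Complex.norm_exp_sub_one_sub_id_le h1
    simp only [norm_mul, Complex.norm_I, one_mul, Complex.norm_real, Real.norm_eq_abs, sq_abs]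
      at this
    nlinarith [sq_nonneg x]
  · push Not at hx
    have h1 : ‖Complex.exp (Complex.I * x) - 1‖ ≤ ‖x‖ := Real.norm_exp_I_mul_ofReal_sub_one_le
    have h2 := norm_sub_le (Complex.exp (Complex.I * x) - 1) (Complex.I * x)
    simp only [norm_mul, Complex.norm_I, one_mul, Complex.norm_real, Real.norm_eq_abs] at h1 h2
    nlinarith [sq_abs x]

lemma tendsto_natCast_mul_exp_sub_one (x : ℝ) :
    Tendsto (fun n : ℕ => (n : ℂ) * (Complex.exp (Complex.I * ((n : ℝ)⁻¹ * x : ℝ)) - 1)) atTop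
      (𝓝 (Complex.I * x)) := by
  rw [tendsto_iff_norm_sub_tendsto_zero]
  have hlim : Tendsto (fun n : ℕ => (n : ℝ)⁻¹ * (3 * x ^ 2)) atTop (𝓝 0) := by
    have := (tendsto_inv_atTop_zero.comp
      (tendsto_natCast_atTop_atTop (R := ℝ))).mul_const (3 * x ^ 2)
    rwa [zero_mul] at this
  refine squeeze_zero' (.of_forall fun n => norm_nonneg _) ?_ hlim
  filter_upwards [eventually_ne_atTop 0] with n hn
  have hn' : (n : ℝ) ≠ 0 := Nat.cast_ne_zero.2 hn
  have hnc : (n : ℂ) ≠ 0 := Nat.cast_ne_zero.2 hn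
  have : (n : ℂ) * (Complex.exp (Complex.I * ((n : ℝ)⁻¹ * x : ℝ)) - 1) - Complex.I * x =
      n * (Complex.exp (Complex.I * ((n : ℝ)⁻¹ * x : ℝ)) - 1 - Complex.I * ((n : ℝ)⁻¹ * x : ℝ)) := by
    push_cast
    field_simp
  rw [this, norm_mul, Complex.norm_natCast]
  calc (n : ℝ) * _ ≤ n * (3 * ((n : ℝ)⁻¹ * x) ^ 2) := by
        gcongr; exact norm_exp_I_mul_sub_le _
    _ = _ := by field_simp

lemma tendsto_natCast_mul_exp_sub_one_sub (x : ℝ) :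
    Tendsto (fun n : ℕ => (n : ℂ) * (Complex.exp (Complex.I * ((√(n : ℝ))⁻¹ * x : ℝ)) - 1 -
      Complex.I * ((√(n : ℝ))⁻¹ * x : ℝ))) atTop (𝓝 (-(x ^ 2 / 2 : ℝ))) := by
  rw [tendsto_iff_norm_sub_tendsto_zero]
  have hsq : Tendsto (fun n : ℕ => √(n : ℝ)) atTop atTop :=
    Real.tendsto_sqrt_atTop.comp tendsto_natCast_atTop_atTop
  have hlim : Tendsto (fun n : ℕ => (√(n : ℝ))⁻¹ * |x| ^ 3) atTop (𝓝 0) := by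
    simpa using (tendsto_inv_atTop_zero.comp hsq).mul_const (|x| ^ 3)
  refine squeeze_zero' (.of_forall fun n => norm_nonneg _) ?_ hlim
  filter_upwards [eventually_ne_atTop 0, hsq.eventually_ge_atTop |x|] with n hn hxn
  have hpos : 0 < √(n : ℝ) := Real.sqrt_pos.2 (by positivity)
  have hsqn : √(n : ℝ) ^ 2 = n := Real.sq_sqrt (Nat.cast_nonneg n)
  set y : ℝ := (√(n : ℝ))⁻¹ * x with hy
  have hy1 : |y| ≤ 1 := by
    rw [hy, abs_mul, abs_of_pos (inv_pos.2 hpos), inv_mul_le_iff₀ hpos, mul_one]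
    exact hxn
  have hny : (n : ℝ) * y ^ 2 = x ^ 2 := by
    rw [hy, mul_pow, inv_pow, hsqn]
    field_simp
  -- third-order Taylor bound at `y = x / √n`, which requires `|y| ≤ 1`
  have hb := Complex.exp_bound (x := Complex.I * y) (by simpa using hy1) (n := 3) (by norm_num)
  have hsum : ∑ m ∈ Finset.range 3, (Complex.I * (y : ℂ)) ^ m / (m.factorial : ℂ) =
      1 + Complex.I * y - (y ^ 2 / 2 : ℝ) := by
    simp only [Finset.sum_range_succ, Finset.sum_range_zero, Nat.factorial]
    push_cast
    rw [show (Complex.I * (y : ℂ)) ^ 2 = -y ^ 2 by rw [mul_pow, Complex.I_sq]; ring]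
    ring
  rw [hsum] at hb
  have : (n : ℂ) * (Complex.exp (Complex.I * y) - 1 - Complex.I * y) - -(x ^ 2 / 2 : ℝ) =
      n * (Complex.exp (Complex.I * y) - (1 + Complex.I * y - (y ^ 2 / 2 : ℝ))) := by
    rw [← hny]; push_cast; ring
  rw [this, norm_mul, Complex.norm_natCast]
  simp only [norm_mul, Complex.norm_I, one_mul, Complex.norm_real, Real.norm_eq_abs] at hb
  calc (n : ℝ) * _ ≤ n * (|y| ^ 3 * 1) := by
        gcongr
        refine hb.trans ?_
        gcongr
        norm_num [Nat.factorial]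
    _ = (√(n : ℝ))⁻¹ * |x| ^ 3 := by
        rw [hy, abs_mul, abs_of_pos (inv_pos.2 hpos)]
        nth_rewrite 1 [← hsqn]
        field_simp

section Integrals

variable {E : Type} [MeasurableSpace E] {ν : Measure E}

lemma tendsto_natCast_mul_integral_exp_sub_one {f : E → ℝ} (hf : Measurable f)
    (hfi : Integrable f ν) :
    Tendsto (fun n : ℕ => (n : ℂ) * ∫ w, (Complex.exp (Complex.I * ((n : ℝ)⁻¹ * f w : ℝ)) - 1) ∂ν)
      atTop (𝓝 (Complex.I * (∫ w, f w ∂ν : ℝ))) := by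
  simp_rw [← integral_const_mul]
  rw [← integral_complex_ofReal, ← integral_const_mul]
  refine tendsto_integral_of_dominated_convergence (fun w => ‖f w‖) (fun n => ?_) hfi.norm
    (fun n => ae_of_all _ fun w => ?_) (ae_of_all _ fun w => tendsto_natCast_mul_exp_sub_one (f w))
  · exact Measurable.aestronglyMeasurable (by fun_prop)
  · rw [norm_mul, Complex.norm_natCast]
    have := @Real.norm_exp_I_mul_ofReal_sub_one_le ((n : ℝ)⁻¹ * f w)
    rw [norm_mul, norm_inv, Real.norm_natCast] at this
    rcases Nat.eq_zero_or_pos n with rfl | hn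
    · simp
    · have hn' : (0 : ℝ) < n := by exact_mod_cast hn
      calc (n : ℝ) * _ ≤ n * ((n : ℝ)⁻¹ * ‖f w‖) := by gcongr
        _ = _ := by field_simp

/-- Second-order expansion of the characteristic function of a centered `f` at `1 / √n`. The measure
`ν` need not be normalized: it is the restriction of the law to a stratum. -/
lemma tendsto_natCast_mul_integral_exp_sub_one_sqrt [IsFiniteMeasure ν] {f : E → ℝ}
    (hf : Measurable f) (hf2 : MemLp f 2 ν) (h0 : ∫ w, f w ∂ν = 0) :
    Tendsto (fun n : ℕ =>
        (n : ℂ) * ∫ w, (Complex.exp (Complex.I * ((√(n : ℝ))⁻¹ * f w : ℝ)) - 1) ∂ν)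
      atTop (𝓝 (-((∫ w, f w ^ 2 ∂ν) / 2 : ℝ))) := by
  have hfi : Integrable f ν := hf2.integrable (by norm_num)
  have hlin : ∀ n : ℕ, ∫ w, (Complex.exp (Complex.I * ((√(n : ℝ))⁻¹ * f w : ℝ)) - 1) ∂ν =
      ∫ w, (Complex.exp (Complex.I * ((√(n : ℝ))⁻¹ * f w : ℝ)) - 1 -
        Complex.I * ((√(n : ℝ))⁻¹ * f w : ℝ)) ∂ν := by
    intro n
    have hi2 : Integrable (fun w => Complex.I * (((√(n : ℝ))⁻¹ * f w : ℝ) : ℂ)) ν :=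
      ((hfi.const_mul _).ofReal).const_mul _
    have hi1 : Integrable
        (fun w => Complex.exp (Complex.I * ((√(n : ℝ))⁻¹ * f w : ℝ)) - 1) ν := by
      refine Integrable.mono' (hfi.const_mul ((√(n : ℝ))⁻¹)).norm
        (Measurable.aestronglyMeasurable (by fun_prop)) (ae_of_all _ fun w => ?_)
      exact Real.norm_exp_I_mul_ofReal_sub_one_le
    rw [integral_sub hi1 hi2, integral_const_mul, integral_complex_ofReal, integral_const_mul, h0]
    simp
  simp_rw [hlin, ← integral_const_mul]
  rw [← integral_div, ← Complex.ofReal_neg, ← integral_neg, ← integral_complex_ofReal]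
  push_cast
  refine tendsto_integral_of_dominated_convergence (fun w => 3 * f w ^ 2) (fun n => ?_)
    (hf2.integrable_sq.const_mul 3) (fun n => ae_of_all _ fun w => ?_) (ae_of_all _ fun w => ?_)
  · exact Measurable.aestronglyMeasurable (by fun_prop)
  · rw [norm_mul, Complex.norm_natCast]
    rcases Nat.eq_zero_or_pos n with rfl | hn
    · simp; positivity
    · have hsqn : √(n : ℝ) ^ 2 = n := Real.sq_sqrt (Nat.cast_nonneg n)
      have hn' : (0 : ℝ) < n := by exact_mod_cast hn
      have := norm_exp_I_mul_sub_le ((√(n : ℝ))⁻¹ * f w)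
      push_cast at this
      calc (n : ℝ) * _ ≤ n * (3 * ((√(n : ℝ))⁻¹ * f w) ^ 2) := by gcongr
        _ = _ := by rw [mul_pow, inv_pow, hsqn]; field_simp
  · have := tendsto_natCast_mul_exp_sub_one_sub (f w)
    push_cast at this
    exact this

end Integrals

/-! ### Law of large numbers and central limit theorem for a balanced trial -/

section Strata

variable {E 𝒮 : Type} [MeasurableSpace E] [Fintype 𝒮] [MeasurableSpace 𝒮]
  [DiscreteMeasurableSpace 𝒮] {P : Measure E} {σ : E → 𝒮}

lemma sum_setIntegral_preimage (hσ : Measurable σ) {F : Type} [NormedAddCommGroup F]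
    [NormedSpace ℝ F] {f : E → F} (hf : Integrable f P) :
    ∑ s, ∫ w in σ ⁻¹' {s}, f w ∂P = ∫ w, f w ∂P := by
  rw [← integral_iUnion_fintype (fun s => hσ (measurableSet_singleton s)) ?_
    fun s => hf.integrableOn]
  · rw [show (⋃ s, σ ⁻¹' {s}) = Set.univ by ext; simp, setIntegral_univ]
  · intro s s' hs
    exact Set.disjoint_left.2 fun w h h' => hs (h.symm.trans h')

end Strata

/-- The mean of `f` over the stratum `s` (zero if the stratum has measure zero). -/
def stratumMean {E 𝒮 : Type} [MeasurableSpace E] (P : Measure E) (σ : E → 𝒮) (f : E → ℝ) (s : 𝒮) :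
    ℝ := (P.real (σ ⁻¹' {s}))⁻¹ * ∫ w in σ ⁻¹' {s}, f w ∂P

/-- The asymptotic variance of `n^{-1/2} ∑ f (A_i) (W_i)` for mean zero functions `f 0`, `f 1`: the
variance between the strata of the average over the arms of the stratum means, plus the average over
the arms of the variance within the strata. -/
def asymptoticVariance {E 𝒮 : Type} [MeasurableSpace E] (P : Measure E) (σ : E → 𝒮)
    (f : Fin 2 → E → ℝ) : ℝ :=
  ∫ w, ((stratumMean P σ (f 0) (σ w) + stratumMean P σ (f 1) (σ w)) / 2) ^ 2 ∂P +
    1 / 2 * ∑ a, ∫ w, (f a w - stratumMean P σ (f a) (σ w)) ^ 2 ∂P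

lemma asymptoticVariance_nonneg {E 𝒮 : Type} [MeasurableSpace E] (P : Measure E) (σ : E → 𝒮)
    (f : Fin 2 → E → ℝ) :
    0 ≤ asymptoticVariance P σ f := by
  unfold asymptoticVariance
  have : ∀ a, 0 ≤ ∫ w, (f a w - stratumMean P σ (f a) (σ w)) ^ 2 ∂P := fun a =>
    integral_nonneg fun w => sq_nonneg _
  have h0 : 0 ≤ ∫ w, ((stratumMean P σ (f 0) (σ w) + stratumMean P σ (f 1) (σ w)) / 2) ^ 2 ∂P :=
    integral_nonneg fun w => sq_nonneg _
  have := Finset.sum_nonneg fun a (_ : a ∈ Finset.univ) => this a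
  positivity

lemma measureReal_mul_stratumMean {E 𝒮 : Type} [MeasurableSpace E] {P : Measure E}
    [IsProbabilityMeasure P] {σ : E → 𝒮} (f : E → ℝ) (s : 𝒮) :
    P.real (σ ⁻¹' {s}) * stratumMean P σ f s = ∫ w in σ ⁻¹' {s}, f w ∂P := by
  unfold stratumMean
  by_cases hp : P.real (σ ⁻¹' {s}) = 0
  · have h0 : P (σ ⁻¹' {s}) = 0 := by
      simpa [Measure.real, ENNReal.toReal_eq_zero_iff] using hp
    rw [hp, Measure.restrict_eq_zero.2 h0]
    simp
  · field_simp

section Strata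

variable {E 𝒮 : Type} [MeasurableSpace E] [Fintype 𝒮] [MeasurableSpace 𝒮]
  [DiscreteMeasurableSpace 𝒮] {P : Measure E} {σ : E → 𝒮}

omit [Fintype 𝒮] in
lemma setIntegral_comp_eq (hσ : Measurable σ) (g : 𝒮 → ℝ) (s : 𝒮) :
    ∫ w in σ ⁻¹' {s}, g (σ w) ∂P = P.real (σ ⁻¹' {s}) * g s := by
  rw [setIntegral_congr_fun (g := fun _ => g s) (hσ (measurableSet_singleton s))
    (by rintro w rfl; rfl)]
  simp

variable [IsProbabilityMeasure P]

lemma memLp_comp_strata (hσ : Measurable σ) (g : 𝒮 → ℝ) : MemLp (fun w => g (σ w)) 2 P := by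
  have hm : Measurable fun w => g (σ w) := (Measurable.of_discrete (f := g)).comp hσ
  refine MemLp.of_bound hm.aestronglyMeasurable (∑ s, ‖g s‖) (ae_of_all _ fun w => ?_)
  exact Finset.single_le_sum (f := fun s => ‖g s‖) (fun _ _ => norm_nonneg _) (Finset.mem_univ _)

/-- Stratification reduces the variance of simple randomization by the between-strata part of the
difference of the arms. -/
lemma asymptoticVariance_eq (hσ : Measurable σ) {f : Fin 2 → E → ℝ} (hf : ∀ a, MemLp (f a) 2 P) :
    asymptoticVariance P σ f = 1 / 2 * ∑ a, ∫ w, f a w ^ 2 ∂P -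
      1 / 4 * ∑ s, (P.real (σ ⁻¹' {s}))⁻¹ *
        (∫ w in σ ⁻¹' {s}, f 1 w ∂P - ∫ w in σ ⁻¹' {s}, f 0 w ∂P) ^ 2 := by
  set m : Fin 2 → 𝒮 → ℝ := fun a s => stratumMean P σ (f a) s with hm
  set q : 𝒮 → ℝ := fun s => P.real (σ ⁻¹' {s}) with hq
  have hqm : ∀ a s, ∫ w in σ ⁻¹' {s}, f a w ∂P = q s * m a s := fun a s =>
    (measureReal_mul_stratumMean (f a) s).symm
  have hg : ∀ g : 𝒮 → ℝ, ∫ w, g (σ w) ∂P = ∑ s, q s * g s := fun g => by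
    rw [← sum_setIntegral_preimage hσ ((memLp_comp_strata hσ g).integrable (by norm_num))]
    simp_rw [setIntegral_comp_eq hσ]
    rfl
  have hsq : ∀ a, ∫ w, (f a w - m a (σ w)) ^ 2 ∂P = ∫ w, f a w ^ 2 ∂P - ∑ s, q s * m a s ^ 2 := by
    intro a
    have hi1 : Integrable (fun w => f a w ^ 2) P := (hf a).integrable_sq
    have hi2 : Integrable (fun w => f a w * m a (σ w)) P :=
      (hf a).integrable_mul (memLp_comp_strata hσ (m a))
    have hi3 : Integrable (fun w => m a (σ w) ^ 2) P := (memLp_comp_strata hσ (m a)).integrable_sq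
    have e : ∀ w, (f a w - m a (σ w)) ^ 2 = f a w ^ 2 - 2 * (f a w * m a (σ w)) + m a (σ w) ^ 2 :=
      fun w => by ring
    simp_rw [e]
    rw [integral_add (f := fun w => f a w ^ 2 - 2 * (f a w * m a (σ w)))
      (hi1.sub (hi2.const_mul 2)) hi3, integral_sub hi1 (hi2.const_mul 2),
      integral_const_mul, hg fun s => m a s ^ 2, ← sum_setIntegral_preimage hσ hi2]
    have : ∀ s, ∫ w in σ ⁻¹' {s}, f a w * m a (σ w) ∂P = q s * m a s ^ 2 := fun s => by
      rw [setIntegral_congr_fun (g := fun w => f a w * m a s) (hσ (measurableSet_singleton s))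
        (by rintro w rfl; rfl), integral_mul_const, hqm]
      ring
    simp_rw [this]
    ring
  have hbetween : ∀ s, (P.real (σ ⁻¹' {s}))⁻¹ * (q s * m 1 s - q s * m 0 s) ^ 2 =
      q s * m 1 s ^ 2 - 2 * (q s * (m 1 s * m 0 s)) + q s * m 0 s ^ 2 := fun s => by
    change (q s)⁻¹ * _ = _
    by_cases h0 : q s = 0
    · simp [h0]
    · field_simp
      ring
  have hhalf : ∀ s, q s * ((m 0 s + m 1 s) / 2) ^ 2 =
      1 / 4 * (q s * m 1 s ^ 2 + 2 * (q s * (m 1 s * m 0 s)) + q s * m 0 s ^ 2) := fun s => by ring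
  simp_rw [hqm]
  unfold asymptoticVariance
  rw [hg fun s => ((stratumMean P σ (f 0) s + stratumMean P σ (f 1) s) / 2) ^ 2]
  simp only [Fin.sum_univ_two]
  rw [hsq 0, hsq 1]
  simp_rw [hbetween]
  have hhalf' : ∑ s, q s * ((stratumMean P σ (f 0) s + stratumMean P σ (f 1) s) / 2) ^ 2 =
      ∑ s, q s * ((m 0 s + m 1 s) / 2) ^ 2 := rfl
  rw [hhalf']
  simp_rw [hhalf, Finset.sum_add_distrib, ← Finset.mul_sum, Finset.sum_add_distrib,
    Finset.sum_sub_distrib, ← Finset.mul_sum]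
  ring

/-- If the two arms have the same stratum means, stratification does not change the variance. -/
lemma asymptoticVariance_of_eq (hσ : Measurable σ) {f : Fin 2 → E → ℝ}
    (hf : ∀ a, MemLp (f a) 2 P)
    (h : ∀ s, ∫ w in σ ⁻¹' {s}, f 1 w ∂P = ∫ w in σ ⁻¹' {s}, f 0 w ∂P) :
    asymptoticVariance P σ f = 1 / 2 * ∑ a, ∫ w, f a w ^ 2 ∂P := by
  rw [asymptoticVariance_eq hσ hf]
  simp [h]

end Strata

section Limits

variable {E 𝒮 Ω : Type} [MeasurableSpace E] [Fintype 𝒮] [DecidableEq 𝒮] [MeasurableSpace 𝒮]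
  [DiscreteMeasurableSpace 𝒮] [MeasurableSpace Ω]
  {P : Measure E} [IsProbabilityMeasure P] {σ : E → 𝒮} {μ : Measure Ω} [IsProbabilityMeasure μ]
  {W : ℕ → Ω → E} {A : ℕ → Ω → Fin 2}

/-- Weak law of large numbers. -/
lemma BalancedTrial.tendstoInMeasure_mean_of_measurable (BT : BalancedTrial P σ μ W A)
    (hσ : Measurable σ) {f : Fin 2 → E → ℝ} (hfm : ∀ a, Measurable (f a))
    (hf : ∀ a, Integrable (f a) P) :
    TendstoInMeasure μ (fun (n : ℕ) ω => (n : ℝ)⁻¹ * ∑ i ∈ Finset.range n, f (A i ω) (W i ω)) atTop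
      (fun _ => 1 / 2 * ∑ a, ∫ w, f a w ∂P) := by
  have hmeas : ∀ n : ℕ, Measurable fun ω => (n : ℝ)⁻¹ * ∑ i ∈ Finset.range n, f (A i ω) (W i ω) :=
    fun n => (Finset.measurable_fun_sum _ fun i _ =>
      measurable_eval_arm (BT.measurable_arm i) (BT.measurable_data i) hfm).const_mul _
  refine tendstoInMeasure_of_tendstoInDistribution_dirac
    (tendstoInDistribution_of_charFun (fun n => (hmeas n).aemeasurable) _ fun t => ?_)
    Measure.map_id
  have hcore := BT.tendsto_integral_prod hσ
    (F := fun n a w => Complex.exp (Complex.I * ((n : ℝ)⁻¹ * (t * f a w) : ℝ)))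
    (G := fun _ _ => 1) (L := fun s a => Complex.I * (∫ w in σ ⁻¹' {s}, t * f a w ∂P : ℝ))
    (fun n a => by have := hfm a; fun_prop)
    (fun n a w => by rw [Complex.norm_exp_I_mul_ofReal]) (by simp)
    (fun s a => tendsto_natCast_mul_integral_exp_sub_one ((hfm a).const_mul t)
      ((hf a).const_mul t).integrableOn)
  simp only [Finset.prod_const_one, integral_const, probReal_univ, one_smul, one_mul]
    at hcore
  have hlim := tendsto_sub_nhds_zero_iff.1 hcore
  rw [charFun_dirac]
  convert! hlim using 2
  · rename_i n
    refine integral_congr_ae (ae_of_all _ fun ω => ?_)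
    dsimp only
    rw [← Complex.exp_sum]
    congr 1
    push_cast
    simp only [Finset.mul_sum]
    exact Finset.sum_congr rfl fun i _ => by ring
  · congr 1
    have hsum : ∑ sa : 𝒮 × Fin 2, Complex.I * ((∫ w in σ ⁻¹' {sa.1}, t * f sa.2 w ∂P : ℝ) : ℂ) =
        Complex.I * (t * ∑ a, ∫ w, f a w ∂P : ℝ) := by
      rw [← Finset.mul_sum, ← Complex.ofReal_sum]
      congr 2
      rw [Fintype.sum_prod_type_right, Finset.mul_sum]
      refine Finset.sum_congr rfl fun a _ => ?_
      dsimp only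
      rw [sum_setIntegral_preimage hσ ((hf a).const_mul t), integral_const_mul]
    rw [hsum]
    simp only [RCLike.inner_apply, conj_trivial]
    push_cast
    ring

end Limits

section CentralLimit

variable {E 𝒮 Ω : Type} [MeasurableSpace E] [Fintype 𝒮] [DecidableEq 𝒮] [MeasurableSpace 𝒮]
  [DiscreteMeasurableSpace 𝒮] [MeasurableSpace Ω]
  {P : Measure E} [IsProbabilityMeasure P] {σ : E → 𝒮} {μ : Measure Ω} [IsProbabilityMeasure μ]
  {W : ℕ → Ω → E} {A : ℕ → Ω → Fin 2}

omit [Fintype 𝒮] [MeasurableSpace 𝒮] [DiscreteMeasurableSpace 𝒮] [IsProbabilityMeasure P]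
  [IsProbabilityMeasure μ] in
lemma BalancedTrial.ae_all (BT : BalancedTrial P σ μ W A) {q : E → Prop} (hq : ∀ᵐ w ∂P, q w) :
    ∀ᵐ ω ∂μ, ∀ i, q (W i ω) := by
  refine ae_all_iff.2 fun i => ?_
  rw [← BT.law i] at hq
  exact ae_of_ae_map (BT.measurable_data i).aemeasurable hq

/-- Weak law of large numbers. -/
lemma BalancedTrial.tendstoInMeasure_mean (BT : BalancedTrial P σ μ W A)
    (hσ : Measurable σ) {f : Fin 2 → E → ℝ} (hf : ∀ a, Integrable (f a) P) :
    TendstoInMeasure μ (fun (n : ℕ) ω => (n : ℝ)⁻¹ * ∑ i ∈ Finset.range n, f (A i ω) (W i ω)) atTop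
      (fun _ => 1 / 2 * ∑ a, ∫ w, f a w ∂P) := by
  have h := BT.tendstoInMeasure_mean_of_measurable hσ (f := fun a => (hf a).1.mk (f a))
    (fun a => (hf a).1.stronglyMeasurable_mk.measurable) (fun a => (hf a).congr (hf a).1.ae_eq_mk)
  have hall : ∀ᵐ w ∂P, ∀ a, f a w = (hf a).1.mk (f a) w := ae_all_iff.2 fun a => (hf a).1.ae_eq_mk
  simp_rw [fun a => integral_congr_ae (hf a).1.ae_eq_mk.symm] at h
  refine h.congr_left fun n => ?_
  filter_upwards [BT.ae_all hall] with ω hω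
  congr 1
  exact Finset.sum_congr rfl fun i _ => (hω i _).symm

omit [MeasurableSpace Ω] [MeasurableSpace E] [MeasurableSpace 𝒮] [DiscreteMeasurableSpace 𝒮] in
/-- A function of stratum and arm is the average over the arms up to the imbalance. -/
lemma sum_stratum_arm (m : 𝒮 → Fin 2 → ℝ) (n : ℕ) (ω : Ω) :
    ∑ i ∈ Finset.range n, m (σ (W i ω)) (A i ω) =
      ∑ i ∈ Finset.range n, (m (σ (W i ω)) 0 + m (σ (W i ω)) 1) / 2 +
      ∑ s, ((cellCount σ W A n s 1 ω : ℝ) - cellCount σ W A n s 0 ω) * ((m s 1 - m s 0) / 2) := by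
  simp_rw [cellCount_sub, Finset.sum_mul, Finset.sum_filter]
  rw [Finset.sum_comm, ← Finset.sum_add_distrib]
  refine Finset.sum_congr rfl fun i _ => ?_
  rw [Finset.sum_ite_eq (Finset.univ) (σ (W i ω))
    (fun s => armSign (A i ω) * ((m s 1 - m s 0) / 2)), if_pos (Finset.mem_univ _)]
  have : A i ω = 0 ∨ A i ω = 1 := by omega
  rcases this with h | h <;> rw [h] <;> simp [armSign] <;> ring

/-- Central limit theorem for the sum of the parts that average out given the strata and the parts
that depend on the strata only. -/
lemma BalancedTrial.tendstoInDistribution_decomposed (BT : BalancedTrial P σ μ W A)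
    (hσ : Measurable σ) {h : 𝒮 → ℝ} {g : Fin 2 → E → ℝ} (hg : ∀ a, Measurable (g a))
    (hg2 : ∀ a, MemLp (g a) 2 P) (h0 : ∫ w, h (σ w) ∂P = 0)
    (hg0 : ∀ a s, ∫ w in σ ⁻¹' {s}, g a w ∂P = 0) {v : ℝ≥0}
    (hv : (v : ℝ) = ∫ w, h (σ w) ^ 2 ∂P + 1 / 2 * ∑ a, ∫ w, g a w ^ 2 ∂P) :
    TendstoInDistribution (fun (n : ℕ) ω => (√(n : ℝ))⁻¹ *
      ∑ i ∈ Finset.range n, (h (σ (W i ω)) + g (A i ω) (W i ω)))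
      atTop (id : ℝ → ℝ) (fun _ => μ) (gaussianReal 0 v) := by
  have hhm : Measurable fun w => h (σ w) := (Measurable.of_discrete (f := h)).comp hσ
  have hmeas : ∀ n : ℕ, Measurable fun ω => (√(n : ℝ))⁻¹ *
      ∑ i ∈ Finset.range n, (h (σ (W i ω)) + g (A i ω) (W i ω)) := fun n =>
    (Finset.measurable_fun_sum _ fun i _ => (hhm.comp (BT.measurable_data i)).add
      (measurable_eval_arm (BT.measurable_arm i) (BT.measurable_data i) hg)).const_mul _
  refine tendstoInDistribution_of_charFun (fun n => (hmeas n).aemeasurable) _ fun t => ?_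
  have hcore := BT.tendsto_integral_prod hσ
    (F := fun n a w => Complex.exp (Complex.I * ((√(n : ℝ))⁻¹ * (t * g a w) : ℝ)))
    (G := fun n s => Complex.exp (Complex.I * ((√(n : ℝ))⁻¹ * (t * h s) : ℝ)))
    (L := fun s a => (-((∫ w in σ ⁻¹' {s}, (t * g a w) ^ 2 ∂P) / 2 : ℝ) : ℂ))
    (fun n a => by have := hg a; fun_prop)
    (fun n a w => by rw [Complex.norm_exp_I_mul_ofReal])
    (fun n s => by rw [Complex.norm_exp_I_mul_ofReal])
    (fun s a => tendsto_natCast_mul_integral_exp_sub_one_sqrt ((hg a).const_mul t)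
      (((hg2 a).const_mul t).restrict _) (by rw [integral_const_mul, hg0, mul_zero]))
  -- the factor that depends on the strata only is a power, by independence
  have hstrata : Tendsto (fun n : ℕ => ∫ ω, ∏ i ∈ Finset.range n,
      Complex.exp (Complex.I * ((√(n : ℝ))⁻¹ * (t * h (σ (W i ω))) : ℝ)) ∂μ) atTop
      (𝓝 (Complex.exp (-((∫ w, (t * h (σ w)) ^ 2 ∂P) / 2 : ℝ)))) := by
    have hz := tendsto_natCast_mul_integral_exp_sub_one_sqrt (ν := P) (hhm.const_mul t)
      ((memLp_comp_strata hσ h).const_mul t) (by rw [integral_const_mul, h0, mul_zero])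
    have hN : Tendsto (fun n : ℕ => (n : ℝ) / n) atTop (𝓝 1) := by
      refine tendsto_const_nhds.congr' ?_
      filter_upwards [eventually_ne_atTop 0] with n hn
      rw [div_self (Nat.cast_ne_zero.2 hn)]
    have hmE : ∀ n : ℕ, Measurable fun w =>
        Complex.exp (Complex.I * ((√(n : ℝ))⁻¹ * (t * h (σ w)) : ℝ)) := fun n => by fun_prop
    have hsub : ∀ n : ℕ,
        ∫ w, (Complex.exp (Complex.I * ((√(n : ℝ))⁻¹ * (t * h (σ w)) : ℝ)) - 1) ∂P =
        ∫ w, Complex.exp (Complex.I * ((√(n : ℝ))⁻¹ * (t * h (σ w)) : ℝ)) ∂P - 1 := fun n => by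
      rw [integral_sub (Integrable.of_bound (hmE n).aestronglyMeasurable 1
        (ae_of_all _ fun w => by rw [Complex.norm_exp_I_mul_ofReal])) (integrable_const _)]
      simp
    simp_rw [hsub] at hz
    have := tendsto_pow_exp_of_tendsto_div hz hN
    rw [Complex.ofReal_one, one_mul] at this
    refine this.congr fun n => ?_
    simp_rw [Finset.prod_range]
    rw [(BT.indep.precomp (g := fun i : Fin n => (i : ℕ)) Fin.val_injective).integral_fun_prod_comp
      (f := fun _ w => Complex.exp (Complex.I * ((√(n : ℝ))⁻¹ * (t * h (σ w)) : ℝ)))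
      (fun i => (BT.measurable_data i).aemeasurable) (fun i => (hmE n).aestronglyMeasurable)]
    have hi : ∀ i, ∫ ω, Complex.exp (Complex.I * ((√(n : ℝ))⁻¹ * (t * h (σ (W i ω))) : ℝ)) ∂μ =
        ∫ w, Complex.exp (Complex.I * ((√(n : ℝ))⁻¹ * (t * h (σ w)) : ℝ)) ∂P := fun i => by
      rw [← BT.law i, integral_map (BT.measurable_data i).aemeasurable
        (hmE n).aestronglyMeasurable]
    rw [Finset.prod_congr rfl fun (i : Fin n) _ => hi i]
    simp
  have hlim := hcore.add (hstrata.mul_const (Complex.exp ((1 / 2 : ℂ) * ∑ sa : 𝒮 × Fin 2,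
    (-((∫ w in σ ⁻¹' {sa.1}, (t * g sa.2 w) ^ 2 ∂P) / 2 : ℝ) : ℂ))))
  simp only [sub_add_cancel, zero_add] at hlim
  rw [charFun_gaussianReal]
  convert! hlim using 2
  · rename_i n
    refine integral_congr_ae (ae_of_all _ fun ω => ?_)
    dsimp only
    rw [Finset.prod_mul_distrib, ← Complex.exp_sum, ← Complex.exp_sum, ← Complex.exp_add]
    congr 1
    push_cast
    rw [← Finset.sum_add_distrib]
    simp only [Finset.mul_sum]
    exact Finset.sum_congr rfl fun i _ => by ring
  · rw [← Complex.exp_add]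
    congr 1
    have hsum : ∑ sa : 𝒮 × Fin 2, (-((∫ w in σ ⁻¹' {sa.1}, (t * g sa.2 w) ^ 2 ∂P) / 2 : ℝ) : ℂ) =
        (-(t ^ 2 * (∑ a, ∫ w, g a w ^ 2 ∂P) / 2 : ℝ) : ℂ) := by
      simp_rw [← Complex.ofReal_neg]
      rw [← Complex.ofReal_sum, Finset.sum_neg_distrib, Fintype.sum_prod_type_right,
        Finset.mul_sum, Finset.sum_div]
      congr 2
      refine Finset.sum_congr rfl fun a _ => ?_
      dsimp only
      rw [← Finset.sum_div, sum_setIntegral_preimage hσ (((hg2 a).const_mul t).integrable_sq)]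
      simp_rw [mul_pow]
      rw [integral_const_mul]
    rw [hsum]
    simp_rw [mul_pow]
    rw [integral_const_mul, show ((v : ℝ≥0) : ℂ) = ((v : ℝ) : ℂ) from rfl, hv]
    push_cast
    ring

/-- Central limit theorem. -/
lemma BalancedTrial.tendstoInDistribution (BT : BalancedTrial P σ μ W A) (hσ : Measurable σ)
    {f : Fin 2 → E → ℝ} (hfm : ∀ a, Measurable (f a)) (hf : ∀ a, MemLp (f a) 2 P)
    (h0 : ∀ a, ∫ w, f a w ∂P = 0) :
    TendstoInDistribution (fun (n : ℕ) ω => (√(n : ℝ))⁻¹ *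
      ∑ i ∈ Finset.range n, f (A i ω) (W i ω))
      atTop (id : ℝ → ℝ) (fun _ => μ) (gaussianReal 0 (asymptoticVariance P σ f).toNNReal) := by
  -- `f a` is the mean over the arms of the averages over the strata, plus a deviation that is
  -- centered in every stratum, plus a term that is the imbalance of the strata in total
  set m : 𝒮 → Fin 2 → ℝ := fun s a => stratumMean P σ (f a) s with hm
  have hmm : ∀ a, Measurable fun w => m (σ w) a := fun a =>
    (Measurable.of_discrete (f := fun s => m s a)).comp hσ
  have hint : ∀ a, Integrable (f a) P := fun a => (hf a).integrable (by norm_num)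
  have hmi : ∀ a, Integrable (fun w => m (σ w) a) P := fun a =>
    (memLp_comp_strata hσ fun s => m s a).integrable (by norm_num)
  have hms : ∀ a s, ∫ w in σ ⁻¹' {s}, m (σ w) a ∂P = ∫ w in σ ⁻¹' {s}, f a w ∂P := fun a s => by
    rw [setIntegral_comp_eq hσ fun s => m s a, measureReal_mul_stratumMean]
  have hm0 : ∀ a, ∫ w, m (σ w) a ∂P = 0 := fun a => by
    rw [← sum_setIntegral_preimage hσ (hmi a)]
    simp_rw [hms]
    rw [sum_setIntegral_preimage hσ (hint a), h0]
  have hmain := BT.tendstoInDistribution_decomposed hσ (h := fun s => (m s 0 + m s 1) / 2)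
    (g := fun a w => f a w - m (σ w) a) (fun a => (hfm a).sub (hmm a))
    (fun a => (hf a).sub (memLp_comp_strata hσ fun s => m s a))
    (by rw [integral_div, integral_add (hmi 0) (hmi 1), hm0, hm0]; simp)
    (fun a s => by
      rw [integral_sub (hint a).integrableOn (hmi a).integrableOn, hms, sub_self])
    (v := (asymptoticVariance P σ f).toNNReal)
    (by rw [Real.coe_toNNReal _ (asymptoticVariance_nonneg P σ f)]; rfl)
  refine tendstoInDistribution_of_tendstoInMeasure_sub _ _ hmain ?_ fun n => ?_
  · have hae : ∀ᵐ ω ∂μ, ∀ s, Tendsto (fun n : ℕ => (√(n : ℝ))⁻¹ *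
        (((cellCount σ W A n s 1 ω : ℝ) - cellCount σ W A n s 0 ω) *
          (∫ w in σ ⁻¹' {s}, f 1 w ∂P - ∫ w in σ ⁻¹' {s}, f 0 w ∂P))) atTop (𝓝 0) :=
      ae_all_iff.2 fun s => BT.imbalance f h0 s
    refine tendstoInMeasure_of_tendsto_ae (fun n => ?_) ?_
    · refine Measurable.aestronglyMeasurable (Measurable.sub ?_ ?_)
      · exact (Finset.measurable_fun_sum _ fun i _ => measurable_eval_arm (BT.measurable_arm i)
          (BT.measurable_data i) hfm).const_mul _
      · exact (Finset.measurable_fun_sum _ fun i _ =>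
          (((Measurable.of_discrete (f := fun s => (m s 0 + m s 1) / 2)).comp hσ).comp
            (BT.measurable_data i)).add (measurable_eval_arm (BT.measurable_arm i)
          (BT.measurable_data i) fun a => (hfm a).sub (hmm a))).const_mul _
    · filter_upwards [hae] with ω hω
      have hsum := tendsto_finsetSum Finset.univ fun s (_ : s ∈ Finset.univ) =>
        (hω s).mul_const ((P.real (σ ⁻¹' {s}))⁻¹ / 2)
      simp only [zero_mul, Finset.sum_const_zero] at hsum
      refine hsum.congr fun n => ?_
      have hid := sum_stratum_arm (σ := σ) (W := W) (A := A) m n ω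
      simp only [Pi.sub_apply]
      rw [← mul_sub, ← Finset.sum_sub_distrib]
      have e : ∀ i, f (A i ω) (W i ω) - ((m (σ (W i ω)) 0 + m (σ (W i ω)) 1) / 2 +
          (f (A i ω) (W i ω) - m (σ (W i ω)) (A i ω))) =
          m (σ (W i ω)) (A i ω) - (m (σ (W i ω)) 0 + m (σ (W i ω)) 1) / 2 := fun i => by ring
      simp_rw [e]
      rw [Finset.sum_sub_distrib, hid, add_sub_cancel_left, Finset.mul_sum]
      refine Finset.sum_congr rfl fun s _ => ?_
      simp only [hm, stratumMean]
      ring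
  · exact ((Finset.measurable_fun_sum _ fun i _ => measurable_eval_arm (BT.measurable_arm i)
      (BT.measurable_data i) hfm).const_mul _).aemeasurable

end CentralLimit

/-! ### Consistency of M-estimators -/

/-- The oscillation of a dominated random continuous function near a point is bounded by an
integrable function of small mean. -/
lemma exists_integrable_oscillation_bound {E X : Type} [MeasurableSpace E] {P : Measure E}
    [PseudoMetricSpace X] [SecondCountableTopology X] {Θ : Set X} {f : E → X → ℝ} {u : E → ℝ}
    (hm : ∀ θ ∈ Θ, AEMeasurable (fun w => f w θ) P) (hc : ∀ᵐ w ∂P, ContinuousOn (f w) Θ)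
    (hu : Integrable u P) (hfu : ∀ᵐ w ∂P, ∀ θ ∈ Θ, |f w θ| ≤ u w) {θ : X} (hθ : θ ∈ Θ) {ε : ℝ}
    (hε : 0 < ε) :
    ∃ δ > 0, ∃ g : E → ℝ, Integrable g P ∧ ∫ w, g w ∂P < ε ∧
      ∀ᵐ w ∂P, ∀ θ' ∈ Θ, dist θ' θ < δ → |f w θ' - f w θ| ≤ g w := by
  -- a supremum over a countable dense set is measurable, and by continuity it bounds all of `Θ`
  obtain ⟨D, hDc, hDd⟩ := TopologicalSpace.exists_countable_dense Θ
  let B : ℝ → Set Θ := fun δ => {x | dist (x : X) θ < δ}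
  have hBo : ∀ δ, IsOpen (B δ) := fun δ => isOpen_lt (by fun_prop) continuous_const
  let G : ℝ → E → ℝ≥0∞ := fun δ w => ⨆ x ∈ B δ ∩ D, ENNReal.ofReal |f w x - f w θ|
  have hGm : ∀ δ, AEMeasurable (G δ) P := fun δ =>
    AEMeasurable.biSup _ (hDc.mono Set.inter_subset_right) fun x _ =>
      ((hm x x.2).sub (hm θ hθ)).abs.ennreal_ofReal
  have hGu : ∀ δ, ∀ᵐ w ∂P, G δ w ≤ ENNReal.ofReal (2 * u w) := fun δ => by
    filter_upwards [hfu] with w hw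
    refine iSup₂_le fun x _ => ENNReal.ofReal_le_ofReal ?_
    have h1 := hw x x.2
    have h2 := hw θ hθ
    calc |f w x - f w θ| ≤ |f w x| + |f w θ| := abs_sub _ _
      _ ≤ 2 * u w := by linarith
  have hufin : ∫⁻ w, ENNReal.ofReal (2 * u w) ∂P ≠ ∞ := (hu.const_mul 2).lintegral_lt_top.ne
  let δ : ℕ → ℝ := fun n => 1 / ((n : ℝ) + 1)
  have hδ0 : Tendsto δ atTop (𝓝 0) := tendsto_one_div_add_atTop_nhds_zero_nat
  have hG0 : ∀ᵐ w ∂P, Tendsto (fun n => G (δ n) w) atTop (𝓝 0) := by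
    filter_upwards [hc] with w hw
    rw [ENNReal.tendsto_nhds_zero]
    intro e he
    obtain ⟨η, hη, hηe⟩ := Metric.continuousOn_iff.1 hw θ hθ (min e 1).toReal
      (ENNReal.toReal_pos (by positivity) (by simp))
    filter_upwards [hδ0.eventually_lt_const hη] with n hn
    refine iSup₂_le fun x hx => ?_
    have := hηe x x.2 (lt_trans hx.1 hn)
    rw [Real.dist_eq] at this
    exact (ENNReal.ofReal_le_of_le_toReal this.le).trans (min_le_left _ _)
  have hlim := tendsto_lintegral_of_dominated_convergence' (μ := P) (f := fun _ => 0)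
    (fun w => ENNReal.ofReal (2 * u w)) (fun n => hGm (δ n)) (fun n => hGu (δ n)) hufin hG0
  simp only [lintegral_zero] at hlim
  obtain ⟨n, hn⟩ := (hlim.eventually_lt_const (ENNReal.ofReal_pos.2 hε)).exists
  have hfin : ∫⁻ w, G (δ n) w ∂P ≠ ∞ := (hn.trans ENNReal.ofReal_lt_top).ne
  refine ⟨δ n, by positivity, fun w => (G (δ n) w).toReal,
    integrable_toReal_of_lintegral_ne_top (hGm _) hfin, ?_, ?_⟩
  · rw [integral_toReal (hGm _) (ae_lt_top' (hGm _) hfin)]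
    exact (ENNReal.lt_ofReal_iff_toReal_lt hfin).1 hn
  · filter_upwards [hc, ae_lt_top' (hGm (δ n)) hfin] with w hw hwfin θ' hθ' hd
    rw [← ENNReal.ofReal_le_iff_le_toReal hwfin.ne]
    have hcl : IsClosed {x : Θ | ENNReal.ofReal |f w x - f w θ| ≤ G (δ n) w} := by
      have hcr := continuousOn_iff_continuous_domRestrict.1 hw
      exact isClosed_le (ENNReal.continuous_ofReal.comp ((hcr.sub continuous_const).abs))
        continuous_const
    have hsub : B (δ n) ∩ D ⊆ {x : Θ | ENNReal.ofReal |f w x - f w θ| ≤ G (δ n) w} :=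
      fun x hx => le_iSup₂ (f := fun (x : Θ) (_ : x ∈ B (δ n) ∩ D) =>
        ENNReal.ofReal |f w x - f w θ|) x hx
    exact closure_minimal hsub hcl
      (hDd.open_subset_closure_inter (hBo (δ n)) (show (⟨θ', hθ'⟩ : Θ) ∈ B (δ n) from hd))

section Consistency

variable {E 𝒮 Ω : Type} [MeasurableSpace E] [Fintype 𝒮] [DecidableEq 𝒮] [MeasurableSpace 𝒮]
  [DiscreteMeasurableSpace 𝒮] [MeasurableSpace Ω]
  {P : Measure E} [IsProbabilityMeasure P] {σ : E → 𝒮} {μ : Measure Ω} [IsProbabilityMeasure μ]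
  {W : ℕ → Ω → E} {A : ℕ → Ω → Fin 2}

/-- Near a point where the population equation fails, the empirical equation has no solution, with
probability tending to one. -/
lemma BalancedTrial.tendsto_measure_root_near {X : Type} [PseudoMetricSpace X]
    [SecondCountableTopology X] (BT : BalancedTrial P σ μ W A) (hσ : Measurable σ) {Θ : Set X}
    {f : Fin 2 → E → X → ℝ} {u : Fin 2 → E → ℝ}
    (hm : ∀ a, ∀ θ ∈ Θ, AEMeasurable (fun w => f a w θ) P)
    (hc : ∀ a, ∀ᵐ w ∂P, ContinuousOn (f a w) Θ) (hu : ∀ a, Integrable (u a) P)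
    (hfu : ∀ a, ∀ᵐ w ∂P, ∀ θ ∈ Θ, |f a w θ| ≤ u a w) {θ : X} (hθ : θ ∈ Θ)
    (hne : ∑ a, ∫ w, f a w θ ∂P ≠ 0) :
    ∃ δ > 0, Tendsto (fun n : ℕ => μ {ω | ∃ θ' ∈ Θ, dist θ' θ < δ ∧
      ∑ i ∈ Finset.range n, f (A i ω) (W i ω) θ' = 0}) atTop (𝓝 0) := by
  set c : ℝ := 1 / 2 * ∑ a, ∫ w, f a w θ ∂P with hcdef
  have hcpos : 0 < |c| := abs_pos.2 (mul_ne_zero (by norm_num) hne)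
  choose δ hδ g hgi hgε hgb using fun a => exists_integrable_oscillation_bound (hm a) (hc a) (hu a)
    (hfu a) hθ (show 0 < |c| / 3 by positivity)
  have hfi : ∀ a, Integrable (fun w => f a w θ) P := fun a =>
    (hu a).mono' (hm a θ hθ).aestronglyMeasurable ((hfu a).mono fun w hw => hw θ hθ)
  have h1 := BT.tendstoInMeasure_mean hσ (f := fun a w => f a w θ) hfi
  have h2 := BT.tendstoInMeasure_mean hσ (f := g) hgi
  rw [tendstoInMeasure_iff_norm] at h1 h2
  refine ⟨min (δ 0) (δ 1), lt_min (hδ 0) (hδ 1), ?_⟩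
  have hsum := (h1 (|c| / 3) (by positivity)).add (h2 (|c| / 3) (by positivity))
  rw [add_zero] at hsum
  have hall := BT.ae_all (ae_all_iff.2 hgb)
  refine tendsto_of_tendsto_of_tendsto_of_le_of_le tendsto_const_nhds hsum (fun n => zero_le) ?_
  intro n
  refine le_trans (measure_mono_ae ?_) (measure_union_le _ _)
  filter_upwards [hall] with ω hω
  rintro ⟨θ', hθ', hd, h0⟩
  by_contra hcon
  obtain ⟨hc1, hc2⟩ := not_or.1 hcon
  change ¬ (|c| / 3 ≤ _) at hc1 hc2
  rw [not_le, Real.norm_eq_abs] at hc1 hc2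
  have hg2 : 1 / 2 * ∑ a, ∫ w, g a w ∂P < |c| / 3 := by
    rw [Fin.sum_univ_two]; linarith [hgε 0, hgε 1]
  have hosc : |(n : ℝ)⁻¹ * ∑ i ∈ Finset.range n, f (A i ω) (W i ω) θ| ≤
      (n : ℝ)⁻¹ * ∑ i ∈ Finset.range n, g (A i ω) (W i ω) := by
    rw [abs_mul, abs_of_nonneg (inv_nonneg.2 (Nat.cast_nonneg n))]
    gcongr
    have e : ∑ i ∈ Finset.range n, f (A i ω) (W i ω) θ =
        -∑ i ∈ Finset.range n, (f (A i ω) (W i ω) θ' - f (A i ω) (W i ω) θ) := by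
      rw [Finset.sum_sub_distrib, h0]; ring
    rw [e, abs_neg]
    refine (Finset.abs_sum_le_sum_abs _ _).trans (Finset.sum_le_sum fun i _ => ?_)
    refine hω i (A i ω) θ' hθ' (lt_of_lt_of_le hd ?_)
    have : A i ω = 0 ∨ A i ω = 1 := by omega
    rcases this with h | h <;> rw [h]
    exacts [min_le_left _ _, min_le_right _ _]
  have hc2' := (abs_lt.1 hc2).2
  have := abs_sub_abs_le_abs_sub c ((n : ℝ)⁻¹ * ∑ i ∈ Finset.range n, f (A i ω) (W i ω) θ)
  rw [abs_sub_comm] at this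
  linarith

/-- Wald's consistency argument: with probability tending to one, the empirical equation has no
solution in the part of `Θ` away from the only root of the population equation. -/
lemma BalancedTrial.tendstoInMeasure_root {ι : Type} [Fintype ι] (BT : BalancedTrial P σ μ W A)
    (hσ : Measurable σ) {Θ : Set (ι → ℝ)} (hΘ : IsCompact Θ) {f : Fin 2 → E → (ι → ℝ) → ι → ℝ}
    {u : Fin 2 → E → ℝ} (hm : ∀ a, ∀ θ ∈ Θ, ∀ r, AEMeasurable (fun w => f a w θ r) P)
    (hc : ∀ a, ∀ᵐ w ∂P, ContinuousOn (f a w) Θ) (hu : ∀ a, Integrable (u a) P)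
    (hfu : ∀ a, ∀ᵐ w ∂P, ∀ θ ∈ Θ, ‖f a w θ‖ ≤ u a w) {θ₀ : ι → ℝ}
    (hroot : ∀ θ ∈ Θ, (∀ r, ∑ a, ∫ w, f a w θ r ∂P = 0) → θ = θ₀) {θhat : ℕ → Ω → ι → ℝ}
    (hsol : Tendsto (fun n : ℕ => μ {ω | ¬ (θhat n ω ∈ Θ ∧
      ∑ i ∈ Finset.range n, f (A i ω) (W i ω) (θhat n ω) = 0)}) atTop (𝓝 0)) :
    TendstoInMeasure μ θhat atTop fun _ => θ₀ := by
  rw [tendstoInMeasure_iff_dist]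
  intro ε hε
  have hnear : ∀ θ ∈ Θ \ Metric.ball θ₀ ε, ∃ δ > 0, Tendsto (fun n : ℕ => μ {ω | ∃ θ' ∈ Θ,
      dist θ' θ < δ ∧ ∑ i ∈ Finset.range n, f (A i ω) (W i ω) θ' = 0}) atTop (𝓝 0) := by
    rintro θ ⟨hθ, hball⟩
    have hne : ∃ r, ∑ a, ∫ w, f a w θ r ∂P ≠ 0 := by
      by_contra! hcon
      exact hball (by rw [hroot θ hθ hcon]; exact Metric.mem_ball_self hε)
    obtain ⟨r, hr⟩ := hne
    obtain ⟨δ, hδ, ht⟩ := BT.tendsto_measure_root_near hσ (f := fun a w θ => f a w θ r) (u := u)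
      (fun a θ hθ => hm a θ hθ r)
      (fun a => (hc a).mono fun w hw => continuousOn_pi.1 hw r)
      hu (fun a => (hfu a).mono fun w hw θ hθ => (norm_le_pi_norm (f a w θ) r).trans (hw θ hθ))
      hθ hr
    refine ⟨δ, hδ, tendsto_of_tendsto_of_tendsto_of_le_of_le tendsto_const_nhds ht
      (fun n => zero_le) fun n => measure_mono ?_⟩
    rintro ω ⟨θ', hθ', hd, h0⟩
    refine ⟨θ', hθ', hd, ?_⟩
    have := congrFun h0 r
    simpa using this
  choose! δ hδ ht using hnear
  obtain ⟨t, htK, hcov⟩ := (hΘ.diff Metric.isOpen_ball).elim_nhds_subcover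
    (fun θ => Metric.ball θ (δ θ)) fun θ hθ => Metric.ball_mem_nhds θ (hδ θ hθ)
  have hsum := hsol.add (tendsto_finsetSum t fun θ hθ => ht θ (htK θ hθ))
  simp only [Finset.sum_const_zero, add_zero] at hsum
  refine tendsto_of_tendsto_of_tendsto_of_le_of_le tendsto_const_nhds hsum (fun n => zero_le) ?_
  intro n
  refine le_trans (measure_mono ?_) ((measure_union_le _ _).trans
    (add_le_add le_rfl (measure_biUnion_finset_le t _)))
  intro ω hω
  by_cases hgood : θhat n ω ∈ Θ ∧ ∑ i ∈ Finset.range n, f (A i ω) (W i ω) (θhat n ω) = 0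
  · right
    have hmem : θhat n ω ∈ Θ \ Metric.ball θ₀ ε := ⟨hgood.1, by
      rw [Metric.mem_ball, not_lt]; exact hω⟩
    obtain ⟨θ, hθt, hθ⟩ := Set.mem_iUnion₂.1 (hcov hmem)
    exact Set.mem_iUnion₂.2 ⟨θ, hθt, θhat n ω, hgood.1, hθ, hgood.2⟩
  · left
    exact hgood

end Consistency

/-! ### Sums with random coefficients -/

section Convergence

variable {Ω : Type} [MeasurableSpace Ω] {μ : Measure Ω}

/-- A property that holds near the limit holds with probability tending to one. -/
lemma tendsto_measure_not_of_eventually {X : Type} [PseudoMetricSpace X] {Y : ℕ → Ω → X} {c : X}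
    (hY : TendstoInMeasure μ Y atTop fun _ => c) {q : X → Prop} (hq : ∀ᶠ x in 𝓝 c, q x) :
    Tendsto (fun n => μ {ω | ¬ q (Y n ω)}) atTop (𝓝 0) := by
  obtain ⟨δ, hδ, hb⟩ := Metric.eventually_nhds_iff.1 hq
  rw [tendstoInMeasure_iff_dist] at hY
  refine tendsto_of_tendsto_of_tendsto_of_le_of_le tendsto_const_nhds (hY δ hδ)
    (fun n => zero_le) fun n => measure_mono fun ω hω => ?_
  by_contra hcon
  exact hω (hb (not_le.1 hcon))

/-- Continuous mapping theorem at a constant limit. -/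
lemma tendstoInMeasure_comp_continuousAt {X X' : Type} [PseudoMetricSpace X] [PseudoMetricSpace X']
    {Y : ℕ → Ω → X} {c : X} (hY : TendstoInMeasure μ Y atTop fun _ => c) {g : X → X'}
    (hg : ContinuousAt g c) :
    TendstoInMeasure μ (fun n ω => g (Y n ω)) atTop fun _ => g c := by
  rw [tendstoInMeasure_iff_dist]
  intro ε hε
  have := tendsto_measure_not_of_eventually hY (Metric.continuousAt_iff'.1 hg ε hε)
  simpa only [not_lt] using this

lemma tendstoInMeasure_pi {κ : Type} [Fintype κ] {X : κ → Type} [∀ i, PseudoMetricSpace (X i)]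
    {Y : ∀ i, ℕ → Ω → X i} {c : ∀ i, X i}
    (hY : ∀ i, TendstoInMeasure μ (Y i) atTop fun _ => c i) :
    TendstoInMeasure μ (fun n ω i => Y i n ω) atTop fun _ => c := by
  rw [tendstoInMeasure_iff_dist]
  intro ε hε
  have hsum := tendsto_finsetSum Finset.univ fun i (_ : i ∈ Finset.univ) =>
    tendstoInMeasure_iff_dist.1 (hY i) ε hε
  simp only [Finset.sum_const_zero] at hsum
  refine tendsto_of_tendsto_of_tendsto_of_le_of_le tendsto_const_nhds hsum
    (fun n => zero_le) fun n => le_trans (measure_mono fun ω hω => ?_)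
      (measure_biUnion_finset_le Finset.univ _)
  by_contra hcon
  simp only [Set.mem_iUnion, Finset.mem_univ, exists_prop, true_and, not_exists] at hcon
  have : dist (fun i => Y i n ω) c < ε := (dist_pi_lt_iff hε).2 fun i => not_le.1 (hcon i)
  exact absurd this (not_lt.2 hω)

lemma tendstoInMeasure_prodMk {X X' : Type} [PseudoMetricSpace X] [PseudoMetricSpace X']
    {Y : ℕ → Ω → X} {Y' : ℕ → Ω → X'} {c : X} {c' : X'}
    (hY : TendstoInMeasure μ Y atTop fun _ => c) (hY' : TendstoInMeasure μ Y' atTop fun _ => c') :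
    TendstoInMeasure μ (fun n ω => (Y n ω, Y' n ω)) atTop fun _ => (c, c') := by
  rw [tendstoInMeasure_iff_dist] at *
  intro ε hε
  have hsum := (hY ε hε).add (hY' ε hε)
  rw [add_zero] at hsum
  refine tendsto_of_tendsto_of_tendsto_of_le_of_le tendsto_const_nhds hsum
    (fun n => zero_le) fun n => le_trans (measure_mono fun ω hω => ?_) (measure_union_le _ _)
  have : ε ≤ max (dist (Y n ω) c) (dist (Y' n ω) c') := hω
  exact le_max_iff.1 this

lemma tendstoInMeasure_congr_of_measure_ne {X : Type} [PseudoMetricSpace X] {Y Y' : ℕ → Ω → X}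
    {c : X} (hY : TendstoInMeasure μ Y atTop fun _ => c)
    (h : Tendsto (fun n => μ {ω | ¬ Y n ω = Y' n ω}) atTop (𝓝 0)) :
    TendstoInMeasure μ Y' atTop fun _ => c := by
  rw [tendstoInMeasure_iff_dist] at *
  intro ε hε
  have hsum := (hY ε hε).add h
  rw [add_zero] at hsum
  refine tendsto_of_tendsto_of_tendsto_of_le_of_le tendsto_const_nhds hsum
    (fun n => zero_le) fun n => le_trans (measure_mono fun ω hω => ?_) (measure_union_le _ _)
  by_cases he : Y n ω = Y' n ω
  · left
    change ε ≤ dist (Y n ω) c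
    rw [he]
    exact hω
  · right
    exact he

/-- A sequence that converges in distribution is bounded in probability, so its product with a
sequence that converges to zero in probability converges to zero in probability. -/
lemma tendstoInMeasure_mul_zero [IsProbabilityMeasure μ] {X Y : ℕ → Ω → ℝ} {ν : Measure ℝ}
    [IsProbabilityMeasure ν]
    (hX : TendstoInDistribution X atTop (id : ℝ → ℝ) (fun _ => μ) ν)
    (hY : TendstoInMeasure μ Y atTop fun _ => 0) :
    TendstoInMeasure μ (fun n ω => Y n ω * X n ω) atTop fun _ => 0 := by
  rw [tendstoInMeasure_iff_norm] at *
  simp only [sub_zero] at *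
  intro ε hε
  have hcl : ∀ R : ℝ, IsClosed {x : ℝ | R ≤ ‖x‖} := fun R =>
    isClosed_le continuous_const continuous_norm
  have htail : Tendsto (fun R : ℕ => ν {x : ℝ | (R : ℝ) ≤ ‖x‖}) atTop (𝓝 0) := by
    have := tendsto_measure_iInter_atTop (μ := ν) (s := fun R : ℕ => {x : ℝ | (R : ℝ) ≤ ‖x‖})
      (fun R => (hcl R).measurableSet.nullMeasurableSet)
      (fun R R' h x (hx : (R' : ℝ) ≤ ‖x‖) => le_trans (Nat.cast_le.2 h) hx)
      ⟨0, measure_ne_top _ _⟩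
    have hempty : (⋂ R : ℕ, {x : ℝ | (R : ℝ) ≤ ‖x‖}) = ∅ := by
      refine Set.eq_empty_of_forall_notMem fun x hx => ?_
      obtain ⟨R, hR⟩ := exists_nat_gt ‖x‖
      exact absurd (Set.mem_iInter.1 hx R) (not_le.2 hR)
    rw [hempty, measure_empty] at this
    exact this
  rw [ENNReal.tendsto_nhds_zero]
  intro η hη
  have hη2 : 0 < η / 2 := ENNReal.half_pos hη.ne'
  obtain ⟨R, hR, hRpos⟩ := ((htail.eventually_lt_const hη2).and (eventually_gt_atTop 0)).exists
  have hRpos' : (0 : ℝ) < R := Nat.cast_pos.2 hRpos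
  have hls := ProbabilityMeasure.limsup_measure_closed_le_of_tendsto hX.tendsto (hcl R)
  simp only [ProbabilityMeasure.coe_mk, Measure.map_id] at hls
  have hev := eventually_lt_of_limsup_lt (lt_of_le_of_lt hls hR)
  filter_upwards [hev, (ENNReal.tendsto_nhds_zero.1 (hY (ε / R) (by positivity))) _ hη2]
    with n hn1 hn2
  rw [Measure.map_apply_of_aemeasurable (hX.forall_aemeasurable n) (hcl R).measurableSet] at hn1
  calc μ {ω | ε ≤ ‖Y n ω * X n ω‖}
      ≤ μ ((X n ⁻¹' {x : ℝ | (R : ℝ) ≤ ‖x‖}) ∪ {ω | ε / R ≤ ‖Y n ω‖}) := by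
        refine measure_mono fun ω hω => ?_
        by_contra hcon
        obtain ⟨h1, h2⟩ := not_or.1 hcon
        have h1' : ‖X n ω‖ < R := not_le.1 h1
        have h2' : ‖Y n ω‖ < ε / R := not_le.1 h2
        have hω' : ε ≤ ‖Y n ω‖ * ‖X n ω‖ := by rw [← norm_mul]; exact hω
        have : ‖Y n ω‖ * ‖X n ω‖ < ε / R * R :=
          mul_lt_mul'' h2' h1' (norm_nonneg _) (norm_nonneg _)
        rw [div_mul_cancel₀ _ hRpos'.ne'] at this
        exact absurd this (not_lt.2 hω')
    _ ≤ η / 2 + η / 2 := (measure_union_le _ _).trans (add_le_add hn1.le hn2)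
    _ = η := ENNReal.add_halves η

end Convergence

section RandomCoefficients

variable {E 𝒮 Ω : Type} [MeasurableSpace E] [Fintype 𝒮] [DecidableEq 𝒮] [MeasurableSpace 𝒮]
  [DiscreteMeasurableSpace 𝒮] [MeasurableSpace Ω]
  {P : Measure E} [IsProbabilityMeasure P] {σ : E → 𝒮} {μ : Measure Ω} [IsProbabilityMeasure μ]
  {W : ℕ → Ω → E} {A : ℕ → Ω → Fin 2}

/-- A linear combination of centered sums, with random coefficients that converge in probability,
has the limit of the combination with the limiting coefficients. -/
lemma BalancedTrial.tendstoInDistribution_random_coeff {K : Type} [Fintype K]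
    (BT : BalancedTrial P σ μ W A) (hσ : Measurable σ) {ξ : K → Fin 2 → E → ℝ}
    (hξm : ∀ κ a, Measurable (ξ κ a)) (hξ2 : ∀ κ a, MemLp (ξ κ a) 2 P)
    (hξ0 : ∀ κ a, ∫ w, ξ κ a w ∂P = 0) {C : ℕ → Ω → K → ℝ} {c : K → ℝ}
    (hC : TendstoInMeasure μ C atTop fun _ => c) {Z : ℕ → Ω → ℝ} (hZ : ∀ n, AEMeasurable (Z n) μ)
    (hZC : Tendsto (fun n : ℕ => μ {ω | ¬ ∑ κ, C n ω κ * ((√(n : ℝ))⁻¹ *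
      ∑ i ∈ Finset.range n, ξ κ (A i ω) (W i ω)) = Z n ω}) atTop (𝓝 0)) :
    TendstoInDistribution Z atTop (id : ℝ → ℝ) (fun _ => μ)
      (gaussianReal 0 (asymptoticVariance P σ fun a w => ∑ κ, c κ * ξ κ a w).toNNReal) := by
  set G : K → ℕ → Ω → ℝ := fun κ n ω => (√(n : ℝ))⁻¹ * ∑ i ∈ Finset.range n, ξ κ (A i ω) (W i ω)
    with hG
  have hGd : ∀ κ, TendstoInDistribution (G κ) atTop (id : ℝ → ℝ) (fun _ => μ)
      (gaussianReal 0 (asymptoticVariance P σ (ξ κ)).toNNReal) := fun κ =>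
    BT.tendstoInDistribution hσ (hξm κ) (hξ2 κ) (hξ0 κ)
  have hmain := BT.tendstoInDistribution hσ (f := fun a w => ∑ κ, c κ * ξ κ a w)
    (fun a => Finset.measurable_fun_sum _ fun κ _ => (hξm κ a).const_mul _)
    (fun a => memLp_finsetSum _ fun κ _ => (hξ2 κ a).const_mul _)
    (fun a => by
      rw [integral_finsetSum _ fun κ _ => ((hξ2 κ a).integrable (by norm_num)).const_mul _]
      refine Finset.sum_eq_zero fun κ _ => ?_
      rw [integral_const_mul, hξ0, mul_zero])
  have hmain' : ∀ (n : ℕ) ω, (√(n : ℝ))⁻¹ * ∑ i ∈ Finset.range n,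
      ∑ κ, c κ * ξ κ (A i ω) (W i ω) = ∑ κ, c κ * G κ n ω := fun n ω => by
    rw [Finset.sum_comm, Finset.mul_sum]
    refine Finset.sum_congr rfl fun κ _ => ?_
    rw [hG, ← Finset.mul_sum]
    ring
  simp_rw [hmain'] at hmain
  refine tendstoInDistribution_of_tendstoInMeasure_sub Z _ hmain ?_ hZ
  have hCκ : ∀ κ, TendstoInMeasure μ (fun n ω => C n ω κ - c κ) atTop fun _ => 0 := fun κ => by
    have := tendstoInMeasure_comp_continuousAt hC (g := fun x : K → ℝ => x κ - c κ)
      ((continuous_apply κ).sub continuous_const).continuousAt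
    simpa only [sub_self] using this
  have hpi := tendstoInMeasure_pi (X := fun _ : K => ℝ)
    (Y := fun κ n ω => (C n ω κ - c κ) * G κ n ω) (c := fun _ => 0)
    fun κ => tendstoInMeasure_mul_zero (hGd κ) (hCκ κ)
  have hrem : TendstoInMeasure μ (fun n ω => ∑ κ, (C n ω κ - c κ) * G κ n ω) atTop
      fun _ => (0 : ℝ) := by
    have := tendstoInMeasure_comp_continuousAt hpi (g := fun x : K → ℝ => ∑ κ, x κ)
      (continuous_finsetSum _ fun κ _ => continuous_apply κ).continuousAt
    simpa only [Finset.sum_const_zero] using this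
  refine tendstoInMeasure_congr_of_measure_ne hrem ?_
  refine tendsto_of_tendsto_of_tendsto_of_le_of_le tendsto_const_nhds hZC
    (fun n => zero_le) fun n => measure_mono fun ω hω hcon => hω ?_
  simp only [Pi.sub_apply]
  rw [← hcon, ← Finset.sum_sub_distrib]
  exact Finset.sum_congr rfl fun κ _ => by simp only [hG]; ring

end RandomCoefficients

/-! ### Missingness completely at random -/

section Data

variable {p k : ℕ} {P : Measure (FullData p k)}

lemma measurable_observed (j : Fin 2) : Measurable (observed j : FullData p k → _) :=
  (measurable_pi_apply j).comp (measurable_fst.comp measurable_snd)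

lemma measurable_outcome (j : Fin 2) : Measurable (outcome j : FullData p k → _) :=
  (measurable_pi_apply j).comp measurable_fst

lemma measurable_covariates : Measurable (covariates : FullData p k → _) :=
  measurable_snd.comp measurable_snd

/-- The probability of the missingness pattern `m`, the same in both arms. -/
def patternProb (P : Measure (FullData p k)) (m : Fin (k + 1) → Bool) : ℝ :=
  P.real {w | observed 0 w = m}

lemma measureReal_observed_eq (hP : DataAssumptions P) (j : Fin 2) (m : Fin (k + 1) → Bool) :
    P.real {w | observed j w = m} = patternProb P m := by
  have h := hP.missing_identDistrib.measure_mem_eq (measurableSet_singleton m)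
  have : j = 0 ∨ j = 1 := by omega
  rcases this with rfl | rfl
  · rfl
  · exact congrArg ENNReal.toReal h.symm

lemma patternProb_nonneg (m : Fin (k + 1) → Bool) : 0 ≤ patternProb P m := measureReal_nonneg

lemma patternProb_full_pos [IsProbabilityMeasure P] (hP : DataAssumptions P) :
    0 < patternProb P fun _ => true := by
  refine ENNReal.toReal_pos ?_ (measure_ne_top _ _)
  have := (hP.positivity 0).ne'
  convert! this using 3
  ext w
  exact funext_iff

lemma measurable_ite_observed (j : Fin 2) (m : Fin (k + 1) → Bool) {g : FullData p k → ℝ}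
    (hg : Measurable g) : Measurable fun w => if observed j w = m then g w else 0 :=
  Measurable.ite (measurable_observed j (measurableSet_singleton m)) hg measurable_const

lemma integral_ite_observed_one (hP : DataAssumptions P) (j : Fin 2) (m : Fin (k + 1) → Bool) :
    ∫ w, (if observed j w = m then (1 : ℝ) else 0) ∂P = patternProb P m := by
  have hm : MeasurableSet {w : FullData p k | observed j w = m} :=
    measurable_observed j (measurableSet_singleton m)
  rw [← measureReal_observed_eq hP j m, ← integral_indicator_one hm]
  refine integral_congr_ae (ae_of_all _ fun w => ?_)
  simp [Set.indicator_apply]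

/-- A pattern of missingness is independent of the covariates and outcomes. -/
lemma integral_ite_observed (hP : DataAssumptions P) (j : Fin 2) (m : Fin (k + 1) → Bool)
    {g : (Fin p → ℝ) × (Fin (k + 1) → ℝ) → ℝ} (hg : Measurable g) :
    ∫ w, (if observed j w = m then g (covariates w, outcome j w) else 0) ∂P =
      patternProb P m * ∫ w, g (covariates w, outcome j w) ∂P := by
  have hf : Measurable fun m' : Fin (k + 1) → Bool => if m' = m then (1 : ℝ) else 0 :=
    Measurable.of_discrete
  have h := (hP.missing_indep j).integral_fun_comp_mul_comp
    (f := fun m' => if m' = m then (1 : ℝ) else 0) (g := g)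
    (measurable_observed j).aemeasurable
    (measurable_covariates.prodMk (measurable_outcome j)).aemeasurable
    hf.aestronglyMeasurable hg.aestronglyMeasurable
  rw [integral_ite_observed_one hP] at h
  rw [← h]
  refine integral_congr_ae (ae_of_all _ fun w => ?_)
  dsimp only
  split_ifs <;> simp

/-- Means of functions of pattern, covariates and outcomes, by independence. -/
lemma integral_observed (hP : DataAssumptions P) (j : Fin 2)
    {g : (Fin (k + 1) → Bool) → (Fin p → ℝ) × (Fin (k + 1) → ℝ) → ℝ} (hg : ∀ m, Measurable (g m))
    (hi : ∀ m, Integrable (fun w => g m (covariates w, outcome j w)) P) :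
    ∫ w, g (observed j w) (covariates w, outcome j w) ∂P =
      ∑ m, patternProb P m * ∫ w, g m (covariates w, outcome j w) ∂P := by
  have e : ∀ w, g (observed j w) (covariates w, outcome j w) =
      ∑ m, if observed j w = m then g m (covariates w, outcome j w) else 0 := fun w => by
    rw [Finset.sum_ite_eq Finset.univ (observed j w)
      (fun m => g m (covariates w, outcome j w)), if_pos (Finset.mem_univ _)]
  simp_rw [e]
  rw [integral_finsetSum _ fun m _ => ?_]
  · exact Finset.sum_congr rfl fun m _ => integral_ite_observed hP j m (hg m)
  · refine (hi m).mono (measurable_ite_observed j m ((hg m).comp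
      (measurable_covariates.prodMk (measurable_outcome j)))).aestronglyMeasurable
      (ae_of_all _ fun w => ?_)
    split_ifs <;> simp

end Data

/-! ### Linearization of estimators that solve weighted equations in each arm -/

section Linearization

variable {p k : ℕ} {T U : Type} [Fintype T] [Fintype U]

/-- The centered outcome (for `none`) and the negative centered regressors (for `some q`) of the
equation `t`. The outcome of the equation `t` is the one at the visit `e t`. -/
def centeredDatum (P : Measure (FullData p k)) (e : T → Fin (k + 1))
    (ux : (Fin p → ℝ) → Matrix U T ℝ) (o : Option U) (t : T) (a : Fin 2) (w : FullData p k) : ℝ :=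
  o.elim (outcome a w (e t) - ∫ w', outcome a w' (e t) ∂P)
    fun q => -(ux (covariates w) q t - ∫ w', ux (covariates w') q t ∂P)

/-- The centered residual `Y_t(a) - E Y_t(a) - (u(X) - E u(X))ᵀ b`. -/
def centeredResidual (P : Measure (FullData p k)) (e : T → Fin (k + 1))
    (ux : (Fin p → ℝ) → Matrix U T ℝ) (b : U → ℝ) (a : Fin 2) (w : FullData p k) (t : T) : ℝ :=
  outcome a w (e t) - ∫ w', outcome a w' (e t) ∂P -
    ∑ q, b q * (ux (covariates w) q t - ∫ w', ux (covariates w') q t ∂P)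

/-- The influence function of a treatment effect that is estimated in each arm by weighting the
centered residuals with `G m`, where `m` is the pattern of missingness. -/
def influence (P : Measure (FullData p k)) (e : T → Fin (k + 1))
    (ux : (Fin p → ℝ) → Matrix U T ℝ) (b : U → ℝ) (G : (Fin (k + 1) → Bool) → T → ℝ) (a : Fin 2)
    (w : FullData p k) : ℝ :=
  armSign a * (2 * ∑ t, G (observed a w) t * centeredResidual P e ux b a w t)

omit [Fintype T] in
lemma sum_centeredDatum (P : Measure (FullData p k)) (e : T → Fin (k + 1))
    (ux : (Fin p → ℝ) → Matrix U T ℝ) (b : U → ℝ) (a : Fin 2) (w : FullData p k) (t : T) :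
    ∑ o : Option U, o.elim 1 b * centeredDatum P e ux o t a w =
      centeredResidual P e ux b a w t := by
  simp only [Fintype.sum_option, centeredDatum, centeredResidual, Option.elim_none,
    Option.elim_some, one_mul, mul_neg, Finset.sum_neg_distrib, sub_eq_add_neg]

omit [Fintype U] in
/-- Grouping weighted vectors by the pattern of missingness. -/
lemma sum_weight_mulVec {κ π : Type} [Fintype π] [DecidableEq π] (I : Finset κ)
    (V : π → Matrix T T ℝ) (q : κ → Prop) [DecidablePred q] (M : κ → π) (x : κ → T → ℝ) :
    ∑ i ∈ I, (if q i then V (M i) *ᵥ x i else 0) =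
      ∑ m, V m *ᵥ ∑ i ∈ I, if q i ∧ M i = m then x i else 0 := by
  simp_rw [Matrix.mulVec_sum]
  rw [Finset.sum_comm]
  refine Finset.sum_congr rfl fun i _ => ?_
  by_cases hq : q i
  · rw [Finset.sum_eq_single (M i)]
    · simp [hq]
    · intro m _ hm
      simp [hq, hm.symm]
    · simp
  · simp [hq]

/-- Solving the weighted equations of one arm for the error `D` of the arm-specific intercept. -/
lemma sqrt_mul_error_eq [DecidableEq T] {π : Type} [Fintype π] [DecidableEq π] {n : ℕ} (hn : n ≠ 0)
    (V : π → Matrix T T ℝ) (q : ℕ → Prop) [DecidablePred q] (M : ℕ → π) (B : Option U → ℝ)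
    (R : Option U → T → ℕ → ℝ) (D : T → ℝ) (N : Matrix T T ℝ)
    (hN : N = ∑ m, ((n : ℝ)⁻¹ * ∑ i ∈ Finset.range n, if q i ∧ M i = m then (1 : ℝ) else 0) • V m)
    (hdet : IsUnit N.det)
    (heq : ∑ i ∈ Finset.range n, (if q i then V (M i) *ᵥ (fun t => ∑ o, B o * R o t i - D t)
      else 0) = 0) (c : T) :
    √(n : ℝ) * D c = ∑ m, ∑ o, ∑ t, (N⁻¹ * V m) c t * B o *
      ((√(n : ℝ))⁻¹ * ∑ i ∈ Finset.range n, if q i ∧ M i = m then R o t i else 0) := by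
  have hn' : (n : ℝ) ≠ 0 := Nat.cast_ne_zero.2 hn
  set H : π → T → ℝ := fun m t => ∑ o, B o * ∑ i ∈ Finset.range n,
    if q i ∧ M i = m then R o t i else 0 with hH
  rw [sum_weight_mulVec] at heq
  have hsplit : ∀ m, (∑ i ∈ Finset.range n, if q i ∧ M i = m then
      (fun t => ∑ o, B o * R o t i - D t) else 0) =
      H m - (∑ i ∈ Finset.range n, if q i ∧ M i = m then (1 : ℝ) else 0) • D := by
    intro m
    funext t
    simp only [Finset.sum_apply, Pi.sub_apply, Pi.smul_apply, smul_eq_mul, hH, Finset.mul_sum]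
    rw [Finset.sum_comm, Finset.sum_mul, ← Finset.sum_sub_distrib]
    refine Finset.sum_congr rfl fun i _ => ?_
    split_ifs <;> simp
  simp_rw [hsplit, Matrix.mulVec_sub, Finset.sum_sub_distrib] at heq
  have hND : N *ᵥ D = (n : ℝ)⁻¹ • ∑ m, V m *ᵥ H m := by
    rw [sub_eq_zero.1 heq, hN, Matrix.sum_mulVec, Finset.smul_sum]
    refine Finset.sum_congr rfl fun m _ => ?_
    rw [Matrix.smul_mulVec, Matrix.mulVec_smul, smul_smul]
  have hD : D = (n : ℝ)⁻¹ • ∑ m, (N⁻¹ * V m) *ᵥ H m := by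
    have := congrArg (fun x => N⁻¹ *ᵥ x) hND
    simp only [Matrix.mulVec_mulVec, Matrix.nonsing_inv_mul N hdet, Matrix.one_mulVec,
      Matrix.mulVec_smul, Matrix.mulVec_sum] at this
    exact this
  have hs : √(n : ℝ) * (n : ℝ)⁻¹ = (√(n : ℝ))⁻¹ := by
    rw [← div_eq_mul_inv, Real.sqrt_div_self]
  have hDc := congrFun hD c
  simp only [Pi.smul_apply, Finset.sum_apply, smul_eq_mul] at hDc
  rw [hDc, ← mul_assoc, hs, Finset.mul_sum]
  refine Finset.sum_congr rfl fun m _ => ?_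
  simp only [Matrix.mulVec, dotProduct, hH, Finset.mul_sum]
  rw [Finset.sum_comm]
  refine Finset.sum_congr rfl fun o _ => Finset.sum_congr rfl fun t _ =>
    Finset.sum_congr rfl fun i _ => by ring

end Linearization

section Linearization

variable {p k : ℕ} {T U : Type} [Fintype T] [Fintype U]

/-- The centered data of the arm `j` among the participants with pattern `m`, the variables whose
sums drive the asymptotic distribution. -/
def cellDatum (P : Measure (FullData p k)) (e : T → Fin (k + 1))
    (ux : (Fin p → ℝ) → Matrix U T ℝ)
    (κ : Fin 2 × (Fin (k + 1) → Bool) × Option U × T) (a : Fin 2) (w : FullData p k) : ℝ :=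
  if a = κ.1 ∧ observed a w = κ.2.1 then centeredDatum P e ux κ.2.2.1 κ.2.2.2 a w else 0

/-- The coefficients of the cell sums in the estimated treatment effect, as a function of the shares
`s` of the cells and of the weights `V` and coefficients `B`. -/
def cellCoeff [DecidableEq T] (c : T) (s : Fin 2 × (Fin (k + 1) → Bool) → ℝ)
    (V : (Fin (k + 1) → Bool) → Matrix T T ℝ) (B : U → ℝ)
    (κ : Fin 2 × (Fin (k + 1) → Bool) × Option U × T) : ℝ :=
  armSign κ.1 * (((∑ m, s (κ.1, m) • V m)⁻¹ * V κ.2.1) c κ.2.2.2 * κ.2.2.1.elim 1 B)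

/-- The share of the participants that are in arm `jm.1` with pattern `jm.2`. -/
def cellShare {Ω : Type} (W : ℕ → Ω → FullData p k) (A : ℕ → Ω → Fin 2) (n : ℕ) (ω : Ω)
    (jm : Fin 2 × (Fin (k + 1) → Bool)) : ℝ :=
  (n : ℝ)⁻¹ * ∑ i ∈ Finset.range n,
    if A i ω = jm.1 ∧ observed (A i ω) (W i ω) = jm.2 then (1 : ℝ) else 0

variable {P : Measure (FullData p k)} [IsProbabilityMeasure P]

omit [Fintype T] [Fintype U] [IsProbabilityMeasure P] in
lemma measurable_centeredDatum (e : T → Fin (k + 1)) {ux : (Fin p → ℝ) → Matrix U T ℝ}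
    (hum : ∀ q t, Measurable fun x => ux x q t) (o : Option U) (t : T) (a : Fin 2) :
    Measurable (centeredDatum P e ux o t a) := by
  cases o with
  | none => exact ((measurable_pi_apply (e t)).comp (measurable_outcome a)).sub_const _
  | some q => exact (((hum q t).comp measurable_covariates).sub_const _).neg

omit [Fintype T] [Fintype U] in
lemma memLp_centeredDatum (hP : DataAssumptions P) (e : T → Fin (k + 1))
    {ux : (Fin p → ℝ) → Matrix U T ℝ} (hu2 : ∀ q t, MemLp (fun w => ux (covariates w) q t) 2 P)
    (o : Option U) (t : T) (a : Fin 2) : MemLp (centeredDatum P e ux o t a) 2 P := by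
  cases o with
  | none => exact (hP.outcome_memLp a (e t)).sub (memLp_const _)
  | some q => exact ((hu2 q t).sub (memLp_const _)).neg

omit [Fintype T] [Fintype U] in
lemma integral_centeredDatum (hP : DataAssumptions P) (e : T → Fin (k + 1))
    {ux : (Fin p → ℝ) → Matrix U T ℝ} (hu2 : ∀ q t, MemLp (fun w => ux (covariates w) q t) 2 P)
    (o : Option U) (t : T) (a : Fin 2) : ∫ w, centeredDatum P e ux o t a w ∂P = 0 := by
  cases o with
  | none =>
    simp only [centeredDatum, Option.elim_none]
    rw [integral_sub ((hP.outcome_memLp a (e t)).integrable (by norm_num)) (integrable_const _)]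
    simp
  | some q =>
    simp only [centeredDatum, Option.elim_some]
    rw [integral_neg, integral_sub ((hu2 q t).integrable (by norm_num)) (integrable_const _)]
    simp

omit [IsProbabilityMeasure P] in
lemma sum_coeff_cellDatum (e : T → Fin (k + 1)) (ux : (Fin p → ℝ) → Matrix U T ℝ)
    [DecidableEq T] {c : T} {V : (Fin (k + 1) → Bool) → Matrix T T ℝ} {B : U → ℝ}
    {Q : Matrix T T ℝ} (hQ : IsUnit Q.det) {s : Fin 2 × (Fin (k + 1) → Bool) → ℝ}
    (hs : ∀ j, ∑ m, s (j, m) • V m = (1 / 2 : ℝ) • Q) (a : Fin 2) (w : FullData p k) :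
    ∑ κ, cellCoeff c s V B κ * cellDatum P e ux κ a w =
      influence P e ux B (fun m t => (Q⁻¹ * V m) c t) a w := by
  have hinv : ((1 / 2 : ℝ) • Q)⁻¹ = (2 : ℝ) • Q⁻¹ := by
    refine Matrix.inv_eq_right_inv ?_
    rw [Matrix.smul_mul, Matrix.mul_smul, Matrix.mul_nonsing_inv Q hQ, smul_smul]
    norm_num
  simp only [Fintype.sum_prod_type, cellCoeff, cellDatum, hs, hinv]
  rw [Finset.sum_eq_single a (fun j _ hj => by simp [hj.symm]) (by simp),
    Finset.sum_eq_single (observed a w) (fun m _ hm => by simp [hm.symm]) (by simp)]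
  simp only [and_self, if_true, influence, ← sum_centeredDatum, Finset.mul_sum, Matrix.smul_mul,
    Matrix.smul_apply, smul_eq_mul]
  rw [Finset.sum_comm]
  exact Finset.sum_congr rfl fun t _ => Finset.sum_congr rfl fun o _ => by ring

variable {𝒮 Ω ι : Type} [Fintype 𝒮] [DecidableEq 𝒮] [MeasurableSpace 𝒮] [Fintype ι]
  [DiscreteMeasurableSpace 𝒮] [MeasurableSpace Ω] {σ : FullData p k → 𝒮} {μ : Measure Ω}
  [IsProbabilityMeasure μ] {W : ℕ → Ω → FullData p k} {A : ℕ → Ω → Fin 2}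

/-- The law of large numbers for the cell shares. -/
lemma BalancedTrial.tendstoInMeasure_cellShare (BT : BalancedTrial P σ μ W A) (hσ : Measurable σ)
    (hP : DataAssumptions P) :
    TendstoInMeasure μ (cellShare W A) atTop fun _ jm => 1 / 2 * patternProb P jm.2 := by
  refine tendstoInMeasure_pi (X := fun _ => ℝ) (Y := fun jm n ω => cellShare W A n ω jm)
    fun jm => ?_
  have hm : ∀ a : Fin 2, Measurable fun w : FullData p k =>
      if a = jm.1 ∧ observed a w = jm.2 then (1 : ℝ) else 0 := fun a => by
    by_cases h : a = jm.1
    · simpa [h] using measurable_ite_observed jm.1 jm.2 (measurable_const (a := (1 : ℝ)))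
    · simp [h]
  have h := BT.tendstoInMeasure_mean hσ
    (f := fun a w => if a = jm.1 ∧ observed a w = jm.2 then (1 : ℝ) else 0)
    fun a => Integrable.of_bound (hm a).aestronglyMeasurable 1
      (ae_of_all _ fun w => by split_ifs <;> simp)
  convert! h using 2
  rw [Finset.sum_eq_single jm.1 (fun a _ ha => by simp [ha]) (by simp)]
  simp only [true_and]
  rw [integral_ite_observed_one hP]

/-- Asymptotic normality of an estimated treatment effect whose arm-specific intercepts solve
weighted equations, with estimated weights `V m θ̂` and covariate coefficients `β θ̂`: the errors of
these two do not matter to first order. -/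
lemma BalancedTrial.tendstoInDistribution_armwise [DecidableEq T] (BT : BalancedTrial P σ μ W A)
    (hσ : Measurable σ) (hP : DataAssumptions P) {e : T → Fin (k + 1)} {c : T}
    (hc : e c = Fin.last k) {ux : (Fin p → ℝ) → Matrix U T ℝ}
    (hum : ∀ q t, Measurable fun x => ux x q t)
    (hu2 : ∀ q t, MemLp (fun w => ux (covariates w) q t) 2 P)
    {V : (Fin (k + 1) → Bool) → (ι → ℝ) → Matrix T T ℝ} {b : Fin 2 → (ι → ℝ) → T → ℝ}
    {β : (ι → ℝ) → U → ℝ} {θ₀ : ι → ℝ} (hV : ∀ m, ContinuousAt (V m) θ₀) (hβ : ContinuousAt β θ₀)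
    (hQ : IsUnit (∑ m, patternProb P m • V m θ₀).det) {θhat : ℕ → Ω → ι → ℝ}
    (hcons : TendstoInMeasure μ θhat atTop fun _ => θ₀)
    (hmeas : ∀ n, AEMeasurable (fun ω => b 1 (θhat n ω) c - b 0 (θhat n ω) c) μ)
    (hsol : Tendsto (fun n : ℕ => μ {ω | ¬ ∀ j, ∑ i ∈ Finset.range n,
      (if A i ω = j then V (observed (A i ω) (W i ω)) (θhat n ω) *ᵥ (fun t =>
        outcome (A i ω) (W i ω) (e t) - b j (θhat n ω) t -
          ∑ q, β (θhat n ω) q * ux (covariates (W i ω)) q t) else 0) = 0}) atTop (𝓝 0)) :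
    TendstoInDistribution
      (fun (n : ℕ) ω => √(n : ℝ) * (b 1 (θhat n ω) c - b 0 (θhat n ω) c - treatmentEffect P))
      atTop (id : ℝ → ℝ) (fun _ => μ) (gaussianReal 0 (asymptoticVariance P σ
        (influence P e ux (β θ₀)
          fun m t => ((∑ m, patternProb P m • V m θ₀)⁻¹ * V m θ₀) c t)).toNNReal) := by
  classical
  set Q := ∑ m, patternProb P m • V m θ₀ with hQdef
  set s₀ : Fin 2 × (Fin (k + 1) → Bool) → ℝ := fun jm => 1 / 2 * patternProb P jm.2 with hs₀
  have hs₀Q : ∀ j, ∑ m, s₀ (j, m) • V m θ₀ = (1 / 2 : ℝ) • Q := fun j => by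
    rw [hQdef, Finset.smul_sum]
    exact Finset.sum_congr rfl fun m _ => by rw [smul_smul]
  have hdet₀ : ∀ j, (∑ m, s₀ (j, m) • V m θ₀).det ≠ 0 := fun j => by
    rw [hs₀Q, Matrix.det_smul]
    exact mul_ne_zero (by positivity) hQ.ne_zero
  have hstate := tendstoInMeasure_prodMk (BT.tendstoInMeasure_cellShare hσ hP) hcons
  have hNcont : ∀ j, ContinuousAt (fun x : (Fin 2 × (Fin (k + 1) → Bool) → ℝ) × (ι → ℝ) =>
      ∑ m, x.1 (j, m) • V m x.2) (s₀, θ₀) := fun j => by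
    refine tendsto_finsetSum _ fun m _ => Tendsto.smul ?_ ?_
    · exact ((continuous_apply (j, m)).comp continuous_fst).continuousAt
    · exact ContinuousAt.comp (f := Prod.snd) (hV m) continuous_snd.continuousAt
  have hdetcont : ∀ j, ContinuousAt (fun x : (Fin 2 × (Fin (k + 1) → Bool) → ℝ) × (ι → ℝ) =>
      (∑ m, x.1 (j, m) • V m x.2).det) (s₀, θ₀) := fun j =>
    ContinuousAt.comp (g := Matrix.det) (Continuous.matrix_det continuous_id).continuousAt
      (hNcont j)
  have hdetev : ∀ᶠ x in 𝓝 ((s₀, θ₀) : (Fin 2 × (Fin (k + 1) → Bool) → ℝ) × (ι → ℝ)),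
      ∀ j, (∑ m, x.1 (j, m) • V m x.2).det ≠ 0 :=
    eventually_all.2 fun j => (hdetcont j).eventually_ne (hdet₀ j)
  have hC : TendstoInMeasure μ (fun n ω => cellCoeff c (cellShare W A n ω)
      (fun m => V m (θhat n ω)) (β (θhat n ω))) atTop
      fun _ => cellCoeff c s₀ (fun m => V m θ₀) (β θ₀) := by
    refine tendstoInMeasure_comp_continuousAt hstate
      (g := fun x => cellCoeff c x.1 (fun m => V m x.2) (β x.2)) ?_
    refine continuousAt_pi.2 fun κ => ?_
    refine Tendsto.const_mul _ (Tendsto.mul ?_ ?_)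
    · have hinv : ContinuousAt (fun x : (Fin 2 × (Fin (k + 1) → Bool) → ℝ) × (ι → ℝ) =>
          (∑ m, x.1 (κ.1, m) • V m x.2)⁻¹) (s₀, θ₀) := by
        refine ContinuousAt.comp (g := Inv.inv) ?_ (hNcont κ.1)
        refine continuousAt_matrix_inv _ ?_
        rw [Ring.inverse_eq_inv']
        exact continuousAt_inv₀ (hdet₀ κ.1)
      have hVc : ContinuousAt (fun x : (Fin 2 × (Fin (k + 1) → Bool) → ℝ) × (ι → ℝ) =>
          V κ.2.1 x.2) (s₀, θ₀) :=
        ContinuousAt.comp (f := Prod.snd) (hV κ.2.1) continuous_snd.continuousAt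
      have hmul := ContinuousAt.comp (g := fun y : Matrix T T ℝ × Matrix T T ℝ => y.1 * y.2)
        (Continuous.matrix_mul continuous_fst continuous_snd).continuousAt (hinv.prodMk hVc)
      exact ContinuousAt.comp (g := fun y : Matrix T T ℝ => y c κ.2.2.2)
        (Continuous.matrix_elem continuous_id c κ.2.2.2).continuousAt hmul
    · cases κ.2.2.1 with
      | none => exact tendsto_const_nhds
      | some q =>
        exact ContinuousAt.comp (g := fun y : U → ℝ => y q) (continuous_apply q).continuousAt
          (ContinuousAt.comp (f := Prod.snd) hβ continuous_snd.continuousAt)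
  have hξm : ∀ κ a, Measurable (cellDatum P e ux κ a) := fun κ a => by
    unfold cellDatum
    by_cases h : a = κ.1
    · simp only [h, true_and]
      exact measurable_ite_observed _ _ (measurable_centeredDatum e hum _ _ _)
    · simp only [h, false_and, if_false]
      exact measurable_const
  have hξ2 : ∀ κ a, MemLp (cellDatum P e ux κ a) 2 P := fun κ a => by
    refine (memLp_centeredDatum hP e hu2 κ.2.2.1 κ.2.2.2 a).mono (hξm κ a).aestronglyMeasurable
      (ae_of_all _ fun w => ?_)
    unfold cellDatum
    split_ifs <;> simp
  have hξ0 : ∀ κ a, ∫ w, cellDatum P e ux κ a w ∂P = 0 := fun κ a => by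
    unfold cellDatum
    by_cases h : a = κ.1
    · simp only [h, true_and]
      have hc0 := integral_centeredDatum hP e hu2 κ.2.2.1 κ.2.2.2 κ.1
      have hgm : Measurable fun d : (Fin p → ℝ) × (Fin (k + 1) → ℝ) =>
          κ.2.2.1.elim (d.2 (e κ.2.2.2) - ∫ w', outcome κ.1 w' (e κ.2.2.2) ∂P)
            fun q => -(ux d.1 q κ.2.2.2 - ∫ w', ux (covariates w') q κ.2.2.2 ∂P) := by
        cases κ.2.2.1 with
        | none => exact ((measurable_pi_apply _).comp measurable_snd).sub_const _
        | some q => exact (((hum q _).comp measurable_fst).sub_const _).neg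
      have := integral_ite_observed hP κ.1 κ.2.1 hgm
      unfold centeredDatum at hc0 ⊢
      rw [this, hc0, mul_zero]
    · simp [h]
  have hmain := BT.tendstoInDistribution_random_coeff hσ hξm hξ2 hξ0 hC
    (Z := fun (n : ℕ) ω => √(n : ℝ) *
      (b 1 (θhat n ω) c - b 0 (θhat n ω) c - treatmentEffect P))
    (fun n => ((hmeas n).sub_const _).const_mul _) ?_
  · have hinfl : (fun a w => ∑ κ, cellCoeff c s₀ (fun m => V m θ₀) (β θ₀) κ *
        cellDatum P e ux κ a w) = influence P e ux (β θ₀) fun m t => (Q⁻¹ * V m θ₀) c t := by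
      funext a w
      exact sum_coeff_cellDatum e ux hQ hs₀Q a w
    rwa [hinfl] at hmain
  · have hbad := (hsol.add (tendsto_measure_not_of_eventually hstate hdetev))
    rw [add_zero] at hbad
    refine tendsto_of_tendsto_of_tendsto_of_le_of_le' tendsto_const_nhds hbad
      (.of_forall fun n => zero_le) ?_
    filter_upwards [eventually_ne_atTop 0] with n hn
    refine le_trans (measure_mono fun ω hω => ?_) (measure_union_le _ _)
    by_contra hcon
    obtain ⟨h1, h2⟩ := not_or.1 hcon
    have heq := not_not.1 h1
    have hdet := not_not.1 h2
    refine hω ?_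
    -- the error of the intercept of arm `j`, relative to the residual at `θhat`
    set D : Fin 2 → T → ℝ := fun j t => b j (θhat n ω) t - ∫ w, outcome j w (e t) ∂P +
      ∑ q, β (θhat n ω) q * ∫ w, ux (covariates w) q t ∂P with hD
    have hDj : ∀ j, √(n : ℝ) * D j c = ∑ m, ∑ o : Option U, ∑ t,
        ((∑ m, cellShare W A n ω (j, m) • V m (θhat n ω))⁻¹ * V m (θhat n ω)) c t *
          o.elim 1 (β (θhat n ω)) * ((√(n : ℝ))⁻¹ * ∑ i ∈ Finset.range n,
            if A i ω = j ∧ observed (A i ω) (W i ω) = m then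
              centeredDatum P e ux o t (A i ω) (W i ω) else 0) := fun j => by
      refine sqrt_mul_error_eq hn (fun m => V m (θhat n ω)) (fun i => A i ω = j)
        (fun i => observed (A i ω) (W i ω)) (fun o => o.elim 1 (β (θhat n ω)))
        (fun o t i => centeredDatum P e ux o t (A i ω) (W i ω)) (D j) _ rfl
        (isUnit_iff_ne_zero.2 (hdet j)) ?_ c
      refine Eq.trans (Finset.sum_congr rfl fun i _ => ?_) (heq j)
      by_cases hA : A i ω = j
      · rw [if_pos hA, if_pos hA]
        congr 1
        funext t
        rw [sum_centeredDatum, centeredResidual, hD, ← hA]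
        simp only [mul_sub, Finset.sum_sub_distrib]
        ring
      · rw [if_neg hA, if_neg hA]
    have htotal : b 1 (θhat n ω) c - b 0 (θhat n ω) c - treatmentEffect P = D 1 c - D 0 c := by
      simp only [hD, treatmentEffect, hc]
      ring
    rw [htotal, mul_sub, hDj 1, hDj 0]
    simp only [Fintype.sum_prod_type, Fin.sum_univ_two, cellCoeff, cellDatum, armSign]
    simp only [Fin.isValue, zero_ne_one, if_false, if_true, neg_mul, one_mul,
      Finset.sum_neg_distrib]
    ring

end Linearization

/-! ### The precision matrix of the observed visits -/

section Precision

variable {k : ℕ} (m : Fin (k + 1) → Bool) {S : Matrix (Fin (k + 1)) (Fin (k + 1)) ℝ}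

lemma selection_transpose_mul_mul (S : Matrix (Fin (k + 1)) (Fin (k + 1)) ℝ) :
    (selection m)ᵀ * S * selection m = S.submatrix Subtype.val Subtype.val := by
  ext t s
  simp [Matrix.mul_apply, selection]

lemma selection_transpose_mul : (selection m)ᵀ * selection m = 1 := by
  have h := selection_transpose_mul_mul m 1
  rwa [Matrix.mul_one, Matrix.submatrix_one _ Subtype.val_injective] at h

lemma selection_mul_transpose :
    selection m * (selection m)ᵀ = Matrix.diagonal fun t => if m t = true then (1 : ℝ) else 0 := by
  ext t s
  simp only [Matrix.mul_apply, selection, Matrix.transpose_apply, Matrix.of_apply,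
    Matrix.diagonal_apply]
  by_cases h : m t = true
  · rw [Finset.sum_eq_single ⟨t, h⟩]
    · by_cases hts : t = s
      · simp [hts, hts ▸ h]
      · simp [hts, Ne.symm hts]
    · rintro ⟨b, hb⟩ _ hne
      have : t ≠ b := fun hh => hne (Subtype.ext hh.symm)
      simp [this]
    · simp
  · rw [Finset.sum_eq_zero]
    · simp [h]
    · rintro ⟨b, hb⟩ _
      have : t ≠ b := fun hh => h (hh ▸ hb)
      simp [this]

lemma posDef_selection (hS : S.PosDef) : ((selection m)ᵀ * S * selection m).PosDef := by
  rw [selection_transpose_mul_mul]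
  exact hS.submatrix Subtype.val_injective

lemma obsPrecision_posSemidef (hS : S.PosDef) : (obsPrecision m S).PosSemidef := by
  have h := (posDef_selection m hS).inv.posSemidef.mul_mul_conjTranspose_same (selection m)
  rwa [Matrix.conjTranspose_eq_transpose_of_trivial] at h

lemma obsPrecision_transpose (hS : S.PosDef) : (obsPrecision m S)ᵀ = obsPrecision m S := by
  rw [← Matrix.conjTranspose_eq_transpose_of_trivial]
  exact (obsPrecision_posSemidef m hS).isHermitian

/-- `V_m(Σ) Σ` acts as the identity on the vectors supported on the observed visits. -/
lemma obsPrecision_mul_mulVec (hS : S.PosDef) {b : Fin (k + 1) → ℝ}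
    (hb : ∀ t, m t = false → b t = 0) : (obsPrecision m S * S) *ᵥ b = b := by
  have hdet := (Matrix.isUnit_iff_isUnit_det _).1 (posDef_selection m hS).isUnit
  have h1 : obsPrecision m S * S * selection m = selection m := by
    unfold obsPrecision
    rw [Matrix.mul_assoc, Matrix.mul_assoc, Matrix.mul_assoc, ← Matrix.mul_assoc _ S,
      Matrix.nonsing_inv_mul _ hdet, Matrix.mul_one]
  have h2 : (selection m * (selection m)ᵀ) *ᵥ b = b := by
    rw [selection_mul_transpose]
    funext t
    rw [Matrix.mulVec_diagonal]
    by_cases h : m t = true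
    · simp [h]
    · simp [hb t (by simpa using h)]
  conv_lhs => rw [← h2]
  rw [Matrix.mulVec_mulVec, ← Matrix.mul_assoc, h1, h2]

lemma obsPrecision_apply_eq_zero {t s : Fin (k + 1)} (ht : m t = false) :
    obsPrecision m S t s = 0 := by
  have h : selection m * (selection m)ᵀ * obsPrecision m S = obsPrecision m S := by
    unfold obsPrecision
    rw [← Matrix.mul_assoc, ← Matrix.mul_assoc, Matrix.mul_assoc (selection m) _ (selection m),
      selection_transpose_mul, Matrix.mul_one]
  rw [← h, selection_mul_transpose, Matrix.diagonal_mul]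
  simp [ht]

lemma obsPrecision_mul_mul (hS : S.PosDef) :
    obsPrecision m S * S * obsPrecision m S = obsPrecision m S := by
  refine Matrix.ext_of_mulVec_single fun s => ?_
  rw [← Matrix.mulVec_mulVec]
  refine obsPrecision_mul_mulVec m hS fun t ht => ?_
  simp [obsPrecision_apply_eq_zero m ht]

lemma obsPrecision_full_mul (hS : S.PosDef) : obsPrecision (fun _ => true) S * S = 1 := by
  refine Matrix.ext_of_mulVec_single fun s => ?_
  rw [obsPrecision_mul_mulVec _ hS (by simp), Matrix.one_mulVec]

lemma sum_smul_obsPrecision_posDef (hS : S.PosDef) {w : (Fin (k + 1) → Bool) → ℝ}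
    (hw : ∀ m, 0 ≤ w m) (hw1 : 0 < w fun _ => true) : (∑ m, w m • obsPrecision m S).PosDef := by
  have hfull : obsPrecision (fun _ => true) S = S⁻¹ :=
    (Matrix.inv_eq_left_inv (obsPrecision_full_mul hS)).symm
  rw [← Finset.add_sum_erase _ _ (Finset.mem_univ fun _ => true), hfull]
  refine (hS.inv.smul hw1).add_posSemidef (Matrix.posSemidef_sum _ fun m _ => ?_)
  exact (obsPrecision_posSemidef m hS).smul (hw m)

lemma continuousAt_obsPrecision (hS : S.PosDef) : ContinuousAt (obsPrecision m) S := by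
  have hdet := (Matrix.isUnit_iff_isUnit_det _).1 (posDef_selection m hS).isUnit
  have h1 : ContinuousAt (fun S : Matrix (Fin (k + 1)) (Fin (k + 1)) ℝ =>
      ((selection m)ᵀ * S * selection m)⁻¹) S := by
    refine ContinuousAt.comp (g := Inv.inv) ?_ (by fun_prop)
    refine continuousAt_matrix_inv _ ?_
    rw [Ring.inverse_eq_inv']
    exact continuousAt_inv₀ hdet.ne_zero
  exact ContinuousAt.comp (g := fun N => selection m * N * (selection m)ᵀ)
    (Continuous.continuousAt (by fun_prop)) h1

/-- The generalized Gauss–Markov inequality: among the weights `b m` supported on the observed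
visits with a given mean `c`, the variance `∑ w_m b_mᵀ Σ b_m` is minimal for `b_m = V_m(Σ) Q⁻¹ c`,
where `Q = ∑ w_m V_m(Σ)`. -/
lemma dotProduct_inv_le_sum_variance (hS : S.PosDef) {w : (Fin (k + 1) → Bool) → ℝ}
    (hw : ∀ m, 0 ≤ w m) (hw1 : 0 < w fun _ => true) {b : (Fin (k + 1) → Bool) → Fin (k + 1) → ℝ}
    (hb : ∀ m t, m t = false → b m t = 0) {c : Fin (k + 1) → ℝ} (hc : ∑ m, w m • b m = c) :
    c ⬝ᵥ ((∑ m, w m • obsPrecision m S)⁻¹ *ᵥ c) ≤ ∑ m, w m * (b m ⬝ᵥ (S *ᵥ b m)) := by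
  set Q := ∑ m, w m • obsPrecision m S with hQ
  have hQu := (Matrix.isUnit_iff_isUnit_det _).1 (sum_smul_obsPrecision_posDef hS hw hw1).isUnit
  set g := Q⁻¹ *ᵥ c with hg
  have hQg : Q *ᵥ g = c := by
    rw [hg, Matrix.mulVec_mulVec, Matrix.mul_nonsing_inv _ hQu, Matrix.one_mulVec]
  have hnn : ∀ m, 0 ≤ (b m - obsPrecision m S *ᵥ g) ⬝ᵥ (S *ᵥ (b m - obsPrecision m S *ᵥ g)) :=
    fun m => by simpa using hS.posSemidef.dotProduct_mulVec_nonneg (b m - obsPrecision m S *ᵥ g)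
  have hexp : ∀ m, (b m - obsPrecision m S *ᵥ g) ⬝ᵥ (S *ᵥ (b m - obsPrecision m S *ᵥ g)) =
      b m ⬝ᵥ (S *ᵥ b m) - 2 * (g ⬝ᵥ b m) + g ⬝ᵥ (obsPrecision m S *ᵥ g) := fun m => by
    have hSt : Sᵀ = S := by
      rw [← Matrix.conjTranspose_eq_transpose_of_trivial]
      exact hS.isHermitian
    have e1 : (obsPrecision m S *ᵥ g) ⬝ᵥ (S *ᵥ b m) = g ⬝ᵥ b m := by
      rw [Matrix.dotProduct_mulVec, Matrix.vecMul_mulVec, ← Matrix.dotProduct_mulVec,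
        obsPrecision_transpose m hS, obsPrecision_mul_mulVec m hS (hb m)]
    have e2 : b m ⬝ᵥ (S *ᵥ (obsPrecision m S *ᵥ g)) = g ⬝ᵥ b m := by
      rw [← e1, Matrix.dotProduct_mulVec, ← Matrix.mulVec_transpose, hSt, dotProduct_comm]
    have e3 : (obsPrecision m S *ᵥ g) ⬝ᵥ (S *ᵥ (obsPrecision m S *ᵥ g)) =
        g ⬝ᵥ (obsPrecision m S *ᵥ g) := by
      rw [Matrix.dotProduct_mulVec, Matrix.vecMul_mulVec, ← Matrix.dotProduct_mulVec,
        obsPrecision_transpose m hS, Matrix.mulVec_mulVec, obsPrecision_mul_mul m hS]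
    rw [Matrix.mulVec_sub, sub_dotProduct, dotProduct_sub, dotProduct_sub, e1, e2, e3]
    ring
  have h := Finset.sum_nonneg fun m (_ : m ∈ Finset.univ) => mul_nonneg (hw m) (hnn m)
  simp_rw [hexp, mul_add, mul_sub, Finset.sum_add_distrib, Finset.sum_sub_distrib] at h
  have s1 : ∑ m, w m * (2 * (g ⬝ᵥ b m)) = 2 * (g ⬝ᵥ c) := by
    rw [← hc, dotProduct_sum, Finset.mul_sum]
    refine Finset.sum_congr rfl fun m _ => ?_
    rw [dotProduct_smul, smul_eq_mul]
    ring
  have s2 : ∑ m, w m * (g ⬝ᵥ (obsPrecision m S *ᵥ g)) = g ⬝ᵥ c := by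
    conv_rhs => rw [← hQg, hQ, Matrix.sum_mulVec, dotProduct_sum]
    refine Finset.sum_congr rfl fun m _ => ?_
    rw [Matrix.smul_mulVec, dotProduct_smul, smul_eq_mul]
  rw [s1, s2] at h
  rw [dotProduct_comm]
  linarith

/-- The variance of the optimal weights. -/
lemma sum_variance_obsPrecision (hS : S.PosDef) {w : (Fin (k + 1) → Bool) → ℝ}
    (hw : ∀ m, 0 ≤ w m) (hw1 : 0 < w fun _ => true) {c : Fin (k + 1) → ℝ} :
    ∑ m, w m * ((obsPrecision m S *ᵥ ((∑ m, w m • obsPrecision m S)⁻¹ *ᵥ c)) ⬝ᵥ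
      (S *ᵥ (obsPrecision m S *ᵥ ((∑ m, w m • obsPrecision m S)⁻¹ *ᵥ c)))) =
      c ⬝ᵥ ((∑ m, w m • obsPrecision m S)⁻¹ *ᵥ c) := by
  set Q := ∑ m, w m • obsPrecision m S with hQ
  have hQu := (Matrix.isUnit_iff_isUnit_det _).1 (sum_smul_obsPrecision_posDef hS hw hw1).isUnit
  set g := Q⁻¹ *ᵥ c with hg
  have hQg : Q *ᵥ g = c := by
    rw [hg, Matrix.mulVec_mulVec, Matrix.mul_nonsing_inv _ hQu, Matrix.one_mulVec]
  rw [dotProduct_comm c]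
  conv_rhs => rw [← hQg, hQ, Matrix.sum_mulVec, dotProduct_sum]
  refine Finset.sum_congr rfl fun m _ => ?_
  rw [Matrix.smul_mulVec, dotProduct_smul, smul_eq_mul, Matrix.dotProduct_mulVec,
    Matrix.vecMul_mulVec, ← Matrix.dotProduct_mulVec, obsPrecision_transpose m hS,
    Matrix.mulVec_mulVec, obsPrecision_mul_mul m hS]

open scoped MatrixOrder in
lemma exists_eq_transpose_mul_self {n : Type} [Fintype n] [DecidableEq n] {A : Matrix n n ℝ}
    (hA : A.PosSemidef) : ∃ B : Matrix n n ℝ, A = Bᵀ * B := by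
  obtain ⟨B, hB⟩ := CStarAlgebra.nonneg_iff_eq_star_mul_self.1 hA.nonneg
  exact ⟨B, by rwa [Matrix.star_eq_conjTranspose,
    Matrix.conjTranspose_eq_transpose_of_trivial] at hB⟩

/-- The matrices `V_m(Σ) H V_m(Σ)` are orthogonal to the symmetric matrix `H` on average only if `H`
vanishes. -/
lemma eq_zero_of_sum_trace_eq_zero (hS : S.PosDef) {w : (Fin (k + 1) → Bool) → ℝ}
    (hw : ∀ m, 0 ≤ w m) (hw1 : 0 < w fun _ => true) {H : Matrix (Fin (k + 1)) (Fin (k + 1)) ℝ}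
    (hH : Hᵀ = H)
    (h : ∑ m, w m * (obsPrecision m S * H * obsPrecision m S * H).trace = 0) : H = 0 := by
  have hnn : ∀ m, 0 ≤ (obsPrecision m S * H * obsPrecision m S * H).trace := fun m => by
    have hPSD : (H * obsPrecision m S * H).PosSemidef := by
      have := (obsPrecision_posSemidef m hS).mul_mul_conjTranspose_same H
      rwa [Matrix.conjTranspose_eq_transpose_of_trivial, hH] at this
    obtain ⟨B, hB⟩ := exists_eq_transpose_mul_self (obsPrecision_posSemidef m hS)
    have h3 := (hPSD.mul_mul_conjTranspose_same B).trace_nonneg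
    rw [Matrix.conjTranspose_eq_transpose_of_trivial, Matrix.mul_assoc, Matrix.trace_mul_comm,
      Matrix.mul_assoc, ← hB] at h3
    rw [Matrix.mul_assoc, Matrix.mul_assoc, Matrix.trace_mul_comm]
    simpa only [Matrix.mul_assoc] using h3
  have hz := (Finset.sum_eq_zero_iff_of_nonneg fun m _ => mul_nonneg (hw m) (hnn m)).1 h
    (fun _ => true) (Finset.mem_univ _)
  have htr := (mul_eq_zero.1 hz).resolve_left hw1.ne'
  have hfull : obsPrecision (fun _ => true) S = S⁻¹ :=
    (Matrix.inv_eq_left_inv (obsPrecision_full_mul hS)).symm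
  rw [hfull] at htr
  -- with `S⁻¹ = Bᵀ B`, the trace is the squared Frobenius norm of `B H Bᵀ`
  obtain ⟨B, hBu, hB⟩ : ∃ B : Matrix (Fin (k + 1)) (Fin (k + 1)) ℝ, IsUnit B.det ∧
      S⁻¹ = Bᵀ * B := by
    obtain ⟨B, hB⟩ := exists_eq_transpose_mul_self hS.inv.posSemidef
    refine ⟨B, ?_, hB⟩
    have := hS.inv.det_pos
    rw [hB, Matrix.det_mul] at this
    exact isUnit_iff_ne_zero.2 fun h0 => by simp [h0] at this
  have hF : ((B * H * Bᵀ)ᵀ * (B * H * Bᵀ)).trace = 0 := by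
    rw [← htr, hB]
    simp only [Matrix.transpose_mul, Matrix.transpose_transpose, hH, Matrix.mul_assoc]
    rw [Matrix.trace_mul_comm]
    simp only [Matrix.mul_assoc]
    rw [Matrix.trace_mul_comm]
    simp only [Matrix.mul_assoc]
  have h0 : B * H * Bᵀ = 0 := by
    have := Matrix.trace_conjTranspose_mul_self_eq_zero_iff (A := B * H * Bᵀ)
    rw [Matrix.conjTranspose_eq_transpose_of_trivial] at this
    exact this.1 hF
  have hBt : IsUnit (Bᵀ).det := by rwa [Matrix.det_transpose]
  have h1 : H = B⁻¹ * (B * H * Bᵀ) * (Bᵀ)⁻¹ := by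
    rw [Matrix.mul_assoc, Matrix.mul_nonsing_inv_cancel_right _ _ hBt, ← Matrix.mul_assoc,
      Matrix.nonsing_inv_mul _ hBu, Matrix.one_mul]
  rw [h1, h0]
  simp

end Precision

/-! ### Consistency and asymptotic normality of the estimators -/

section Estimators

variable {p k : ℕ} {P : Measure (FullData p k)} [IsProbabilityMeasure P] {ι : Type} [Fintype ι]
  {ψ : EstimatingFunction p k ι} {Θ : Set (ι → ℝ)} {θ₀ : ι → ℝ}

lemma RegularityConditions.integrable (hR : RegularityConditions P ψ Θ θ₀) (j : Fin 2) {θ : ι → ℝ}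
    (hθ : θ ∈ Θ) (r : ι) : Integrable (fun w => ψ j (armData j w) θ r) P :=
  ((hR.moment j θ hθ).integrable (by norm_num)).eval r

lemma RegularityConditions.populationEquation_apply (hR : RegularityConditions P ψ Θ θ₀)
    {θ : ι → ℝ} (hθ : θ ∈ Θ) (r : ι) :
    populationEquation P ψ θ r = 1 / 2 * ∑ j, ∫ w, ψ j (armData j w) θ r ∂P := by
  simp only [populationEquation, Finset.sum_apply, Pi.smul_apply, smul_eq_mul, Finset.mul_sum]
  exact Finset.sum_congr rfl fun j _ => by rw [eval_integral fun r => hR.integrable j hθ r]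

lemma RegularityConditions.sum_integral_eq_zero (hR : RegularityConditions P ψ Θ θ₀) (r : ι) :
    ∑ j, ∫ w, ψ j (armData j w) θ₀ r ∂P = 0 := by
  have h := hR.populationEquation_apply (interior_subset hR.mem_interior) r
  rw [hR.root, Pi.zero_apply] at h
  linarith

variable {𝒮 Ω : Type} [Fintype 𝒮] [DecidableEq 𝒮] [MeasurableSpace 𝒮]
  [DiscreteMeasurableSpace 𝒮] [MeasurableSpace Ω] {σ : FullData p k → 𝒮} {μ : Measure Ω}
  [IsProbabilityMeasure μ] {W : ℕ → Ω → FullData p k} {A : ℕ → Ω → Fin 2} {θhat : ℕ → Ω → ι → ℝ}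

omit [IsProbabilityMeasure μ] in
lemma IsMEstimator.tendsto_measure_not_root (hM : IsMEstimator μ W A ψ Θ θhat) :
    Tendsto (fun n : ℕ => μ {ω | ¬ (θhat n ω ∈ Θ ∧
      ∑ i ∈ Finset.range n, ψ (A i ω) (armData (A i ω) (W i ω)) (θhat n ω) = 0)}) atTop (𝓝 0) := by
  refine hM.solves.congr' ?_
  filter_upwards [eventually_ne_atTop 0] with n hn
  simp [hn]

/-- M-estimators are consistent. -/
lemma RegularityConditions.tendstoInMeasure (hR : RegularityConditions P ψ Θ θ₀)
    (BT : BalancedTrial P σ μ W A) (hσ : Measurable σ) (hM : IsMEstimator μ W A ψ Θ θhat) :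
    TendstoInMeasure μ θhat atTop fun _ => θ₀ := by
  choose u hu hfu using hR.dominated
  refine BT.tendstoInMeasure_root hσ hR.compact (f := fun a w θ => ψ a (armData a w) θ)
    (fun a θ hθ r => (hR.integrable a hθ r).aemeasurable) (fun a => ?_) hu hfu (fun θ hθ h => ?_)
    hM.tendsto_measure_not_root
  · filter_upwards [hR.smooth a] with w hw θ hθ
    exact (hw θ hθ).continuousAt.continuousWithinAt
  · refine hR.root_unique θ hθ (funext fun r => ?_)
    rw [hR.populationEquation_apply hθ r, h r, mul_zero, Pi.zero_apply]

omit 𝒮 Ω [Fintype 𝒮] [DecidableEq 𝒮] [MeasurableSpace 𝒮] [DiscreteMeasurableSpace 𝒮]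
  [MeasurableSpace Ω] σ μ [IsProbabilityMeasure μ] W A θhat in
/-- Asymptotic normality of M-estimators whose estimating equations entail weighted equations for
arm-specific intercepts. -/
lemma RegularityConditions.hasAsymptoticVariance {T U 𝒮 : Type} [Fintype T] [Fintype U]
    [DecidableEq T] [Fintype 𝒮] [DecidableEq 𝒮] [MeasurableSpace 𝒮] [DiscreteMeasurableSpace 𝒮]
    (hR : RegularityConditions P ψ Θ θ₀) (hP : DataAssumptions P) {σ : FullData p k → 𝒮}
    (hσ : Measurable σ) {D : Scheme p k}
    (hD : ∀ (Ω : Type) [MeasurableSpace Ω] (μ : Measure Ω) [IsProbabilityMeasure μ]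
      (W : ℕ → Ω → FullData p k) (A : ℕ → Ω → Fin 2), IsIIDSample P μ W → D μ W A →
        BalancedTrial P σ μ W A)
    {e : T → Fin (k + 1)} {c : T} (hc : e c = Fin.last k) {ux : (Fin p → ℝ) → Matrix U T ℝ}
    (hum : ∀ q t, Measurable fun x => ux x q t)
    (hu2 : ∀ q t, MemLp (fun w => ux (covariates w) q t) 2 P)
    {V : (Fin (k + 1) → Bool) → (ι → ℝ) → Matrix T T ℝ} {b : Fin 2 → (ι → ℝ) → T → ℝ}
    {β : (ι → ℝ) → U → ℝ} (hV : ∀ m, ContinuousAt (V m) θ₀) (hβ : ContinuousAt β θ₀)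
    (hQ : IsUnit (∑ m, patternProb P m • V m θ₀).det) {r : ι}
    (hr : ∀ θ, θ r = b 1 θ c - b 0 θ c)
    (hψ : ∀ (I : Finset ℕ) (a : ℕ → Fin 2) (w : ℕ → FullData p k) (θ : ι → ℝ),
      ∑ i ∈ I, ψ (a i) (armData (a i) (w i)) θ = 0 → ∀ j, ∑ i ∈ I,
        (if a i = j then V (observed (a i) (w i)) θ *ᵥ (fun t => outcome (a i) (w i) (e t) -
          b j θ t - ∑ q, β θ q * ux (covariates (w i)) q t) else 0) = 0) :
    HasAsymptoticVariance P D ψ Θ r (asymptoticVariance P σ (influence P e ux (β θ₀)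
      fun m t => ((∑ m, patternProb P m • V m θ₀)⁻¹ * V m θ₀) c t)).toNNReal := by
  intro Ω _ μ _ W A θhat hW hA hM
  have BT := hD Ω μ W A hW hA
  simp only [hr]
  refine BT.tendstoInDistribution_armwise hσ hP hc hum hu2 hV hβ hQ (hR.tendstoInMeasure BT hσ hM)
    (fun n => ?_) ?_
  · simp only [← hr]
    exact (measurable_pi_apply r).comp_aemeasurable (hM.aemeasurable n)
  · refine tendsto_of_tendsto_of_tendsto_of_le_of_le tendsto_const_nhds
      hM.tendsto_measure_not_root (fun n => zero_le) fun n => measure_mono fun ω hω h => hω ?_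
    exact hψ _ (fun i => A i ω) (fun i => W i ω) _ h.2

end Estimators

/-- Equations that hold in the treated arm and in the whole sample hold in each arm. -/
lemma sum_ite_arm_eq_zero {M : Type} [AddCommGroup M] [Module ℝ M] {I : Finset ℕ} {a : ℕ → Fin 2}
    {R : ℕ → M} (h0 : ∑ i ∈ I, R i = 0) (h1 : ∑ i ∈ I, treated (a i) • R i = 0) (j : Fin 2) :
    ∑ i ∈ I, (if a i = j then R i else 0) = 0 := by
  have : j = 1 ∨ j = 0 := by omega
  rcases this with rfl | rfl
  · refine Eq.trans (Finset.sum_congr rfl fun i _ => ?_) h1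
    by_cases hi : a i = 1 <;> simp [treated, hi]
  · have h2 : ∑ i ∈ I, (R i - treated (a i) • R i) = 0 := by
      rw [Finset.sum_sub_distrib, h0, h1, sub_zero]
    refine Eq.trans (Finset.sum_congr rfl fun i _ => ?_) h2
    have : a i = 0 ∨ a i = 1 := by omega
    rcases this with hi | hi <;> simp [treated, hi]

section Mmrm

variable {p k : ℕ} {U : Type} [Fintype U] {P : Measure (FullData p k)}

omit [Fintype U] in
lemma continuous_mmrmCov : Continuous (mmrmCov : (MmrmIndex k U → ℝ) → _) := by
  refine continuous_pi fun t => continuous_pi fun s => ?_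
  exact continuous_apply _

/-- The precision matrix of the observed visits averaged over the patterns of missingness. -/
def meanPrecision (P : Measure (FullData p k)) (S : Matrix (Fin (k + 1)) (Fin (k + 1)) ℝ) :
    Matrix (Fin (k + 1)) (Fin (k + 1)) ℝ :=
  ∑ m, patternProb P m • obsPrecision m S

/-- The weights `V_m(Σ) Q⁻¹ e_K` of the MMRM estimators. -/
def mmrmWeight (P : Measure (FullData p k)) (S : Matrix (Fin (k + 1)) (Fin (k + 1)) ℝ)
    (m : Fin (k + 1) → Bool) (t : Fin (k + 1)) : ℝ :=
  ((meanPrecision P S)⁻¹ * obsPrecision m S) (Fin.last k) t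

variable [IsProbabilityMeasure P]

lemma isUnit_det_meanPrecision (hP : DataAssumptions P)
    {S : Matrix (Fin (k + 1)) (Fin (k + 1)) ℝ} (hS : S.PosDef) :
    IsUnit (meanPrecision P S).det :=
  (Matrix.isUnit_iff_isUnit_det _).1
    (sum_smul_obsPrecision_posDef hS patternProb_nonneg (patternProb_full_pos hP)).isUnit

/-- Asymptotic normality of the MMRM estimators. -/
lemma hasAsymptoticVariance_mmrm {𝒮 : Type} [Fintype 𝒮] [DecidableEq 𝒮] [MeasurableSpace 𝒮]
    [DiscreteMeasurableSpace 𝒮] (hP : DataAssumptions P) {σ : FullData p k → 𝒮}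
    (hσ : Measurable σ) {D : Scheme p k}
    (hD : ∀ (Ω : Type) [MeasurableSpace Ω] (μ : Measure Ω) [IsProbabilityMeasure μ]
      (W : ℕ → Ω → FullData p k) (A : ℕ → Ω → Fin 2), IsIIDSample P μ W → D μ W A →
        BalancedTrial P σ μ W A)
    {u : (Fin p → ℝ) → Matrix U (Fin (k + 1)) ℝ} (hum : ∀ q t, Measurable fun x => u x q t)
    (hu2 : ∀ q t, MemLp (fun w => u (covariates w) q t) 2 P) {Θ : Set (MmrmIndex k U → ℝ)}
    {θ₀ : MmrmIndex k U → ℝ} (hR : RegularityConditions P (mmrmPsi k u) Θ θ₀)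
    (hS : (mmrmCov θ₀).PosDef) :
    HasAsymptoticVariance P D (mmrmPsi k u) Θ (mmrmEffect k U) (asymptoticVariance P σ
      (influence P id u (fun q => θ₀ (.inr (.inr (.inl q))))
        (mmrmWeight P (mmrmCov θ₀)))).toNNReal := by
  refine hR.hasAsymptoticVariance hP hσ hD (e := id) (c := Fin.last k) rfl hum hu2
    (V := fun m θ => obsPrecision m (mmrmCov θ))
    (b := fun j θ t => θ (.inl t) + treated j * θ (.inr (.inl t)))
    (β := fun θ q => θ (.inr (.inr (.inl q)))) (fun m => ?_)
    (continuous_pi fun q => continuous_apply _).continuousAt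
    (isUnit_det_meanPrecision hP hS) (fun θ => ?_) fun I a w θ h => ?_
  · exact ContinuousAt.comp (continuousAt_obsPrecision m hS) continuous_mmrmCov.continuousAt
  · simp [mmrmEffect, treated]
  · have hres : ∀ i, mmrmResidual (u (covariates (w i))) (a i) (outcome (a i) (w i)) θ =
        fun t => outcome (a i) (w i) (id t) -
          (θ (.inl t) + treated (a i) * θ (.inr (.inl t))) -
          ∑ q, θ (.inr (.inr (.inl q))) * u (covariates (w i)) q t := fun i => by
      funext t
      simp only [mmrmResidual, Matrix.mulVec, dotProduct, Matrix.transpose_apply, id]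
      rw [Finset.sum_congr rfl fun q _ => mul_comm _ _]
      ring
    set R : ℕ → Fin (k + 1) → ℝ := fun i => obsPrecision (observed (a i) (w i)) (mmrmCov θ) *ᵥ
      mmrmResidual (u (covariates (w i))) (a i) (outcome (a i) (w i)) θ with hRdef
    have h0 : ∑ i ∈ I, R i = 0 := funext fun t => by
      have := congrFun h (.inl t)
      rwa [Finset.sum_apply] at this ⊢
    have h1 : ∑ i ∈ I, treated (a i) • R i = 0 := funext fun t => by
      have := congrFun h (.inr (.inl t))
      rwa [Finset.sum_apply] at this ⊢
    have hj : ∀ j i, (if a i = j then obsPrecision (observed (a i) (w i)) (mmrmCov θ) *ᵥ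
        (fun t => outcome (a i) (w i) (id t) - (θ (.inl t) + treated j * θ (.inr (.inl t))) -
          ∑ q, θ (.inr (.inr (.inl q))) * u (covariates (w i)) q t) else 0) =
        if a i = j then R i else 0 := fun j i => by
      by_cases hij : a i = j
      · rw [if_pos hij, if_pos hij]
        simp only [hRdef]
        rw [hres, hij]
      · rw [if_neg hij, if_neg hij]
    intro j
    rw [Finset.sum_congr rfl fun i _ => hj j i]
    exact sum_ite_arm_eq_zero h0 h1 j

end Mmrm

section Ancova

variable {p k : ℕ} {P : Measure (FullData p k)}

/-- The probability that the last visit is observed. -/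
def lastProb (P : Measure (FullData p k)) : ℝ :=
  ∑ m, patternProb P m * if m (Fin.last k) = true then 1 else 0

lemma lastProb_pos [IsProbabilityMeasure P] (hP : DataAssumptions P) : 0 < lastProb P := by
  refine Finset.sum_pos' (fun m _ => mul_nonneg (patternProb_nonneg m) (by split_ifs <;> norm_num))
    ⟨fun _ => true, Finset.mem_univ _, ?_⟩
  simpa using patternProb_full_pos hP

/-- The weights of ANCOVA: inverse probability weights of the last visit. -/
def ancovaWeight (P : Measure (FullData p k)) (m : Fin (k + 1) → Bool) (t : Fin (k + 1)) : ℝ :=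
  if t = Fin.last k then (lastProb P)⁻¹ * if m (Fin.last k) = true then 1 else 0 else 0

/-- Asymptotic normality of ANCOVA. -/
lemma hasAsymptoticVariance_ancova [IsProbabilityMeasure P] {𝒮 : Type} [Fintype 𝒮] [DecidableEq 𝒮]
    [MeasurableSpace 𝒮] [DiscreteMeasurableSpace 𝒮] (hP : DataAssumptions P)
    {σ : FullData p k → 𝒮} (hσ : Measurable σ) {D : Scheme p k}
    (hD : ∀ (Ω : Type) [MeasurableSpace Ω] (μ : Measure Ω) [IsProbabilityMeasure μ]
      (W : ℕ → Ω → FullData p k) (A : ℕ → Ω → Fin 2), IsIIDSample P μ W → D μ W A →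
        BalancedTrial P σ μ W A)
    {Θ : Set (AncovaIndex p → ℝ)} {θ₀ : AncovaIndex p → ℝ}
    (hR : RegularityConditions P (ancovaPsi p k) Θ θ₀) :
    HasAsymptoticVariance P D (ancovaPsi p k) Θ (ancovaEffect p) (asymptoticVariance P σ
      (influence P id (mmrmOneDesign p k) (fun l => θ₀ (.inr (.inr l)))
        (ancovaWeight P))).toNNReal := by
  have hQeq : ∑ m, patternProb P m • ((if m (Fin.last k) = true then (1 : ℝ) else 0) •
      (1 : Matrix Unit Unit ℝ)) = lastProb P • 1 := by
    rw [lastProb, Finset.sum_smul]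
    exact Finset.sum_congr rfl fun m _ => by rw [smul_smul]
  have hinv : (lastProb P • (1 : Matrix Unit Unit ℝ))⁻¹ = (lastProb P)⁻¹ • 1 := by
    refine Matrix.inv_eq_right_inv ?_
    rw [Matrix.smul_mul, Matrix.one_mul, smul_smul, mul_inv_cancel₀ (lastProb_pos hP).ne', one_smul]
  have hmain := hR.hasAsymptoticVariance hP hσ hD (T := Unit) (e := fun _ => Fin.last k) (c := ())
    rfl (ux := fun x => Matrix.of fun l _ => x l) (fun q t => measurable_pi_apply q)
    (fun q t => hP.covariates_memLp q)
    (V := fun m _ => (if m (Fin.last k) = true then (1 : ℝ) else 0) • (1 : Matrix Unit Unit ℝ))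
    (b := fun j θ _ => θ (.inl ()) + treated j * θ (.inr (.inl ())))
    (β := fun θ q => θ (.inr (.inr q))) (fun m => continuousAt_const)
    (continuous_pi fun q => continuous_apply _).continuousAt
    (by rw [hQeq]; simp [(lastProb_pos hP).ne']) (r := ancovaEffect p)
    (fun θ => by simp [ancovaEffect, treated]) ?_
  · convert! hmain using 3
    rw [hQeq, hinv]
    funext a w
    by_cases hm : observed a w (Fin.last k) = true <;>
      simp [influence, ancovaWeight, centeredResidual, mmrmOneDesign, hm]
  · intro I a w θ h
    set R : ℕ → ℝ := fun i => (if observed (a i) (w i) (Fin.last k) = true then 1 else 0) *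
      (outcome (a i) (w i) (Fin.last k) - (θ (.inl ()) + treated (a i) * θ (.inr (.inl ()))) -
        ∑ l, θ (.inr (.inr l)) * covariates (w i) l) with hRdef
    have hψ : ∀ i r, ancovaPsi p k (a i) (armData (a i) (w i)) θ r =
        R i * ancovaRegressor (a i) (covariates (w i)) r := fun i r => by
      simp only [ancovaPsi, armData, hRdef, Pi.smul_apply, smul_eq_mul]
      congr 2
      ring
    have h0 : ∑ i ∈ I, R i = 0 := by
      have := congrFun h (.inl ())
      rw [Finset.sum_apply] at this
      refine Eq.trans (Finset.sum_congr rfl fun i _ => ?_) this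
      rw [hψ]
      simp [ancovaRegressor]
    have h1 : ∑ i ∈ I, treated (a i) • R i = 0 := by
      have := congrFun h (.inr (.inl ()))
      rw [Finset.sum_apply] at this
      refine Eq.trans (Finset.sum_congr rfl fun i _ => ?_) this
      rw [hψ]
      simp [ancovaRegressor, mul_comm]
    have hj : ∀ j i t, (if a i = j then
        ((if observed (a i) (w i) (Fin.last k) = true then (1 : ℝ) else 0) •
          (1 : Matrix Unit Unit ℝ)) *ᵥ (fun _ => outcome (a i) (w i) (Fin.last k) -
          (θ (.inl ()) + treated j * θ (.inr (.inl ()))) -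
          ∑ l, θ (.inr (.inr l)) * covariates (w i) l) else 0) t =
        if a i = j then R i else 0 := fun j i t => by
      by_cases hij : a i = j
      · rw [if_pos hij, if_pos hij, Matrix.smul_mulVec, Matrix.one_mulVec, ← hij]
        rfl
      · rw [if_neg hij, if_neg hij]
        rfl
    intro j
    funext t
    rw [Finset.sum_apply, Pi.zero_apply]
    refine Eq.trans (Finset.sum_congr rfl fun i _ => hj j i t) ?_
    exact sum_ite_arm_eq_zero h0 h1 j

end Ancova

/-! ### Population equations -/

section Population

variable {p k : ℕ} {P : Measure (FullData p k)}

/-- The centered residual of the visit `t` for visit-specific covariate coefficients `B`. -/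
def visitResidual (P : Measure (FullData p k)) (B : Fin (k + 1) × Fin p → ℝ) (a : Fin 2)
    (w : FullData p k) (t : Fin (k + 1)) : ℝ :=
  outcome a w t - ∫ w', outcome a w' t ∂P -
    ∑ l, B (t, l) * (covariates w l - ∫ w', covariates w' l ∂P)

/-- The second moments of the centered residuals, averaged over the arms. -/
def residualCov (P : Measure (FullData p k)) (B : Fin (k + 1) × Fin p → ℝ) :
    Matrix (Fin (k + 1)) (Fin (k + 1)) ℝ :=
  Matrix.of fun t s => 1 / 2 * ∑ a, ∫ w, visitResidual P B a w t * visitResidual P B a w s ∂P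

lemma centeredResidual_mmrmTwoDesign (B : Fin (k + 1) × Fin p → ℝ) (a : Fin 2)
    (w : FullData p k) (t : Fin (k + 1)) :
    centeredResidual P id (mmrmTwoDesign p k) B a w t = visitResidual P B a w t := by
  simp only [centeredResidual, visitResidual, id, Fintype.sum_prod_type, mmrmTwoDesign,
    Matrix.of_apply]
  rw [Finset.sum_eq_single t]
  · simp
  · intro s _ hs
    simp [hs]
  · simp

variable [IsProbabilityMeasure P]

lemma memLp_visitResidual (hP : DataAssumptions P) (B : Fin (k + 1) × Fin p → ℝ) (a : Fin 2)
    (t : Fin (k + 1)) : MemLp (fun w => visitResidual P B a w t) 2 P :=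
  ((hP.outcome_memLp a t).sub (memLp_const _)).sub (memLp_finsetSum _ fun l _ =>
    ((hP.covariates_memLp l).sub (memLp_const _)).const_mul _)

lemma integral_visitResidual (hP : DataAssumptions P) (B : Fin (k + 1) × Fin p → ℝ) (a : Fin 2)
    (t : Fin (k + 1)) : ∫ w, visitResidual P B a w t ∂P = 0 := by
  have hX : ∀ l, Integrable (fun w => covariates w l) P := fun l =>
    (hP.covariates_memLp l).integrable (by norm_num)
  have hY := (hP.outcome_memLp a t).integrable (by norm_num)
  have hXc : ∀ l, Integrable (fun w => B (t, l) *
      (covariates w l - ∫ w', covariates w' l ∂P)) P := fun l =>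
    ((hX l).sub (integrable_const _)).const_mul _
  have hX0 : ∀ l, ∫ w, B (t, l) * (covariates w l - ∫ w', covariates w' l ∂P) ∂P = 0 := fun l => by
    rw [integral_const_mul, integral_sub (hX l) (integrable_const _)]
    simp
  simp only [visitResidual]
  rw [integral_sub (f := fun w => outcome a w t - ∫ w', outcome a w' t ∂P)
      (hY.sub (integrable_const _)) (integrable_finsetSum _ fun l _ => hXc l),
    integral_sub hY (integrable_const _), integral_finsetSum _ fun l _ => hXc l]
  simp [hX0]

/-- Residuals with mean zero are centered. -/
lemma sub_sub_eq_visitResidual (hP : DataAssumptions P) {B : Fin (k + 1) × Fin p → ℝ} {a : Fin 2}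
    {t : Fin (k + 1)} {c : ℝ}
    (h : ∫ w, (outcome a w t - c - ∑ l, B (t, l) * covariates w l) ∂P = 0) (w : FullData p k) :
    outcome a w t - c - ∑ l, B (t, l) * covariates w l = visitResidual P B a w t := by
  have e : ∀ w, outcome a w t - c - ∑ l, B (t, l) * covariates w l = visitResidual P B a w t +
      (∫ w', outcome a w' t ∂P - c - ∑ l, B (t, l) * ∫ w', covariates w' l ∂P) := fun w => by
    simp only [visitResidual, mul_sub, Finset.sum_sub_distrib]
    ring
  simp_rw [e] at h ⊢
  rw [integral_add ((memLp_visitResidual hP B a t).integrable (by norm_num)) (integrable_const _),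
    integral_visitResidual hP] at h
  simp only [integral_const, probReal_univ, one_smul, zero_add] at h
  rw [h, add_zero]

omit [IsProbabilityMeasure P] in
/-- Means of weighted vectors, by independence of the pattern of missingness. -/
lemma integral_obsPrecision_mulVec (hP : DataAssumptions P) (j : Fin 2)
    (S : Matrix (Fin (k + 1)) (Fin (k + 1)) ℝ)
    {x : (Fin p → ℝ) × (Fin (k + 1) → ℝ) → Fin (k + 1) → ℝ} (hx : ∀ t, Measurable fun d => x d t)
    (hi : ∀ t, Integrable (fun w => x (covariates w, outcome j w) t) P) (t : Fin (k + 1)) :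
    ∫ w, (obsPrecision (observed j w) S *ᵥ x (covariates w, outcome j w)) t ∂P =
      (meanPrecision P S *ᵥ fun s => ∫ w, x (covariates w, outcome j w) s ∂P) t := by
  rw [integral_observed hP j (g := fun m d => (obsPrecision m S *ᵥ x d) t)]
  · rw [meanPrecision, Matrix.sum_mulVec, Finset.sum_apply]
    refine Finset.sum_congr rfl fun m _ => ?_
    rw [Matrix.smul_mulVec, Pi.smul_apply, smul_eq_mul]
    congr 1
    simp only [Matrix.mulVec, dotProduct]
    rw [integral_finsetSum _ fun s _ => (hi s).const_mul _]
    simp only [integral_const_mul]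
  · intro m
    simp only [Matrix.mulVec, dotProduct]
    exact Finset.measurable_fun_sum _ fun s _ => (hx s).const_mul _
  · intro m
    simp only [Matrix.mulVec, dotProduct]
    exact integrable_finsetSum _ fun s _ => (hi s).const_mul _

/-- Means of quadratic functions of the residuals, by independence of the pattern of missingness. -/
lemma integral_add_dotProduct_mulVec (hP : DataAssumptions P) (j : Fin 2)
    (c : (Fin (k + 1) → Bool) → ℝ)
    (F : (Fin (k + 1) → Bool) → Matrix (Fin (k + 1)) (Fin (k + 1)) ℝ)
    (B : Fin (k + 1) × Fin p → ℝ) :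
    ∫ w, (c (observed j w) +
      visitResidual P B j w ⬝ᵥ (F (observed j w) *ᵥ visitResidual P B j w)) ∂P =
      ∑ m, patternProb P m * (c m + ∑ t, ∑ s, F m t s *
        ∫ w, visitResidual P B j w t * visitResidual P B j w s ∂P) := by
  set r : (Fin p → ℝ) × (Fin (k + 1) → ℝ) → Fin (k + 1) → ℝ := fun d t =>
    d.2 t - ∫ w', outcome j w' t ∂P - ∑ l, B (t, l) * (d.1 l - ∫ w', covariates w' l ∂P) with hr
  have hrm : ∀ t, Measurable fun d => r d t := fun t => by
    refine (((measurable_pi_apply t).comp measurable_snd).sub_const _).sub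
      (Finset.measurable_fun_sum _ fun l _ => ?_)
    exact (((measurable_pi_apply l).comp measurable_fst).sub_const _).const_mul _
  have hrr : ∀ t s, Integrable (fun w => visitResidual P B j w t * visitResidual P B j w s) P :=
    fun t s => (memLp_visitResidual hP B j t).integrable_mul (memLp_visitResidual hP B j s)
  have hexp : ∀ (N : Matrix (Fin (k + 1)) (Fin (k + 1)) ℝ) (x : Fin (k + 1) → ℝ),
      x ⬝ᵥ (N *ᵥ x) = ∑ t, ∑ s, N t s * (x t * x s) := fun N x => by
    simp only [dotProduct, Matrix.mulVec, Finset.mul_sum]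
    exact Finset.sum_congr rfl fun t _ => Finset.sum_congr rfl fun s _ => by ring
  have hi : ∀ m, Integrable (fun w =>
      visitResidual P B j w ⬝ᵥ (F m *ᵥ visitResidual P B j w)) P := fun m => by
    simp only [hexp]
    exact integrable_finsetSum _ fun t _ => integrable_finsetSum _ fun s _ => (hrr t s).const_mul _
  refine (integral_observed hP j (g := fun m d => c m + r d ⬝ᵥ (F m *ᵥ r d)) (fun m => ?_)
    fun m => (integrable_const _).add (hi m)).trans (Finset.sum_congr rfl fun m _ => ?_)
  · simp only [hexp]
    exact (Finset.measurable_fun_sum _ fun t _ => Finset.measurable_fun_sum _ fun s _ =>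
      ((hrm t).mul (hrm s)).const_mul _).const_add _
  · congr 1
    refine (integral_add (integrable_const _) (hi m)).trans ?_
    rw [integral_const, probReal_univ, one_smul]
    congr 1
    simp only [hexp]
    refine (integral_finsetSum _ fun t _ => integrable_finsetSum _ fun s _ =>
      (hrr t s).const_mul _).trans (Finset.sum_congr rfl fun t _ => ?_)
    refine (integral_finsetSum _ fun s _ => (hrr t s).const_mul _).trans ?_
    exact Finset.sum_congr rfl fun s _ => integral_const_mul _ _

omit [IsProbabilityMeasure P] in
lemma eq_zero_of_sum_arm {f : Fin 2 → ℝ} (h0 : ∑ j, f j = 0) (h1 : ∑ j, treated j * f j = 0)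
    (j : Fin 2) : f j = 0 := by
  simp only [Fin.sum_univ_two, treated] at h0 h1
  have : j = 0 ∨ j = 1 := by omega
  rcases this with rfl | rfl
  · norm_num at h1
    linarith
  · norm_num at h1
    exact h1

end Population

section AncovaPopulation

variable {p k : ℕ} {P : Measure (FullData p k)} [IsProbabilityMeasure P]

/-- The limits of the ANCOVA coefficients are least squares coefficients at the last visit. -/
lemma RegularityConditions.ancova_normal_equations (hP : DataAssumptions P)
    {Θ : Set (AncovaIndex p → ℝ)} {θ₀ : AncovaIndex p → ℝ}
    (hR : RegularityConditions P (ancovaPsi p k) Θ θ₀) (l : Fin p) :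
    ∑ a, ∫ w, covariates w l *
      visitResidual P (fun tl => θ₀ (.inr (.inr tl.2))) a w (Fin.last k) ∂P = 0 := by
  set B : Fin (k + 1) × Fin p → ℝ := fun tl => θ₀ (.inr (.inr tl.2)) with hB
  have hint : ∀ (a : Fin 2) (g : (Fin p → ℝ) × (Fin (k + 1) → ℝ) → ℝ), Measurable g →
      Integrable (fun w => g (covariates w, outcome a w)) P →
      ∫ w, (if observed a w (Fin.last k) = true then (1 : ℝ) else 0) *
        g (covariates w, outcome a w) ∂P = lastProb P * ∫ w, g (covariates w, outcome a w) ∂P := by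
    intro a g hg hi
    rw [integral_observed hP a
      (g := fun m d => (if m (Fin.last k) = true then (1 : ℝ) else 0) * g d)
      (fun m => hg.const_mul _)
      fun m => hi.const_mul _, lastProb, Finset.sum_mul]
    exact Finset.sum_congr rfl fun m _ => by rw [integral_const_mul, mul_assoc]
  set r : Fin 2 → (Fin p → ℝ) × (Fin (k + 1) → ℝ) → ℝ := fun a d =>
    d.2 (Fin.last k) - (θ₀ (.inl ()) + treated a * θ₀ (.inr (.inl ()))) -
      ∑ l, B (Fin.last k, l) * d.1 l with hr
  have hrm : ∀ a, Measurable (r a) := fun a => by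
    refine (((measurable_pi_apply _).comp measurable_snd).sub_const _).sub
      (Finset.measurable_fun_sum _ fun l _ => ?_)
    exact ((measurable_pi_apply l).comp measurable_fst).const_mul _
  have hr2 : ∀ a, MemLp (fun w => r a (covariates w, outcome a w)) 2 P := fun a =>
    ((hP.outcome_memLp a _).sub (memLp_const _)).sub
      (memLp_finsetSum _ fun l _ => (hP.covariates_memLp l).const_mul _)
  have hψ : ∀ a w q, ancovaPsi p k a (armData a w) θ₀ q =
      (if observed a w (Fin.last k) = true then (1 : ℝ) else 0) *
        (r a (covariates w, outcome a w) * ancovaRegressor a (covariates w) q) := fun a w q => by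
    simp only [ancovaPsi, armData, hr, hB, Pi.smul_apply, smul_eq_mul]
    rw [mul_assoc]
    congr 2
    ring
  have hπ := lastProb_pos hP
  have h0 : ∀ a, lastProb P * ∫ w, r a (covariates w, outcome a w) ∂P = 0 := by
    have e : ∀ a, lastProb P * ∫ w, r a (covariates w, outcome a w) ∂P =
        ∫ w, (if observed a w (Fin.last k) = true then (1 : ℝ) else 0) *
          r a (covariates w, outcome a w) ∂P := fun a =>
      (hint a (r a) (hrm a) ((hr2 a).integrable (by norm_num))).symm
    refine eq_zero_of_sum_arm ?_ ?_
    · rw [← hR.sum_integral_eq_zero (.inl ())]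
      refine Finset.sum_congr rfl fun a _ => ?_
      rw [e]
      simp only [hψ, ancovaRegressor, Sum.elim_inl, mul_one]
    · rw [← hR.sum_integral_eq_zero (.inr (.inl ()))]
      refine Finset.sum_congr rfl fun a _ => ?_
      rw [e, ← integral_const_mul]
      simp only [hψ, ancovaRegressor, Sum.elim_inl, Sum.elim_inr]
      exact integral_congr_ae (ae_of_all _ fun w => by ring)
  have hrc : ∀ a w, r a (covariates w, outcome a w) = visitResidual P B a w (Fin.last k) :=
    fun a w => sub_sub_eq_visitResidual hP ((mul_eq_zero.1 (h0 a)).resolve_left hπ.ne') w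
  refine (mul_eq_zero.1 ?_).resolve_left hπ.ne'
  rw [← hR.sum_integral_eq_zero (.inr (.inr l)), Finset.mul_sum]
  refine Finset.sum_congr rfl fun a _ => ?_
  have := hint a (fun d => r a d * d.1 l)
    ((hrm a).mul ((measurable_pi_apply l).comp measurable_fst))
    ((hr2 a).integrable_mul (hP.covariates_memLp l))
  simp only [hψ, ancovaRegressor, Sum.elim_inr]
  rw [this]
  simp only [hrc, mul_comm]

end AncovaPopulation

section MmrmPopulation

variable {p k : ℕ} {P : Measure (FullData p k)} [IsProbabilityMeasure P]
  {Θ : Set (MmrmIndex k (Fin (k + 1) × Fin p) → ℝ)}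
  {θ₀ : MmrmIndex k (Fin (k + 1) × Fin p) → ℝ}

omit [IsProbabilityMeasure P] in
lemma mmrmResidual_mmrmTwoDesign (a : Fin 2) (w : FullData p k)
    (θ : MmrmIndex k (Fin (k + 1) × Fin p) → ℝ) (t : Fin (k + 1)) :
    mmrmResidual (mmrmTwoDesign p k (covariates w)) a (outcome a w) θ t =
      outcome a w t - (θ (.inl t) + treated a * θ (.inr (.inl t))) -
        ∑ l, θ (.inr (.inr (.inl (t, l)))) * covariates w l := by
  have : ((mmrmTwoDesign p k (covariates w))ᵀ *ᵥ fun q => θ (.inr (.inr (.inl q)))) t =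
      ∑ l, θ (.inr (.inr (.inl (t, l)))) * covariates w l := by
    simp only [Matrix.mulVec, dotProduct, Fintype.sum_prod_type, mmrmTwoDesign,
      Matrix.transpose_apply, Matrix.of_apply]
    rw [Finset.sum_eq_single t]
    · simp [mul_comm]
    · intro s _ hs
      simp [hs]
    · simp
  rw [mmrmResidual, this]
  ring

omit [IsProbabilityMeasure P] in
lemma mmrmTwoDesign_mulVec (x : Fin p → ℝ) (v : Fin (k + 1) → ℝ) (t : Fin (k + 1)) (l : Fin p) :
    (mmrmTwoDesign p k x *ᵥ v) (t, l) = x l * v t := by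
  simp [Matrix.mulVec, dotProduct, mmrmTwoDesign]

/-- At the limit of MMRM-II the residuals are centered. -/
lemma RegularityConditions.mmrmResidual_eq (hP : DataAssumptions P)
    (hR : RegularityConditions P (mmrmPsi k (mmrmTwoDesign p k)) Θ θ₀)
    (hS : (mmrmCov θ₀).PosDef) (a : Fin 2) (w : FullData p k) :
    mmrmResidual (mmrmTwoDesign p k (covariates w)) a (outcome a w) θ₀ =
      visitResidual P (fun tl => θ₀ (.inr (.inr (.inl tl)))) a w := by
  set r : Fin 2 → (Fin p → ℝ) × (Fin (k + 1) → ℝ) → Fin (k + 1) → ℝ := fun a d t =>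
    d.2 t - (θ₀ (.inl t) + treated a * θ₀ (.inr (.inl t))) -
        ∑ l, θ₀ (.inr (.inr (.inl (t, l)))) * d.1 l with hr
  have hrw : ∀ a w, mmrmResidual (mmrmTwoDesign p k (covariates w)) a (outcome a w) θ₀ =
      r a (covariates w, outcome a w) := fun a w =>
    funext fun t => mmrmResidual_mmrmTwoDesign a w θ₀ t
  have hrm : ∀ a t, Measurable fun d => r a d t := fun a t => by
    refine (((measurable_pi_apply t).comp measurable_snd).sub_const _).sub
      (Finset.measurable_fun_sum _ fun l _ => ?_)
    exact ((measurable_pi_apply l).comp measurable_fst).const_mul _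
  have hri : ∀ a t, Integrable (fun w => r a (covariates w, outcome a w) t) P := fun a t =>
    (((hP.outcome_memLp a t).integrable (by norm_num)).sub (integrable_const _)).sub
      (integrable_finsetSum _ fun l _ =>
        ((hP.covariates_memLp l).integrable (by norm_num)).const_mul _)
  have hV : ∀ t a, (meanPrecision P (mmrmCov θ₀) *ᵥ
      fun s => ∫ w, r a (covariates w, outcome a w) s ∂P) t = 0 := fun t => by
    refine eq_zero_of_sum_arm ?_ ?_
    · rw [← hR.sum_integral_eq_zero (.inl t)]
      refine Finset.sum_congr rfl fun a _ => ?_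
      rw [← integral_obsPrecision_mulVec hP a _ (hrm a) (hri a)]
      simp only [mmrmPsi, armData, Sum.elim_inl, hrw]
    · rw [← hR.sum_integral_eq_zero (.inr (.inl t))]
      refine Finset.sum_congr rfl fun a _ => ?_
      rw [← integral_obsPrecision_mulVec hP a _ (hrm a) (hri a), ← integral_const_mul]
      simp only [mmrmPsi, armData, Sum.elim_inl, Sum.elim_inr, hrw, Pi.smul_apply, smul_eq_mul]
  have h0 : ∀ a, (fun s => ∫ w, r a (covariates w, outcome a w) s ∂P) = 0 := fun a => by
    have := congrArg ((meanPrecision P (mmrmCov θ₀))⁻¹ *ᵥ ·) (funext fun t => hV t a)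
    simp only [Matrix.mulVec_mulVec, Matrix.nonsing_inv_mul _ (isUnit_det_meanPrecision hP hS),
      Matrix.one_mulVec] at this
    rw [this]
    exact Matrix.mulVec_zero _
  rw [hrw]
  exact funext fun t => sub_sub_eq_visitResidual hP
    (B := fun tl => θ₀ (.inr (.inr (.inl tl)))) (congrFun (h0 a) t) w

/-- The limits of the MMRM-II coefficients are least squares coefficients at all visits. -/
lemma RegularityConditions.mmrm_normal_equations (hP : DataAssumptions P)
    (hR : RegularityConditions P (mmrmPsi k (mmrmTwoDesign p k)) Θ θ₀)
    (hS : (mmrmCov θ₀).PosDef) (t : Fin (k + 1)) (l : Fin p) :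
    ∑ a, ∫ w, covariates w l *
      visitResidual P (fun tl => θ₀ (.inr (.inr (.inl tl)))) a w t ∂P = 0 := by
  set B : Fin (k + 1) × Fin p → ℝ := fun tl => θ₀ (.inr (.inr (.inl tl))) with hB
  set x : Fin 2 → (Fin p → ℝ) × (Fin (k + 1) → ℝ) → Fin (k + 1) → ℝ := fun a d t =>
    d.1 l * (d.2 t - ∫ w', outcome a w' t ∂P -
      ∑ l, B (t, l) * (d.1 l - ∫ w', covariates w' l ∂P)) with hx
  have hxm : ∀ a t, Measurable fun d => x a d t := fun a t => by
    refine ((measurable_pi_apply l).comp measurable_fst).mul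
      ((((measurable_pi_apply t).comp measurable_snd).sub_const _).sub
      (Finset.measurable_fun_sum _ fun l _ => ?_))
    exact (((measurable_pi_apply l).comp measurable_fst).sub_const _).const_mul _
  have hxi : ∀ a t, Integrable (fun w => x a (covariates w, outcome a w) t) P := fun a t =>
    (hP.covariates_memLp l).integrable_mul (memLp_visitResidual hP B a t)
  have hV : ∀ t, (meanPrecision P (mmrmCov θ₀) *ᵥ
      ∑ a, fun s => ∫ w, x a (covariates w, outcome a w) s ∂P) t = 0 := fun t => by
    rw [← hR.sum_integral_eq_zero (.inr (.inr (.inl (t, l)))), Matrix.mulVec_sum, Finset.sum_apply]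
    refine Finset.sum_congr rfl fun a _ => ?_
    rw [← integral_obsPrecision_mulVec hP a _ (hxm a) (hxi a)]
    refine integral_congr_ae (ae_of_all _ fun w => ?_)
    simp only [mmrmPsi, armData, Sum.elim_inl, Sum.elim_inr]
    rw [hR.mmrmResidual_eq hP hS]
    rw [mmrmTwoDesign_mulVec]
    simp only [Matrix.mulVec, dotProduct, Finset.mul_sum]
    exact Finset.sum_congr rfl fun s _ => mul_left_comm _ _ _
  have h0 := congrArg ((meanPrecision P (mmrmCov θ₀))⁻¹ *ᵥ ·) (funext hV)
  simp only [Matrix.mulVec_mulVec, Matrix.nonsing_inv_mul _ (isUnit_det_meanPrecision hP hS),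
    Matrix.one_mulVec] at h0
  have h1 := congrFun (h0.trans (Matrix.mulVec_zero _)) t
  rwa [Finset.sum_apply] at h1

lemma covOfLower_eq_sum (α : {rs : Fin (k + 1) × Fin (k + 1) // rs.2 ≤ rs.1} → ℝ) :
    covOfLower α = ∑ l, α l • covOfLower (Pi.single l 1) := by
  ext r s
  simp only [covOfLower, Matrix.of_apply, Matrix.sum_apply, Matrix.smul_apply, smul_eq_mul,
    Pi.single_apply, mul_ite, mul_one, mul_zero]
  simp

lemma covOfLower_apply_of_symm {H : Matrix (Fin (k + 1)) (Fin (k + 1)) ℝ} (hH : Hᵀ = H) :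
    covOfLower (fun l => H l.1.1 l.1.2) = H := by
  ext r s
  simp only [covOfLower, Matrix.of_apply]
  rcases le_total r s with h | h
  · rw [max_eq_right h, min_eq_left h]
    exact congrFun (congrFun hH r) s
  · rw [max_eq_left h, min_eq_right h]

omit [IsProbabilityMeasure P] in
lemma residualCov_transpose (B : Fin (k + 1) × Fin p → ℝ) :
    (residualCov P B)ᵀ = residualCov P B := by
  ext t s
  simp [residualCov, mul_comm]

/-- The limit of the covariance matrix of MMRM-II is the covariance matrix of the residuals, however
the outcomes are distributed. -/
lemma RegularityConditions.mmrmCov_eq_residualCov (hP : DataAssumptions P)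
    (hR : RegularityConditions P (mmrmPsi k (mmrmTwoDesign p k)) Θ θ₀)
    (hS : (mmrmCov θ₀).PosDef) :
    mmrmCov θ₀ = residualCov P fun tl => θ₀ (.inr (.inr (.inl tl))) := by
  set B : Fin (k + 1) × Fin p → ℝ := fun tl => θ₀ (.inr (.inr (.inl tl))) with hB
  set S := mmrmCov θ₀ with hSdef
  have hSt : Sᵀ = S := by
    rw [← Matrix.conjTranspose_eq_transpose_of_trivial]
    exact hS.isHermitian
  set H := residualCov P B - S with hH
  have hHt : Hᵀ = H := by rw [hH, Matrix.transpose_sub, residualCov_transpose, hSt]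
  -- the score of the entry `l` of `Σ`, as `tr (V E V Σ) = tr (V E)` by `V Σ V = V`
  have hscore : ∀ l, ∑ m, patternProb P m *
      (obsPrecision m S * covOfLower (Pi.single l 1) * obsPrecision m S * H).trace = 0 := by
    intro l
    set E : Matrix (Fin (k + 1)) (Fin (k + 1)) ℝ := covOfLower (Pi.single l 1) with hE
    have htr : ∀ m, (obsPrecision m S * E * obsPrecision m S * H).trace =
        - (obsPrecision m S * E).trace + ∑ t, ∑ s, (obsPrecision m S * E * obsPrecision m S) t s *
          residualCov P B t s := fun m => by
      have h1 : (obsPrecision m S * E * obsPrecision m S * S).trace =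
          (obsPrecision m S * E).trace := by
        rw [Matrix.mul_assoc, Matrix.trace_mul_comm, ← Matrix.mul_assoc,
          obsPrecision_mul_mul m hS]
      have h2 : (obsPrecision m S * E * obsPrecision m S * residualCov P B).trace =
          ∑ t, ∑ s, (obsPrecision m S * E * obsPrecision m S) t s * residualCov P B t s := by
        refine Finset.sum_congr rfl fun t _ => ?_
        rw [Matrix.diag_apply, Matrix.mul_apply]
        refine Finset.sum_congr rfl fun s _ => ?_
        rw [← congrFun (congrFun (residualCov_transpose B) t) s, Matrix.transpose_apply]
      rw [hH, Matrix.mul_sub, Matrix.trace_sub, h1, h2]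
      ring
    have hR' := hR.sum_integral_eq_zero (.inr (.inr (.inr l)))
    have hint : ∀ a, ∫ w, mmrmPsi k (mmrmTwoDesign p k) a (armData a w) θ₀
        (.inr (.inr (.inr l))) ∂P = ∑ m, patternProb P m * (- (obsPrecision m S * E).trace +
          ∑ t, ∑ s, (obsPrecision m S * E * obsPrecision m S) t s *
            ∫ w, visitResidual P B a w t * visitResidual P B a w s ∂P) := fun a => by
      rw [← integral_add_dotProduct_mulVec hP a (fun m => - (obsPrecision m S * E).trace)
        (fun m => obsPrecision m S * E * obsPrecision m S) B]
      refine integral_congr_ae (ae_of_all _ fun w => ?_)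
      simp only [mmrmPsi, armData, Sum.elim_inr]
      rw [hR.mmrmResidual_eq hP hS]
    simp only [hint, Fin.sum_univ_two] at hR'
    rw [← Finset.sum_add_distrib] at hR'
    have hhalf := congrArg (fun x => 1 / 2 * x) hR'
    simp only [mul_zero, Finset.mul_sum] at hhalf
    rw [← hhalf]
    refine Finset.sum_congr rfl fun m _ => ?_
    have hL : ∀ t s, residualCov P B t s = 1 / 2 *
        (∫ w, visitResidual P B 0 w t * visitResidual P B 0 w s ∂P +
          ∫ w, visitResidual P B 1 w t * visitResidual P B 1 w s ∂P) := fun t s => by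
      simp only [residualCov, Matrix.of_apply, Fin.sum_univ_two]
    rw [htr]
    simp only [hL, mul_add, Finset.sum_add_distrib, mul_left_comm _ (1 / 2 : ℝ), ← Finset.mul_sum]
    ring
  -- the combination of the scores with the entries of `H` as coefficients
  have hzero : ∑ m, patternProb P m *
      (obsPrecision m S * H * obsPrecision m S * H).trace = 0 := by
    have hexp : ∀ m, (obsPrecision m S * H * obsPrecision m S * H).trace =
        ∑ l : {rs : Fin (k + 1) × Fin (k + 1) // rs.2 ≤ rs.1}, H l.1.1 l.1.2 *
          (obsPrecision m S * covOfLower (Pi.single l 1) * obsPrecision m S * H).trace := by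
      intro m
      conv_lhs =>
        enter [1, 1, 1, 2]
        rw [← covOfLower_apply_of_symm hHt, covOfLower_eq_sum]
      simp only [Matrix.mul_sum, Matrix.sum_mul, Matrix.trace_sum, Matrix.mul_smul,
        Matrix.smul_mul, Matrix.trace_smul, smul_eq_mul]
    simp_rw [hexp, Finset.mul_sum]
    rw [Finset.sum_comm]
    refine Finset.sum_eq_zero fun l _ => ?_
    rw [← mul_zero (H l.1.1 l.1.2), ← hscore l, Finset.mul_sum]
    exact Finset.sum_congr rfl fun m _ => by ring
  exact (sub_eq_zero.1 (eq_zero_of_sum_trace_eq_zero hS patternProb_nonneg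
    (patternProb_full_pos hP) hHt hzero)).symm

end MmrmPopulation

/-! ### Comparison of the asymptotic variances -/

section Weights

variable {p k : ℕ} {P : Measure (FullData p k)} [IsProbabilityMeasure P]

omit [IsProbabilityMeasure P] in
lemma mmrmWeight_eq_mulVec {S : Matrix (Fin (k + 1)) (Fin (k + 1)) ℝ} (hS : S.PosDef)
    (m : Fin (k + 1) → Bool) : mmrmWeight P S m =
      obsPrecision m S *ᵥ ((meanPrecision P S)⁻¹ *ᵥ Pi.single (Fin.last k) 1) := by
  have hQt : (meanPrecision P S)ᵀ = meanPrecision P S := by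
    rw [meanPrecision, Matrix.transpose_sum]
    exact Finset.sum_congr rfl fun m _ => by
      rw [Matrix.transpose_smul, obsPrecision_transpose m hS]
  funext t
  rw [Matrix.mulVec_mulVec, Matrix.mulVec_single_one]
  change ((meanPrecision P S)⁻¹ * obsPrecision m S) (Fin.last k) t =
    (obsPrecision m S * (meanPrecision P S)⁻¹) t (Fin.last k)
  rw [← Matrix.transpose_apply (obsPrecision m S * _), Matrix.transpose_mul,
    Matrix.transpose_nonsing_inv, hQt, obsPrecision_transpose m hS]

omit [IsProbabilityMeasure P] in
lemma mmrmWeight_eq_zero {S : Matrix (Fin (k + 1)) (Fin (k + 1)) ℝ} (hS : S.PosDef)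
    {m : Fin (k + 1) → Bool} {t : Fin (k + 1)} (ht : m t = false) : mmrmWeight P S m t = 0 := by
  rw [mmrmWeight_eq_mulVec hS]
  simp [Matrix.mulVec, dotProduct, obsPrecision_apply_eq_zero m ht]

lemma sum_mmrmWeight (hP : DataAssumptions P) {S : Matrix (Fin (k + 1)) (Fin (k + 1)) ℝ}
    (hS : S.PosDef) :
    ∑ m, patternProb P m • mmrmWeight P S m = Pi.single (Fin.last k) 1 := by
  simp only [mmrmWeight_eq_mulVec hS, ← Matrix.smul_mulVec]
  rw [← Matrix.sum_mulVec, Matrix.mulVec_mulVec]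
  change (meanPrecision P S * (meanPrecision P S)⁻¹) *ᵥ _ = _
  rw [Matrix.mul_nonsing_inv _ (isUnit_det_meanPrecision hP hS), Matrix.one_mulVec]

omit [IsProbabilityMeasure P] in
lemma ancovaWeight_eq_zero {m : Fin (k + 1) → Bool} {t : Fin (k + 1)} (ht : m t = false) :
    ancovaWeight P m t = 0 := by
  unfold ancovaWeight
  split_ifs with h h'
  · rw [h, h'] at ht
    exact absurd ht (by simp)
  · simp
  · rfl

lemma sum_ancovaWeight (hP : DataAssumptions P) :
    ∑ m, patternProb P m • ancovaWeight P m = Pi.single (Fin.last k) 1 := by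
  funext t
  rw [Finset.sum_apply]
  by_cases ht : t = Fin.last k
  · subst ht
    simp only [ancovaWeight, Pi.smul_apply, smul_eq_mul, if_true, mul_left_comm _ (lastProb P)⁻¹,
      ← Finset.mul_sum, Pi.single_eq_same]
    exact inv_mul_cancel₀ (lastProb_pos hP).ne'
  · simp [ancovaWeight, ht]

end Weights

section Variance

variable {p k : ℕ} {P : Measure (FullData p k)}

/-- The influence function of an estimated treatment effect that weights the residuals by `G`. By
definition it is `influence` for the design `mmrmOneDesign`, if `B` does not depend on the visit. -/
def visitInfluence (P : Measure (FullData p k)) (B : Fin (k + 1) × Fin p → ℝ)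
    (G : (Fin (k + 1) → Bool) → Fin (k + 1) → ℝ) (a : Fin 2) (w : FullData p k) : ℝ :=
  armSign a * (2 * (G (observed a w) ⬝ᵥ visitResidual P B a w))

lemma influence_mmrmTwoDesign (B : Fin (k + 1) × Fin p → ℝ)
    (G : (Fin (k + 1) → Bool) → Fin (k + 1) → ℝ) :
    influence P id (mmrmTwoDesign p k) B G = visitInfluence P B G := by
  funext a w
  simp only [influence, visitInfluence, centeredResidual_mmrmTwoDesign, dotProduct]

variable [IsProbabilityMeasure P]

lemma memLp_visitInfluence (hP : DataAssumptions P) (B : Fin (k + 1) × Fin p → ℝ)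
    (G : (Fin (k + 1) → Bool) → Fin (k + 1) → ℝ) (a : Fin 2) :
    MemLp (visitInfluence P B G a) 2 P := by
  have h : ∀ t, MemLp (fun w => G (observed a w) t * visitResidual P B a w t) 2 P := fun t => by
    have hR := memLp_visitResidual hP B a t
    have hG : Measurable fun w : FullData p k => G (observed a w) t :=
      (Measurable.of_discrete (f := fun m => G m t)).comp (measurable_observed a)
    refine hR.of_le_mul (c := ∑ m, |G m t|) (hG.aestronglyMeasurable.mul hR.aestronglyMeasurable)
      (ae_of_all _ fun w => ?_)
    rw [norm_mul]
    exact mul_le_mul_of_nonneg_right (Finset.single_le_sum (f := fun m => |G m t|)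
      (fun _ _ => abs_nonneg _) (Finset.mem_univ _)) (norm_nonneg _)
  exact ((memLp_finsetSum _ fun t _ => h t).const_mul 2).const_mul _

/-- The variance under simple randomization. -/
lemma half_sum_integral_visitInfluence_sq (hP : DataAssumptions P) (B : Fin (k + 1) × Fin p → ℝ)
    (G : (Fin (k + 1) → Bool) → Fin (k + 1) → ℝ) :
    1 / 2 * ∑ a, ∫ w, visitInfluence P B G a w ^ 2 ∂P =
      4 * ∑ m, patternProb P m * (G m ⬝ᵥ (residualCov P B *ᵥ G m)) := by
  have h : ∀ a, ∫ w, visitInfluence P B G a w ^ 2 ∂P =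
      4 * ∑ m, patternProb P m * ∑ t, ∑ s, G m t * G m s *
        ∫ w, visitResidual P B a w t * visitResidual P B a w s ∂P := fun a => by
    have h' := integral_add_dotProduct_mulVec hP a (fun _ => 0)
      (fun m => Matrix.vecMulVec (G m) (G m)) B
    simp only [zero_add, Matrix.vecMulVec_apply] at h'
    rw [← h', ← integral_const_mul]
    refine integral_congr_ae (ae_of_all _ fun w => ?_)
    have hs : armSign a ^ 2 = 1 := by
      rw [← sq_abs, abs_armSign, one_pow]
    simp only [visitInfluence]
    rw [mul_pow, hs, Matrix.vecMulVec_mulVec, op_smul_eq_smul, dotProduct_smul, smul_eq_mul,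
      dotProduct_comm (visitResidual P B a w)]
    ring
  simp only [h, Fin.sum_univ_two, Finset.mul_sum]
  rw [← Finset.sum_add_distrib, Finset.mul_sum]
  refine Finset.sum_congr rfl fun m _ => ?_
  simp only [dotProduct, Matrix.mulVec, residualCov, Matrix.of_apply, Finset.mul_sum]
  simp only [← Finset.sum_add_distrib, Finset.mul_sum]
  refine Finset.sum_congr rfl fun t _ => Finset.sum_congr rfl fun s _ => ?_
  rw [Fin.sum_univ_two]
  ring

variable {𝒮 : Type} [Fintype 𝒮] [DecidableEq 𝒮] [MeasurableSpace 𝒮] [DiscreteMeasurableSpace 𝒮]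
  {strat : (Fin p → ℝ) → 𝒮}

omit [IsProbabilityMeasure P] [Fintype 𝒮] in
lemma setIntegral_stratum (hstrat : Measurable strat) (s : 𝒮) (f : FullData p k → ℝ) :
    ∫ w in (fun w : FullData p k => strat (covariates w)) ⁻¹' {s}, f w ∂P =
      ∫ w, (if strat (covariates w) = s then f w else 0) ∂P := by
  have hσ : Measurable fun w : FullData p k => strat (covariates w) :=
    hstrat.comp measurable_covariates
  rw [← integral_indicator (hσ (measurableSet_singleton s))]
  refine integral_congr_ae (ae_of_all _ fun w => ?_)
  by_cases h : strat (covariates w) = s <;> simp [h]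

omit [Fintype 𝒮] in
/-- Over a stratum, an influence function integrates like the residual at the last visit. -/
lemma setIntegral_visitInfluence (hP : DataAssumptions P) (hstrat : Measurable strat)
    (B : Fin (k + 1) × Fin p → ℝ) {G : (Fin (k + 1) → Bool) → Fin (k + 1) → ℝ}
    (hG : ∑ m, patternProb P m • G m = Pi.single (Fin.last k) 1) (a : Fin 2) (s : 𝒮) :
    ∫ w in (fun w : FullData p k => strat (covariates w)) ⁻¹' {s}, visitInfluence P B G a w ∂P =
      armSign a * (2 * ∫ w in (fun w : FullData p k => strat (covariates w)) ⁻¹' {s},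
        visitResidual P B a w (Fin.last k) ∂P) := by
  have hm : MeasurableSet ((fun w : FullData p k => strat (covariates w)) ⁻¹' {s}) :=
    (hstrat.comp measurable_covariates) (measurableSet_singleton s)
  set r : (Fin p → ℝ) × (Fin (k + 1) → ℝ) → Fin (k + 1) → ℝ := fun d t =>
    d.2 t - ∫ w', outcome a w' t ∂P - ∑ l, B (t, l) * (d.1 l - ∫ w', covariates w' l ∂P) with hr
  have hrm : ∀ t, Measurable fun d => r d t := fun t => by
    refine (((measurable_pi_apply t).comp measurable_snd).sub_const _).sub
      (Finset.measurable_fun_sum _ fun l _ => ?_)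
    exact (((measurable_pi_apply l).comp measurable_fst).sub_const _).const_mul _
  have hri : ∀ t, Integrable (fun w => visitResidual P B a w t) P := fun t =>
    (memLp_visitResidual hP B a t).integrable (by norm_num)
  have hGi : ∀ m, Integrable (fun w => G m ⬝ᵥ visitResidual P B a w) P := fun m =>
    integrable_finsetSum _ fun t _ => (hri t).const_mul _
  have h := integral_observed hP a
    (g := fun m d => if strat d.1 = s then G m ⬝ᵥ r d else 0) (fun m => ?_) fun m => ?_
  · have e : ∀ m, ∫ w, (if strat (covariates w) = s then
        G m ⬝ᵥ r (covariates w, outcome a w) else 0) ∂P =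
        ∑ t, G m t * ∫ w in (fun w : FullData p k => strat (covariates w)) ⁻¹' {s},
          visitResidual P B a w t ∂P := fun m => by
      refine (setIntegral_stratum hstrat s _).symm.trans ?_
      refine (integral_finsetSum _ fun t _ => ((hri t).const_mul (G m t)).integrableOn).trans ?_
      exact Finset.sum_congr rfl fun t _ => integral_const_mul _ _
    simp only [visitInfluence, integral_const_mul]
    congr 2
    refine (setIntegral_stratum hstrat s _).trans (h.trans ?_)
    simp only [e, Finset.mul_sum]
    rw [Finset.sum_comm]
    have hsum : ∀ t, ∑ m, patternProb P m * G m t =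
        (Pi.single (Fin.last k) 1 : Fin (k + 1) → ℝ) t := fun t => by
      rw [← hG, Finset.sum_apply]
      rfl
    simp only [← mul_assoc, ← Finset.sum_mul, hsum]
    rw [Finset.sum_eq_single (Fin.last k) (fun t _ ht => by simp [ht]) (by simp)]
    simp
  · exact Measurable.ite (hstrat.comp measurable_fst (measurableSet_singleton s))
      (Finset.measurable_fun_sum _ fun t _ => (hrm t).const_mul _) measurable_const
  · refine ((hGi m).indicator hm).congr (ae_of_all _ fun w => ?_)
    by_cases hw : strat (covariates w) = s
    · simp only [Set.indicator_of_mem (show w ∈ (fun w : FullData p k =>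
        strat (covariates w)) ⁻¹' {s} from hw), hw, if_true]
      rfl
    · simp only [Set.indicator_of_notMem (show w ∉ (fun w : FullData p k =>
        strat (covariates w)) ⁻¹' {s} from hw), hw, if_false]

omit [Fintype 𝒮] in
/-- Residuals that are orthogonal to the covariates have mean zero in every stratum, on average over
the arms. -/
lemma sum_setIntegral_visitResidual (hP : DataAssumptions P) (hstrat : Measurable strat)
    (hS : StrataInCovariates P strat) {B : Fin (k + 1) × Fin p → ℝ} {t : Fin (k + 1)}
    (hB : ∀ l, ∑ a, ∫ w, covariates w l * visitResidual P B a w t ∂P = 0) (s : 𝒮) :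
    ∑ a, ∫ w in (fun w : FullData p k => strat (covariates w)) ⁻¹' {s},
      visitResidual P B a w t ∂P = 0 := by
  obtain ⟨c, d, hcd⟩ := hS s
  have hri : ∀ a, Integrable (fun w => visitResidual P B a w t) P := fun a =>
    (memLp_visitResidual hP B a t).integrable (by norm_num)
  have hXr : ∀ a l, Integrable (fun w => covariates w l * visitResidual P B a w t) P := fun a l =>
    (hP.covariates_memLp l).integrable_mul (memLp_visitResidual hP B a t)
  have h : ∀ a, ∫ w in (fun w : FullData p k => strat (covariates w)) ⁻¹' {s},
      visitResidual P B a w t ∂P =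
      ∑ l, d l * ∫ w, covariates w l * visitResidual P B a w t ∂P := fun a => by
    have e : ∫ w in (fun w : FullData p k => strat (covariates w)) ⁻¹' {s},
        visitResidual P B a w t ∂P = ∫ w, (c * visitResidual P B a w t +
          ∑ l, d l * (covariates w l * visitResidual P B a w t)) ∂P := by
      rw [setIntegral_stratum hstrat s]
      refine integral_congr_ae ?_
      filter_upwards [hcd] with w hw
      have : (c + ∑ l, d l * covariates w l) * visitResidual P B a w t =
          c * visitResidual P B a w t +
            ∑ l, d l * (covariates w l * visitResidual P B a w t) := by
        rw [add_mul, Finset.sum_mul]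
        simp only [mul_assoc]
      rw [← this, ← hw, ite_mul, one_mul, zero_mul]
    rw [e, integral_add ((hri a).const_mul _) (integrable_finsetSum _ fun l _ =>
      (hXr a l).const_mul _), integral_const_mul, integral_visitResidual hP, mul_zero, zero_add,
      integral_finsetSum _ fun l _ => (hXr a l).const_mul _]
    simp only [integral_const_mul]
  simp only [h]
  rw [Finset.sum_comm]
  simp only [← Finset.mul_sum, hB, mul_zero, Finset.sum_const_zero]

/-- For residuals that are orthogonal to the covariates at the last visit, the variance under
stratified randomization is the one under simple randomization. -/
lemma asymptoticVariance_visitInfluence_of_normal (hP : DataAssumptions P)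
    (hstrat : Measurable strat) (hS : StrataInCovariates P strat) {B : Fin (k + 1) × Fin p → ℝ}
    (hB : ∀ l, ∑ a, ∫ w, covariates w l * visitResidual P B a w (Fin.last k) ∂P = 0)
    {G : (Fin (k + 1) → Bool) → Fin (k + 1) → ℝ}
    (hG : ∑ m, patternProb P m • G m = Pi.single (Fin.last k) 1) :
    asymptoticVariance P (fun w => strat (covariates w)) (visitInfluence P B G) =
      4 * ∑ m, patternProb P m * (G m ⬝ᵥ (residualCov P B *ᵥ G m)) := by
  have hσ : Measurable fun w : FullData p k => strat (covariates w) :=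
    hstrat.comp measurable_covariates
  rw [asymptoticVariance_of_eq hσ
    (memLp_visitInfluence hP B G), half_sum_integral_visitInfluence_sq hP]
  intro s
  have h := sum_setIntegral_visitResidual hP hstrat hS hB s
  rw [setIntegral_visitInfluence hP hstrat B hG, setIntegral_visitInfluence hP hstrat B hG]
  rw [Fin.sum_univ_two] at h
  simp only [armSign]
  norm_num
  linarith

/-- The variance under simple randomization, for which all participants form one stratum. -/
lemma asymptoticVariance_visitInfluence_unit (hP : DataAssumptions P)
    (B : Fin (k + 1) × Fin p → ℝ) {G : (Fin (k + 1) → Bool) → Fin (k + 1) → ℝ}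
    (hG : ∑ m, patternProb P m • G m = Pi.single (Fin.last k) 1) :
    asymptoticVariance P (fun _ => ()) (visitInfluence P B G) =
      4 * ∑ m, patternProb P m * (G m ⬝ᵥ (residualCov P B *ᵥ G m)) := by
  rw [asymptoticVariance_of_eq measurable_const
    (memLp_visitInfluence hP B G), half_sum_integral_visitInfluence_sq hP]
  intro s
  have h := fun a => setIntegral_visitInfluence hP
    (measurable_const : Measurable fun _ : Fin p → ℝ => ()) B hG a s
  have hu : ((fun _ : FullData p k => ()) ⁻¹' {s}) = Set.univ := by ext; simp
  simp only [hu, setIntegral_univ, integral_visitResidual hP] at h ⊢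
  rw [h, h]
  simp

end Variance

section Comparison

variable {p k : ℕ} {P : Measure (FullData p k)} [IsProbabilityMeasure P]

/-- The change of the residuals when the covariate coefficients change from `B₀` to `B`. -/
def residualShift (P : Measure (FullData p k)) (B₀ B : Fin (k + 1) × Fin p → ℝ)
    (w : FullData p k) (t : Fin (k + 1)) : ℝ :=
  ∑ l, (B₀ (t, l) - B (t, l)) * (covariates w l - ∫ w', covariates w' l ∂P)

omit [IsProbabilityMeasure P] in
lemma visitResidual_eq_add (B₀ B : Fin (k + 1) × Fin p → ℝ) (a : Fin 2) (w : FullData p k)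
    (t : Fin (k + 1)) :
    visitResidual P B a w t = visitResidual P B₀ a w t + residualShift P B₀ B w t := by
  simp only [visitResidual, residualShift, sub_mul, Finset.sum_sub_distrib]
  ring

lemma memLp_residualShift (hP : DataAssumptions P) (B₀ B : Fin (k + 1) × Fin p → ℝ)
    (t : Fin (k + 1)) : MemLp (fun w => residualShift P B₀ B w t) 2 P :=
  memLp_finsetSum _ fun l _ => ((hP.covariates_memLp l).sub (memLp_const _)).const_mul _

/-- Least squares: the residuals are orthogonal to the changes of the residuals. -/
lemma sum_integral_visitResidual_mul_shift (hP : DataAssumptions P)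
    {B₀ : Fin (k + 1) × Fin p → ℝ}
    (hB : ∀ t l, ∑ a, ∫ w, covariates w l * visitResidual P B₀ a w t ∂P = 0)
    (B : Fin (k + 1) × Fin p → ℝ) (t s : Fin (k + 1)) :
    ∑ a, ∫ w, visitResidual P B₀ a w t * residualShift P B₀ B w s ∂P = 0 := by
  have hri : ∀ a, Integrable (fun w => visitResidual P B₀ a w t) P := fun a =>
    (memLp_visitResidual hP B₀ a t).integrable (by norm_num)
  have hXr : ∀ a l, Integrable (fun w => covariates w l * visitResidual P B₀ a w t) P :=
    fun a l => (hP.covariates_memLp l).integrable_mul (memLp_visitResidual hP B₀ a t)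
  have h : ∀ a, ∫ w, visitResidual P B₀ a w t * residualShift P B₀ B w s ∂P =
      ∑ l, (B₀ (s, l) - B (s, l)) * ∫ w, covariates w l * visitResidual P B₀ a w t ∂P := fun a => by
    have e : ∀ w, visitResidual P B₀ a w t * residualShift P B₀ B w s =
        ∑ l, (B₀ (s, l) - B (s, l)) * (covariates w l * visitResidual P B₀ a w t -
          (∫ w', covariates w' l ∂P) * visitResidual P B₀ a w t) := fun w => by
      rw [residualShift, Finset.mul_sum]
      exact Finset.sum_congr rfl fun l _ => by ring
    simp only [e]
    refine (integral_finsetSum _ fun l _ =>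
      ((hXr a l).sub ((hri a).const_mul _)).const_mul _).trans ?_
    refine Finset.sum_congr rfl fun l _ => ?_
    rw [integral_const_mul, integral_sub' (hXr a l) ((hri a).const_mul _), integral_const_mul,
      integral_visitResidual hP, mul_zero, sub_zero]
  simp only [h]
  rw [Finset.sum_comm]
  simp only [← Finset.mul_sum, hB, mul_zero, Finset.sum_const_zero]

/-- The second moments of the residuals split into those of the least squares residuals and those of
the shift. -/
lemma dotProduct_residualCov_mulVec (hP : DataAssumptions P) {B₀ : Fin (k + 1) × Fin p → ℝ}
    (hB : ∀ t l, ∑ a, ∫ w, covariates w l * visitResidual P B₀ a w t ∂P = 0)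
    (B : Fin (k + 1) × Fin p → ℝ) (g : Fin (k + 1) → ℝ) :
    g ⬝ᵥ (residualCov P B *ᵥ g) = g ⬝ᵥ (residualCov P B₀ *ᵥ g) +
      ∫ w, (g ⬝ᵥ residualShift P B₀ B w) ^ 2 ∂P := by
  have hDD : ∀ t s, Integrable (fun w => residualShift P B₀ B w t * residualShift P B₀ B w s) P :=
    fun t s => (memLp_residualShift hP B₀ B t).integrable_mul (memLp_residualShift hP B₀ B s)
  have hRD : ∀ a t s, Integrable (fun w =>
      visitResidual P B₀ a w t * residualShift P B₀ B w s) P := fun a t s =>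
    (memLp_visitResidual hP B₀ a t).integrable_mul (memLp_residualShift hP B₀ B s)
  have hRR : ∀ a t s, Integrable (fun w =>
      visitResidual P B₀ a w t * visitResidual P B₀ a w s) P := fun a t s =>
    (memLp_visitResidual hP B₀ a t).integrable_mul (memLp_visitResidual hP B₀ a s)
  have hentry : ∀ t s, residualCov P B t s = residualCov P B₀ t s +
      ∫ w, residualShift P B₀ B w t * residualShift P B₀ B w s ∂P := fun t s => by
    have e : ∀ a, ∫ w, visitResidual P B a w t * visitResidual P B a w s ∂P =
        ∫ w, visitResidual P B₀ a w t * visitResidual P B₀ a w s ∂P +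
        ∫ w, visitResidual P B₀ a w t * residualShift P B₀ B w s ∂P +
        ∫ w, visitResidual P B₀ a w s * residualShift P B₀ B w t ∂P +
        ∫ w, residualShift P B₀ B w t * residualShift P B₀ B w s ∂P := fun a => by
      have h3 := integral_add ((hRR a t s).add (hRD a t s)) ((hRD a s t).add (hDD t s))
      simp only [Pi.add_apply] at h3
      rw [add_assoc, ← integral_add (hRR a t s) (hRD a t s),
        ← integral_add (hRD a s t) (hDD t s), ← h3]
      refine integral_congr_ae (ae_of_all _ fun w => ?_)
      simp only [visitResidual_eq_add B₀ B]
      ring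
    have h1 := sum_integral_visitResidual_mul_shift hP hB B t s
    have h2 := sum_integral_visitResidual_mul_shift hP hB B s t
    simp only [residualCov, Matrix.of_apply, e, Fin.sum_univ_two] at h1 h2 ⊢
    linarith
  have hsq : ∫ w, (g ⬝ᵥ residualShift P B₀ B w) ^ 2 ∂P =
      ∑ t, ∑ s, g t * (g s * ∫ w, residualShift P B₀ B w t * residualShift P B₀ B w s ∂P) := by
    have e : ∀ w, (g ⬝ᵥ residualShift P B₀ B w) ^ 2 =
        ∑ t, ∑ s, g t * (g s * (residualShift P B₀ B w t * residualShift P B₀ B w s)) := fun w => by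
      rw [sq, dotProduct, Finset.sum_mul_sum]
      exact Finset.sum_congr rfl fun t _ => Finset.sum_congr rfl fun s _ => by ring
    simp only [e]
    rw [integral_finsetSum _ fun t _ => integrable_finsetSum _ fun s _ =>
      ((hDD t s).const_mul _).const_mul _]
    refine Finset.sum_congr rfl fun t _ => ?_
    rw [integral_finsetSum _ fun s _ => ((hDD t s).const_mul _).const_mul _]
    simp only [integral_const_mul]
  rw [hsq]
  simp only [dotProduct, Matrix.mulVec, hentry, Finset.mul_sum]
  simp only [← Finset.sum_add_distrib]
  exact Finset.sum_congr rfl fun t _ => Finset.sum_congr rfl fun s _ => by ring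

lemma sum_patternProb : ∑ m, patternProb P m = 1 := by
  have h := sum_measureReal_preimage_singleton (μ := P) (f := observed 0) Finset.univ
    fun m _ => measurable_observed 0 (measurableSet_singleton m)
  rw [Finset.coe_univ, Set.preimage_univ, probReal_univ] at h
  exact h

variable {𝒮 : Type} [Fintype 𝒮] [DecidableEq 𝒮] [MeasurableSpace 𝒮] [DiscreteMeasurableSpace 𝒮]
  {strat : (Fin p → ℝ) → 𝒮}

omit [DecidableEq 𝒮] in
/-- The part of a function that is explained by the strata has a smaller second moment. -/
lemma sum_sq_setIntegral_le {E : Type} [MeasurableSpace E] {P : Measure E} [IsProbabilityMeasure P]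
    {σ : E → 𝒮} (hσ : Measurable σ) {D : E → ℝ} (hD : MemLp D 2 P) :
    ∑ s, (P.real (σ ⁻¹' {s}))⁻¹ * (∫ w in σ ⁻¹' {s}, D w ∂P) ^ 2 ≤ ∫ w, D w ^ 2 ∂P := by
  have hf : ∀ a, MemLp (fun w => armSign a * D w) 2 P := fun a => hD.const_mul _
  have h := asymptoticVariance_nonneg P σ fun a w => armSign a * D w
  rw [asymptoticVariance_eq hσ hf] at h
  simp only [integral_const_mul, Fin.sum_univ_two, mul_pow, armSign] at h
  have e : ∀ x : ℝ, (x + x) ^ 2 = 4 * x ^ 2 := fun x => by ring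
  norm_num [e, mul_left_comm _ (4 : ℝ), ← Finset.mul_sum] at h
  linarith

/-- Among the estimators that weight residuals, weighting the least squares residuals by the optimal
weights has the smallest asymptotic variance. -/
lemma asymptoticVariance_visitInfluence_le (hP : DataAssumptions P) (hstrat : Measurable strat)
    (hS : StrataInCovariates P strat) {B₀ : Fin (k + 1) × Fin p → ℝ}
    (hB : ∀ t l, ∑ a, ∫ w, covariates w l * visitResidual P B₀ a w t ∂P = 0)
    (hpd : (residualCov P B₀).PosDef) (B : Fin (k + 1) × Fin p → ℝ)
    {G : (Fin (k + 1) → Bool) → Fin (k + 1) → ℝ} (hG0 : ∀ m t, m t = false → G m t = 0)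
    (hG : ∑ m, patternProb P m • G m = Pi.single (Fin.last k) 1) :
    asymptoticVariance P (fun w => strat (covariates w))
        (visitInfluence P B₀ (mmrmWeight P (residualCov P B₀))) ≤
      asymptoticVariance P (fun w => strat (covariates w)) (visitInfluence P B G) := by
  set D := residualShift P B₀ B with hD
  set c : Fin (k + 1) → ℝ := Pi.single (Fin.last k) 1 with hc
  have hσ : Measurable fun w : FullData p k => strat (covariates w) :=
    hstrat.comp measurable_covariates
  have hD2 : ∀ t, MemLp (fun w => D w t) 2 P := memLp_residualShift hP B₀ B
  rw [asymptoticVariance_visitInfluence_of_normal hP hstrat hS (hB (Fin.last k))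
    (sum_mmrmWeight hP hpd)]
  simp only [mmrmWeight_eq_mulVec hpd]
  have hopt := sum_variance_obsPrecision hpd patternProb_nonneg (patternProb_full_pos hP) (c := c)
  rw [← meanPrecision] at hopt
  rw [hopt]
  have hgls := dotProduct_inv_le_sum_variance hpd patternProb_nonneg (patternProb_full_pos hP)
    hG0 hG
  rw [← meanPrecision] at hgls
  rw [asymptoticVariance_eq hσ (memLp_visitInfluence hP B G),
    half_sum_integral_visitInfluence_sq hP]
  simp only [dotProduct_residualCov_mulVec hP hB B, mul_add, Finset.sum_add_distrib]
  -- the difference of the arms within a stratum stems from the shift alone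
  have hstr : ∀ s, ∫ w in (fun w : FullData p k => strat (covariates w)) ⁻¹' {s},
        visitInfluence P B G 1 w ∂P -
      ∫ w in (fun w : FullData p k => strat (covariates w)) ⁻¹' {s}, visitInfluence P B G 0 w ∂P =
      4 * ∫ w in (fun w : FullData p k => strat (covariates w)) ⁻¹' {s}, D w (Fin.last k) ∂P := by
    intro s
    have h := sum_setIntegral_visitResidual hP hstrat hS (hB (Fin.last k)) s
    rw [setIntegral_visitInfluence hP hstrat B hG, setIntegral_visitInfluence hP hstrat B hG]
    have e : ∀ a, ∫ w in (fun w : FullData p k => strat (covariates w)) ⁻¹' {s},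
        visitResidual P B a w (Fin.last k) ∂P =
        ∫ w in (fun w : FullData p k => strat (covariates w)) ⁻¹' {s},
          visitResidual P B₀ a w (Fin.last k) ∂P +
        ∫ w in (fun w : FullData p k => strat (covariates w)) ⁻¹' {s}, D w (Fin.last k) ∂P :=
      fun a => by
        simp only [visitResidual_eq_add B₀ B]
        exact integral_add ((memLp_visitResidual hP B₀ a _).integrable (by norm_num)).integrableOn
          ((hD2 _).integrable (by norm_num)).integrableOn
    rw [e, e]
    rw [Fin.sum_univ_two] at h
    simp only [armSign]
    norm_num
    linarith
  simp only [hstr]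
  have hstrata := sum_sq_setIntegral_le hσ (hD2 (Fin.last k))
  -- Jensen's inequality for the pattern of missingness
  have hjensen : ∫ w, D w (Fin.last k) ^ 2 ∂P ≤
      ∑ m, patternProb P m * ∫ w, (G m ⬝ᵥ D w) ^ 2 ∂P := by
    have hGD : ∀ m, MemLp (fun w => G m ⬝ᵥ D w) 2 P := fun m =>
      memLp_finsetSum _ fun t _ => (hD2 t).const_mul _
    simp only [← integral_const_mul]
    rw [← integral_finsetSum _ fun m _ => (hGD m).integrable_sq.const_mul _]
    refine integral_mono (hD2 _).integrable_sq
      (integrable_finsetSum _ fun m _ => (hGD m).integrable_sq.const_mul _) fun w => ?_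
    have hmean : D w (Fin.last k) = ∑ m, patternProb P m • (G m ⬝ᵥ D w) := by
      have : ∑ m, patternProb P m • (G m ⬝ᵥ D w) = c ⬝ᵥ D w := by
        rw [← hG, sum_dotProduct]
        exact Finset.sum_congr rfl fun m _ => (smul_dotProduct _ _ _).symm
      rw [this, hc, single_dotProduct, one_mul]
    have hconv := (even_two.convexOn_pow (𝕜 := ℝ)).map_sum_le (t := Finset.univ)
      (w := patternProb P) (p := fun m => G m ⬝ᵥ D w) (fun m _ => patternProb_nonneg m)
      sum_patternProb (fun m _ => Set.mem_univ _)
    dsimp only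
    rw [hmean]
    simpa only [smul_eq_mul] using hconv
  have hquart : ∀ s, (P.real ((fun w : FullData p k => strat (covariates w)) ⁻¹' {s}))⁻¹ *
      (4 * ∫ w in (fun w : FullData p k => strat (covariates w)) ⁻¹' {s},
        D w (Fin.last k) ∂P) ^ 2 =
      16 * ((P.real ((fun w : FullData p k => strat (covariates w)) ⁻¹' {s}))⁻¹ *
      (∫ w in (fun w : FullData p k => strat (covariates w)) ⁻¹' {s},
        D w (Fin.last k) ∂P) ^ 2) := fun s => by ring
  simp only [hquart, ← Finset.mul_sum]
  linarith

end Comparison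

end RepeatedMeasures

end

open RepeatedMeasures in
theorem corollary2 {p k : ℕ} (P : Measure (FullData p k)) [IsProbabilityMeasure P]
    (hP : DataAssumptions P)
    {𝒮 : Type} [Fintype 𝒮] [DecidableEq 𝒮] [MeasurableSpace 𝒮] [DiscreteMeasurableSpace 𝒮]
    (strat : (Fin p → ℝ) → 𝒮) (hstrat : Measurable strat) (hS : StrataInCovariates P strat)
    (ΘA : Set (AncovaIndex p → ℝ)) (θA : AncovaIndex p → ℝ)
    (hA : RegularityConditions P (ancovaPsi p k) ΘA θA)
    (ΘI : Set (MmrmIndex k (Fin p) → ℝ)) (θI : MmrmIndex k (Fin p) → ℝ)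
    (hΘI : ∀ θ ∈ ΘI, (mmrmCov θ).PosDef)
    (hI : RegularityConditions P (mmrmPsi k (mmrmOneDesign p k)) ΘI θI)
    (ΘII : Set (MmrmIndex k (Fin (k + 1) × Fin p) → ℝ))
    (θII : MmrmIndex k (Fin (k + 1) × Fin p) → ℝ)
    (hΘII : ∀ θ ∈ ΘII, (mmrmCov θ).PosDef)
    (hII : RegularityConditions P (mmrmPsi k (mmrmTwoDesign p k)) ΘII θII) :
    ∃ vA vI vII : ℝ≥0,
      HasAsymptoticVariance P (SimpleRandomization p k)
        (ancovaPsi p k) ΘA (ancovaEffect p) vA ∧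
      HasAsymptoticVariance P (StratifiedRandomization k strat)
        (ancovaPsi p k) ΘA (ancovaEffect p) vA ∧
      HasAsymptoticVariance P (SimpleRandomization p k)
        (mmrmPsi k (mmrmTwoDesign p k)) ΘII (mmrmEffect k _) vII ∧
      HasAsymptoticVariance P (StratifiedRandomization k strat)
        (mmrmPsi k (mmrmTwoDesign p k)) ΘII (mmrmEffect k _) vII ∧
      HasAsymptoticVariance P (StratifiedRandomization k strat)
        (mmrmPsi k (mmrmOneDesign p k)) ΘI (mmrmEffect k _) vI ∧
      vII ≤ vA ∧ vII ≤ vI := by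
  have hIpd : (mmrmCov θI).PosDef := hΘI θI (interior_subset hI.mem_interior)
  have hIIpd : (mmrmCov θII).PosDef := hΘII θII (interior_subset hII.mem_interior)
  have hσ : Measurable fun w : FullData p k => strat (covariates w) :=
    hstrat.comp measurable_covariates
  have hXm : ∀ l, Measurable fun x : Fin p → ℝ => x l := measurable_pi_apply
  have hone : ∀ q t, Measurable fun x => mmrmOneDesign p k x q t := fun q _ => hXm q
  have hone2 : ∀ q t, MemLp (fun w => mmrmOneDesign p k (covariates w) q t) 2 P :=
    fun q _ => hP.covariates_memLp q
  have htwo : ∀ q t, Measurable fun x => mmrmTwoDesign p k x q t := fun q t => by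
    simp only [mmrmTwoDesign, Matrix.of_apply]
    split_ifs
    exacts [hXm _, measurable_const]
  have htwo2 : ∀ q t, MemLp (fun w => mmrmTwoDesign p k (covariates w) q t) 2 P := fun q t => by
    simp only [mmrmTwoDesign, Matrix.of_apply]
    split_ifs
    exacts [hP.covariates_memLp _, memLp_const _]
  set BA : Fin (k + 1) × Fin p → ℝ := fun tl => θA (.inr (.inr tl.2)) with hBA
  set BI : Fin (k + 1) × Fin p → ℝ := fun tl => θI (.inr (.inr (.inl tl.2))) with hBI
  set BII : Fin (k + 1) × Fin p → ℝ := fun tl => θII (.inr (.inr (.inl tl))) with hBII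
  have hnA := hA.ancova_normal_equations hP
  have hnII := hII.mmrm_normal_equations hP hIIpd
  have hcov := hII.mmrmCov_eq_residualCov hP hIIpd
  have hsimple : ∀ (Ω : Type) [MeasurableSpace Ω] (μ : Measure Ω) [IsProbabilityMeasure μ]
      (W : ℕ → Ω → FullData p k) (A : ℕ → Ω → Fin 2), IsIIDSample P μ W →
        SimpleRandomization p k μ W A → BalancedTrial P (fun _ => ()) μ W A :=
    fun Ω _ μ _ W A => BalancedTrial.of_simple
  have hstratified : ∀ (Ω : Type) [MeasurableSpace Ω] (μ : Measure Ω) [IsProbabilityMeasure μ]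
      (W : ℕ → Ω → FullData p k) (A : ℕ → Ω → Fin 2), IsIIDSample P μ W →
        StratifiedRandomization k strat μ W A →
          BalancedTrial P (fun w => strat (covariates w)) μ W A :=
    fun Ω _ μ _ W A => BalancedTrial.of_stratified hstrat
  -- with simple randomization there is a single stratum; the normal equations remove the effect of
  -- the strata on the variance
  have hAeq : asymptoticVariance P (fun _ => ()) (visitInfluence P BA (ancovaWeight P)) =
      asymptoticVariance P (fun w => strat (covariates w))
        (visitInfluence P BA (ancovaWeight P)) := by
    rw [asymptoticVariance_visitInfluence_unit hP BA (sum_ancovaWeight hP),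
      asymptoticVariance_visitInfluence_of_normal hP hstrat hS hnA (sum_ancovaWeight hP)]
  have hIIeq : asymptoticVariance P (fun _ => ())
        (visitInfluence P BII (mmrmWeight P (mmrmCov θII))) =
      asymptoticVariance P (fun w => strat (covariates w))
        (visitInfluence P BII (mmrmWeight P (mmrmCov θII))) := by
    rw [asymptoticVariance_visitInfluence_unit hP BII (sum_mmrmWeight hP hIIpd),
      asymptoticVariance_visitInfluence_of_normal hP hstrat hS (hnII (Fin.last k))
        (sum_mmrmWeight hP hIIpd)]
  have hle := fun (B : Fin (k + 1) × Fin p → ℝ) (G : (Fin (k + 1) → Bool) → Fin (k + 1) → ℝ) =>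
    asymptoticVariance_visitInfluence_le (G := G) hP hstrat hS hnII (hcov ▸ hIIpd) B
  refine ⟨(asymptoticVariance P (fun w => strat (covariates w))
      (visitInfluence P BA (ancovaWeight P))).toNNReal,
    (asymptoticVariance P (fun w => strat (covariates w))
      (visitInfluence P BI (mmrmWeight P (mmrmCov θI)))).toNNReal,
    (asymptoticVariance P (fun w => strat (covariates w))
      (visitInfluence P BII (mmrmWeight P (mmrmCov θII)))).toNNReal, ?_, ?_, ?_, ?_, ?_, ?_, ?_⟩
  · rw [← hAeq]
    exact hasAsymptoticVariance_ancova hP measurable_const hsimple hA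
  · exact hasAsymptoticVariance_ancova hP hσ hstratified hA
  · rw [← hIIeq, ← influence_mmrmTwoDesign]
    exact hasAsymptoticVariance_mmrm hP measurable_const hsimple htwo htwo2 hII hIIpd
  · rw [← influence_mmrmTwoDesign]
    exact hasAsymptoticVariance_mmrm hP hσ hstratified htwo htwo2 hII hIIpd
  · exact hasAsymptoticVariance_mmrm hP hσ hstratified hone hone2 hI hIpd
  · rw [hcov]
    exact Real.toNNReal_le_toNNReal
      (hle BA _ (fun m t => ancovaWeight_eq_zero) (sum_ancovaWeight hP))
  · nth_rewrite 1 [hcov]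
    exact Real.toNNReal_le_toNNReal
      (hle BI _ (fun m t => mmrmWeight_eq_zero hIpd) (sum_mmrmWeight hP hIpd))
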